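/- Let $\xi=(\xi_t)_{t\ge 0}$, $\xi_0=0$, be a (strictly) $\alpha$-stable Lévy process without positive jumps, where either $\alpha\in(1,2)$ and $\xi$ has Lévy measure $c_-|x|^{-(1+\alpha)}\mathbf 1_{(-\infty,0)}(x)\,\mathrm dx$ with $c_->0$, or $\alpha=1$ and $\xi$ is the drift $\xi_t=-\eta t$ with $\eta<0$. Put $C_1(\alpha):=\log \mathbf E\big(e^{\xi_1}\big)$; one has $0<C_1(\alpha)<\infty$. Let $(p_k)_{k\ge0}$ be a probability distribution on $\{0,1,2,\dots\}$ with $m:=\sum_{k\ge 0} k\,p_k<1$ and $\sum_{k\ge 1}k(\log k)\,p_k<\infty$. Consider the branching Lévy process with spatial motion $\xi$, branching rate $1$ and offspring distribution $(p_k)$: it starts at time $0$ from one particle at $0$; every particle moves from its place of birth as a copy of $\xi$, lives an exponential time with parameter $1$ independent of the motion, and at its death, at the place where it dies, is replaced by $k$ new particles with probability $p_k$, $k\ge 0$; all particles move, live and reproduce independently of each other. Let $N_t$ be the set of particles alive at time $t$, $X_u(t)$ the position of $u\in N_t$, and $$M:=\sup_{t>0}\,\sup_{u\in N_t}X_u(t)$$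 the maximal position. Then there is a constant $C_4(\alpha)\in(0,\infty)$, depending only on the law of $\xi$ and on $(p_k)$, such that $$\lim_{x\to+\infty} e^{\left((1-m)/C_1(\alpha)\right)^{1/\alpha}x}\;\mathbb P(M\ge x)=C_4(\alpha).$$ -/

import Mathlib

open MeasureTheory ProbabilityTheory Filter Topology
open scoped NNReal ENNReal

noncomputable section

/-! ### Lévy processes and stable processes -/

/-- A path on `[0, ∞)` is càdlàg: right-continuous with left limits. -/
def IsCadlag (f : ℝ≥0 → ℝ) : Prop :=
  ∀ t, ContinuousWithinAt f (Set.Ici t) t ∧ ∃ l, Tendsto f (𝓝[<] t) (𝓝 l)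

/-- A real-valued Lévy process started from `0`. -/
structure IsLevyProcess {Ω : Type*} [MeasurableSpace Ω] (ξ : ℝ≥0 → Ω → ℝ) (P : Measure Ω) :
    Prop where
  measurable : ∀ t, Measurable (ξ t)
  start_zero : ∀ᵐ ω ∂P, ξ 0 ω = 0
  cadlag : ∀ᵐ ω ∂P, IsCadlag (fun t => ξ t ω)
  indep_increments : HasIndepIncrements ξ P
  stationary_increments : ∀ s t, IdentDistrib (fun ω => ξ (s + t) ω - ξ s ω) (ξ t) P P

/-- The measure `c₊ x^{-(1+α)} 1_{x > 0} dx + c₋ |x|^{-(1+α)} 1_{x < 0} dx`. -/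
def stableLevyMeasure (α cPos cNeg : ℝ) : Measure ℝ :=
  volume.withDensity fun x => ENNReal.ofReal
    (if 0 < x then cPos * x ^ (-(1 + α)) else if x < 0 then cNeg * |x| ^ (-(1 + α)) else 0)

/-- The Lévy–Khintchine exponent with drift `b`, Gaussian variance `σsq` and Lévy measure `ν`:
`-i b θ + σsq θ² / 2 + ∫ (1 - e^{iθx} + iθx 1_{|x| < 1}) ν(dx)`. -/
def levyKhintchineExponent (b : ℝ) (σsq : ℝ≥0) (ν : Measure ℝ) (θ : ℝ) : ℂ :=
  -(Complex.I * b * θ) + σsq * θ ^ 2 / 2 +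
    ∫ x : ℝ, (1 - Complex.exp (Complex.I * θ * x) +
      (if |x| < 1 then Complex.I * θ * x else 0)) ∂ν

/-- `ν` is a Lévy measure, and `ξ` has Lévy–Khintchine triplet `(b, σsq, ν)`. -/
structure HasLevyTriplet {Ω : Type*} [MeasurableSpace Ω] (ξ : ℝ≥0 → Ω → ℝ) (P : Measure Ω)
    (b : ℝ) (σsq : ℝ≥0) (ν : Measure ℝ) : Prop where
  measure_zero : ν {0} = 0
  lintegral_lt_top : ∫⁻ x, ENNReal.ofReal (min 1 (x ^ 2)) ∂ν < ∞
  charFun_eq : ∀ (t : ℝ≥0) (θ : ℝ),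
    charFun (P.map (ξ t)) θ = Complex.exp (-(t : ℂ) * levyKhintchineExponent b σsq ν θ)

/-- `ξ` is a strictly `α`-stable process (a Lévy process such that `(ξ_{a t})_t` and
`(a^{1/α} ξ_t)_t` have the same law for every `a > 0`) with Lévy measure
`c₊ x^{-(1+α)} 1_{x > 0} dx + c₋ |x|^{-(1+α)} 1_{x < 0} dx`.

The parameter `η` matters only for `α = 1`. Strict stability then forces `c₊ = c₋ =: c`, the
truncated integral in the Lévy–Khintchine exponent is `π c |θ|`, and the exponent is
`π c |θ| + i η θ`, that is, the drift of the triplet is `-η`. For `α ≠ 1` drift and Gaussian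
variance are determined by the scaling property. -/
structure IsStrictlyStableProcess {Ω : Type*} [MeasurableSpace Ω] (α cPos cNeg η : ℝ)
    (ξ : ℝ≥0 → Ω → ℝ) (P : Measure Ω) : Prop where
  levy : IsLevyProcess ξ P
  scaling : ∀ a : ℝ≥0, 0 < a →
    IdentDistrib (fun ω t => ξ (a * t) ω) (fun ω t => (a : ℝ) ^ (1 / α) * ξ t ω) P P
  triplet : ∃ (b : ℝ) (σsq : ℝ≥0),
    HasLevyTriplet ξ P b σsq (stableLevyMeasure α cPos cNeg) ∧ (α = 1 → b = -η)

/-- `C₁ = log E[e^{ξ_1}] = -Ψ(-i)`, where `Ψ(θ) = -log E[e^{iθ ξ_1}]`. -/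
def laplaceConstant {Ω : Type*} [MeasurableSpace Ω] (ξ : ℝ≥0 → Ω → ℝ) (P : Measure Ω) : ℝ :=
  Real.log (∫ ω, Real.exp (ξ 1 ω) ∂P)

/-! ### Branching Lévy processes -/

/-- Labels of particles: `[]` is the ancestor, `i :: u` is the `i`-th child of `u`. -/
abbrev Label := List ℕ

/-- The random data from which a branching process is built: every potential particle `u` has
a displacement path (relative to its birth place, in its own age), a lifetime and a number of
children. -/
structure BranchingData (Ω : Type*) where
  /-- displacement of the particle at a given age -/
  disp : Label → ℝ≥0 → Ω → ℝ
  /-- lifetime of the particle -/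
  life : Label → Ω → ℝ≥0
  /-- number of children of the particle -/
  offspring : Label → Ω → ℕ

namespace BranchingData

variable {Ω : Type*}

/-- The particle `u` is ever born. -/
def Born (Z : BranchingData Ω) : Label → Ω → Prop
  | [], _ => True
  | i :: u, ω => Z.Born u ω ∧ i < Z.offspring u ω

/-- Birth time: the ancestor is born at time `0`, children at the death of their parent. -/
def birthTime (Z : BranchingData Ω) : Label → Ω → ℝ≥0
  | [], _ => 0
  | _ :: u, ω => Z.birthTime u ω + Z.life u ω

/-- Birth place: the ancestor is born at `0`, children at the place of death of their parent. -/
def birthPlace (Z : BranchingData Ω) : Label → Ω → ℝ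
  | [], _ => 0
  | _ :: u, ω => Z.birthPlace u ω + Z.disp u (Z.life u ω) ω

/-- The set `N_t` of particles alive at time `t`. -/
def alive (Z : BranchingData Ω) (t : ℝ≥0) (ω : Ω) : Set Label :=
  {u | Z.Born u ω ∧ Z.birthTime u ω ≤ t ∧ t < Z.birthTime u ω + Z.life u ω}

/-- The position `X_u(t)` of the particle `u` at time `t` (meaningful for `u ∈ N_t`). -/
def position (Z : BranchingData Ω) (u : Label) (t : ℝ≥0) (ω : Ω) : ℝ :=
  Z.birthPlace u ω + Z.disp u (t - Z.birthTime u ω) ω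

/-- The maximal position `M = sup_{t > 0} sup_{u ∈ N_t} X_u(t)`. -/
def maxPosition (Z : BranchingData Ω) (ω : Ω) : EReal :=
  ⨆ (t : ℝ≥0) (_ : 0 < t) (u : Label) (_ : u ∈ Z.alive t ω), (Z.position u t ω : EReal)

end BranchingData

/-- `Z`, under `P`, is a branching Lévy process started from one particle at `0`, with branching
rate `1`, spatial motion `ξ` (a Lévy process under `P₀`) and offspring law `p`. -/
structure IsBranchingLevyProcess {Ω : Type*} [MeasurableSpace Ω] (Z : BranchingData Ω)
    (P : Measure Ω) {Ω₀ : Type*} [MeasurableSpace Ω₀] (ξ : ℝ≥0 → Ω₀ → ℝ) (P₀ : Measure Ω₀) (p : PMF ℕ) :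
    Prop where
  measurable_disp : ∀ u t, Measurable (Z.disp u t)
  measurable_life : ∀ u, Measurable (Z.life u)
  measurable_offspring : ∀ u, Measurable (Z.offspring u)
  cadlag_disp : ∀ u, ∀ᵐ ω ∂P, IsCadlag (fun t => Z.disp u t ω)
  law_disp : ∀ u, IdentDistrib (fun ω t => Z.disp u t ω) (fun ω t => ξ t ω) P P₀
  law_life : ∀ u, HasLaw (fun ω => (Z.life u ω : ℝ)) (expMeasure 1) P
  law_offspring : ∀ u, HasLaw (Z.offspring u) p.toMeasure P
  /-- displacement, lifetime and number of children of one particle are independent -/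
  indep_life_offspring : ∀ u, IndepFun (Z.life u) (Z.offspring u) P
  indep_disp : ∀ u,
    IndepFun (fun ω t => Z.disp u t ω) (fun ω => (Z.life u ω, Z.offspring u ω)) P
  /-- different particles are independent -/
  indep : iIndepFun (fun u ω => ((fun t => Z.disp u t ω), Z.life u ω, Z.offspring u ω)) P


/-- The mean `∑ k p_k` of an offspring law. -/
def offspringMean (p : PMF ℕ) : ℝ≥0∞ := ∑' k : ℕ, (k : ℝ≥0∞) * p k

end

/-! Let `T` be the lifetime of one particle, `S` the supremum of its motion before `T`, `Y` its
displacement at `T`, and `D = S - Y`. Write `C` for `laplaceConstant ξ P₀`. Since there are no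
positive jumps, `S` is exponential with rate `ρ = C^(-1/α)`; moreover `S` and `D ≥ 0` are
independent, and the law `ν` of `D` satisfies `ρ (1 - C θ^α) E[e^(-θD)] = ρ - θ` for `0 ≤ θ < ρ`
(`IsStrictlyStableProcess.exists_map_killedSup_killedEnd`).

Let `f` be the offspring generating function and `F v = 1 - f (1 - v)`. Conditioning on the
ancestor, with `r = x - S`, turns the tail `u x = P(M > x)` into a solution of `e^(ρx) u x = 1 + ∫₀ˣ
ρ e^(ρr) E[F (u (r + D))] dr`. The tails of the maximum over the first `n` generations are the
successive approximations of this equation (`isRenewalIteration_treeTail`), and `u` is their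
supremum. Choose `lam` with `C lam^α = 1 - m`. The transform of `ν` then gives `ρ m E[e^(-lam D)] =
ρ - lam`, which says that `e^(-lam x)` solves the equation linearized by `F v ≈ m v`.

Because `F v ≤ m v`, comparison from an arbitrary level `y` yields `u (y + x) ≤ e^(-lam x) u y`
(`le_exp_mul_iSup`). Hence `e^(lam x) u x` is nonincreasing and converges with no further renewal
argument. Only positivity of the limit is left, and this is where the `k log k` moment enters. If `F
s ≥ m s e^(-a x)` for `s ≤ e^(-lam x)`, then `exp (-lam x - K ∫₀ˣ a)` is a subsolution for a
suitable `K` (`exists_pos_le_exp_mul_iSup`), and the moment condition bounds `∫ a`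
(`exists_integral_linearizationDefect_le`).

The facts about `S` and `D` come from dyadic grids, on which the motion up to `T` is a random walk
killed at a memoryless time. The strong Markov property at first passages gives independence of the
maximum and the distance to it on every grid. It also gives multiplicativity of the tail of the
maximum up to an overshoot, which disappears with the mesh by a Chernoff bound. The rate is read off
from the blow-up of `E[e^(θY)]`. The Laplace transform `E[e^(θ ξ_t)] = e^(t C θ^α)` follows from
scaling once exponential moments are known to exist, and these come from compound Poisson
approximation of the Lévy–Khintchine law. -/

/-! ### The integral equation for the tail and its successive approximations. -/

/-- `F` behaves on `[0, 1]` like `v ↦ 1 - f (1 - v)` for a generating function `f` of mean `m`. -/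
structure IsSurvivalFunction (m : ℝ) (F : ℝ → ℝ) : Prop where
  map_zero : F 0 = 0
  monotoneOn : MonotoneOn F (Set.Icc 0 1)
  sub_le : ∀ v w, 0 ≤ v → v ≤ w → w ≤ 1 → F w - F v ≤ m * (w - v)

namespace IsSurvivalFunction

variable {m : ℝ} {F : ℝ → ℝ}

lemma le_mul (hF : IsSurvivalFunction m F) {v : ℝ} (h0 : 0 ≤ v) (h1 : v ≤ 1) : F v ≤ m * v := by
  simpa [hF.map_zero] using hF.sub_le 0 v le_rfl h0 h1

lemma nonneg (hF : IsSurvivalFunction m F) {v : ℝ} (h0 : 0 ≤ v) (h1 : v ≤ 1) : 0 ≤ F v := by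
  simpa [hF.map_zero] using hF.monotoneOn ⟨le_rfl, zero_le_one⟩ ⟨h0, h1⟩ h0

lemma integrable_comp_shift (hF : IsSurvivalFunction m F) {ν : Measure ℝ} [IsProbabilityMeasure ν]
    {v : ℝ → ℝ} (hv : Antitone v) (h0 : ∀ x, 0 ≤ v x) (h1 : ∀ x, v x ≤ 1) (r : ℝ) :
    Integrable (fun d => F (v (r + d))) ν := by
  have hanti : Antitone fun d => F (v (r + d)) := fun a b hab =>
    hF.monotoneOn ⟨h0 _, h1 _⟩ ⟨h0 _, h1 _⟩ (hv (by linarith))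
  refine Integrable.of_bound (C := F 1) hanti.measurable.aestronglyMeasurable
    (ae_of_all _ fun d => ?_)
  rw [Real.norm_of_nonneg (hF.nonneg (h0 _) (h1 _))]
  exact hF.monotoneOn ⟨h0 _, h1 _⟩ ⟨zero_le_one, le_rfl⟩ (h1 _)

end IsSurvivalFunction

/-- The successive approximations of the renewal-type equation satisfied by the tail of the
maximal position of a branching process, where `ρ` is the rate of the running supremum of one
particle and `ν` the law of its distance to the running supremum at the time of its death. -/
structure IsRenewalIteration (ρ : ℝ) (F : ℝ → ℝ) (ν : Measure ℝ) (u : ℕ → ℝ → ℝ) : Prop where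
  zero : ∀ x, 0 ≤ x → u 0 x = 0
  nonneg : ∀ n x, 0 ≤ u n x
  le_one : ∀ n x, u n x ≤ 1
  anti : ∀ n, Antitone (u n)
  succ : ∀ n x, 0 ≤ x → Real.exp (ρ * x) * u (n + 1) x =
    1 + ∫ r in 0..x, ρ * Real.exp (ρ * r) * ∫ d, F (u n (r + d)) ∂ν

lemma integral_mul_exp_mul {c : ℝ} (a b : ℝ) :
    ∫ r in a..b, c * Real.exp (c * r) = Real.exp (c * b) - Real.exp (c * a) := by
  have h : ∀ r ∈ Set.uIcc a b,
      HasDerivAt (fun r => Real.exp (c * r)) (c * Real.exp (c * r)) r := fun r _ => by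
    have := ((hasDerivAt_id r).const_mul c).exp
    simpa [mul_comm] using this
  exact intervalIntegral.integral_eq_sub_of_hasDerivAt h
    (Continuous.intervalIntegrable (by fun_prop) _ _)

namespace IsRenewalIteration

variable {ρ m lam : ℝ} {F : ℝ → ℝ} {ν : Measure ℝ} {u : ℕ → ℝ → ℝ}

lemma bddAbove (hu : IsRenewalIteration ρ F ν u) (x : ℝ) : BddAbove (Set.range fun n => u n x) :=
  ⟨1, by rintro _ ⟨n, rfl⟩; exact hu.le_one n x⟩

/-- The constant term of the equation, that is the supremum of the ancestor's own path, already has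
tail `e^(-ρx)`. This lower bound suffices when `m = 0`, where `lam = ρ`. -/
lemma exp_neg_le_iSup (hu : IsRenewalIteration ρ F ν u) (hF : IsSurvivalFunction m F)
    (hρ : 0 < ρ) {x : ℝ} (hx : 0 ≤ x) : 1 ≤ Real.exp (ρ * x) * ⨆ n, u n x := by
  have h := hu.succ 0 x hx
  have h0 : 0 ≤ ∫ r in 0..x, ρ * Real.exp (ρ * r) * ∫ d, F (u 0 (r + d)) ∂ν :=
    intervalIntegral.integral_nonneg hx fun r _ => mul_nonneg (by positivity)
      (integral_nonneg fun d => hF.nonneg (hu.nonneg _ _) (hu.le_one _ _))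
  have := mul_le_mul_of_nonneg_left (le_ciSup (hu.bddAbove x) 1) (Real.exp_pos (ρ * x)).le
  simp only [zero_add] at h
  linarith

variable [IsProbabilityMeasure ν]

lemma intervalIntegrable (hu : IsRenewalIteration ρ F ν u) (hF : IsSurvivalFunction m F)
    (n : ℕ) (a b : ℝ) :
    IntervalIntegrable (fun r => ρ * Real.exp (ρ * r) * ∫ d, F (u n (r + d)) ∂ν) volume a b := by
  have hanti : Antitone fun r => ∫ d, F (u n (r + d)) ∂ν := fun r s hrs =>
    integral_mono (hF.integrable_comp_shift (hu.anti n) (hu.nonneg n) (hu.le_one n) _)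
      (hF.integrable_comp_shift (hu.anti n) (hu.nonneg n) (hu.le_one n) _) fun d =>
      hF.monotoneOn ⟨hu.nonneg _ _, hu.le_one _ _⟩ ⟨hu.nonneg _ _, hu.le_one _ _⟩
        (hu.anti n (by simpa using hrs))
  exact hanti.intervalIntegrable.continuousOn_mul (by fun_prop)

/-- Induction on the generation, with the integral split at `y`. The part up to `y` reassembles to
`e^(ρy) u (n+1) y`, at most `e^(ρy) U`. On the rest, `F v ≤ m v` and the induction hypothesis reduce
the claim to the linear equation, which `e^(-lam x)` solves exactly by `hlap`. -/
lemma le_exp_mul_iSup (hu : IsRenewalIteration ρ F ν u) (hF : IsSurvivalFunction m F)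
    (hρ : 0 < ρ) (hm : 0 ≤ m) (hlam : 0 < lam) (hν : ∀ᵐ d ∂ν, 0 ≤ d)
    (hlap : ρ * m * ∫ d, Real.exp (-lam * d) ∂ν = ρ - lam) (n : ℕ) {x y : ℝ} (hx : 0 ≤ x)
    (hy : 0 ≤ y) : u n (y + x) ≤ Real.exp (-lam * x) * ⨆ k, u k y := by
  set U := ⨆ k, u k y with hU
  have hU0 : 0 ≤ U := Real.iSup_nonneg fun k => hu.nonneg k y
  have hexpint : Integrable (fun d => Real.exp (-lam * d)) ν := by
    refine Integrable.of_bound (C := 1) (by fun_prop) ?_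
    filter_upwards [hν] with d hd
    rw [Real.norm_of_nonneg (Real.exp_pos _).le]
    exact Real.exp_le_one_iff.2 (by nlinarith)
  induction n generalizing x with
  | zero => rw [hu.zero _ (by linarith)]; positivity
  | succ n ih =>
    have h1 := hu.succ n (y + x) (by linarith)
    have h2 := hu.succ n y hy
    rw [← intervalIntegral.integral_add_adjacent_intervals
      (hu.intervalIntegrable hF n 0 y) (hu.intervalIntegrable hF n y (y + x)), ← add_assoc,
      ← h2] at h1
    have hle : u (n + 1) y ≤ U := le_ciSup (hu.bddAbove y) (n + 1)
    have hq : ∀ r, y ≤ r → ∫ d, F (u n (r + d)) ∂ν ≤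
        m * (Real.exp (-lam * (r - y)) * U * ∫ d, Real.exp (-lam * d) ∂ν) := fun r hr => by
      rw [← integral_const_mul, ← integral_const_mul]
      refine integral_mono_ae
        (hF.integrable_comp_shift (hu.anti n) (hu.nonneg n) (hu.le_one n) _)
        ((hexpint.const_mul _).const_mul _) ?_
      filter_upwards [hν] with d hd
      refine (hF.le_mul (hu.nonneg _ _) (hu.le_one _ _)).trans
        (mul_le_mul_of_nonneg_left ?_ hm)
      have := ih (x := r - y + d) (by linarith)
      rw [show y + (r - y + d) = r + d by ring] at this
      refine this.trans (le_of_eq ?_)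
      rw [show -lam * (r - y + d) = -lam * (r - y) + -lam * d by ring, Real.exp_add]
      ring
    have hint : ∫ r in y..(y + x), ρ * Real.exp (ρ * r) * ∫ d, F (u n (r + d)) ∂ν ≤
        ∫ r in y..(y + x), (Real.exp (lam * y) * U) * ((ρ - lam) * Real.exp ((ρ - lam) * r)) := by
      refine intervalIntegral.integral_mono_on (by linarith) (hu.intervalIntegrable hF n _ _)
        (Continuous.intervalIntegrable (by fun_prop) _ _) fun r hr => ?_
      calc _ ≤ ρ * Real.exp (ρ * r) *
            (m * (Real.exp (-lam * (r - y)) * U * ∫ d, Real.exp (-lam * d) ∂ν)) := by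
            gcongr; exact hq r hr.1
        _ = (Real.exp (ρ * r) * Real.exp (-lam * (r - y))) * U *
            (ρ * m * ∫ d, Real.exp (-lam * d) ∂ν) := by ring
        _ = _ := by
            rw [hlap, ← Real.exp_add, show ρ * r + -lam * (r - y) = lam * y + (ρ - lam) * r by ring,
              Real.exp_add]
            ring
    rw [intervalIntegral.integral_const_mul, integral_mul_exp_mul] at hint
    have key : Real.exp (ρ * (y + x)) * u (n + 1) (y + x) ≤
        Real.exp (ρ * (y + x)) * (Real.exp (-lam * x) * U) := by
      rw [h1]
      have e1 : Real.exp (lam * y) * Real.exp ((ρ - lam) * (y + x)) =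
          Real.exp (ρ * (y + x)) * Real.exp (-lam * x) := by
        rw [← Real.exp_add, ← Real.exp_add]; ring_nf
      have e2 : Real.exp (lam * y) * Real.exp ((ρ - lam) * y) = Real.exp (ρ * y) := by
        rw [← Real.exp_add]; ring_nf
      have e3 : Real.exp (lam * y) * U *
          (Real.exp ((ρ - lam) * (y + x)) - Real.exp ((ρ - lam) * y)) =
          Real.exp (ρ * (y + x)) * (Real.exp (-lam * x) * U) - Real.exp (ρ * y) * U := by
        rw [← mul_assoc, ← e1, ← e2]; ring
      have := mul_le_mul_of_nonneg_left hle (Real.exp_pos (ρ * y)).le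
      linarith
    exact le_of_mul_le_mul_left key (Real.exp_pos _)

/-- This monotonicity takes the place of a renewal theorem: existence of the limit becomes
automatic. -/
lemma antitoneOn_exp_mul_iSup (hu : IsRenewalIteration ρ F ν u) (hF : IsSurvivalFunction m F)
    (hρ : 0 < ρ) (hm : 0 ≤ m) (hlam : 0 < lam) (hν : ∀ᵐ d ∂ν, 0 ≤ d)
    (hlap : ρ * m * ∫ d, Real.exp (-lam * d) ∂ν = ρ - lam) :
    AntitoneOn (fun x => Real.exp (lam * x) * ⨆ k, u k x) (Set.Ici 0) := by
  intro x hx y _ hxy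
  have h : ⨆ k, u k y ≤ Real.exp (-lam * (y - x)) * ⨆ k, u k x := ciSup_le fun k => by
    simpa using hu.le_exp_mul_iSup hF hρ hm hlam hν hlap k (x := y - x) (by linarith) hx
  calc Real.exp (lam * y) * ⨆ k, u k y
      ≤ Real.exp (lam * y) * (Real.exp (-lam * (y - x)) * ⨆ k, u k x) := by gcongr
    _ = _ := by rw [← mul_assoc, ← Real.exp_add]; ring_nf

/-- A function `z` with `z 0 ≤ 1` and `z' ≤ ρ (q - z)`, `q r = E[F (z (r + d))]`, lies below
`⨆ n, u n`. -/
lemma le_iSup_of_hasDerivAt (hu : IsRenewalIteration ρ F ν u) (hF : IsSurvivalFunction m F)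
    (hρ : 0 < ρ) (hm : 0 ≤ m) (hm1 : m < 1) (hν : ∀ᵐ d ∂ν, 0 ≤ d) {z z' : ℝ → ℝ}
    (hz : Antitone z) (hz0 : ∀ x, 0 ≤ z x) (hz1 : z 0 = 1) (hcont : Continuous z')
    (hderiv : ∀ x, HasDerivAt z (z' x) x)
    (hsub : ∀ r, 0 ≤ r → z' r ≤ ρ * ((∫ d, F (z (r + d)) ∂ν) - z r)) {x : ℝ} (hx : 0 ≤ x) :
    z x ≤ ⨆ n, u n x := by
  have hzle : ∀ x, 0 ≤ x → z x ≤ 1 := fun x hx => hz1 ▸ hz hx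
  have hzint : ∀ r, 0 ≤ r → Integrable (fun d => F (z (r + d))) ν := fun r hr => by
    have := hF.integrable_comp_shift (ν := ν) (v := fun x => min (z x) 1)
      (fun a b hab => min_le_min_right _ (hz hab)) (fun x => le_min (hz0 x) zero_le_one)
      (fun x => min_le_right _ _) r
    refine this.congr ?_
    filter_upwards [hν] with d hd
    rw [min_eq_left (hzle _ (by linarith))]
  -- Starting from `z ≤ 1 = u 0 + m^0`, each iteration shrinks the gap by the factor `m`: `F` has
  -- Lipschitz constant `m`, and the kernel `ρ e^(ρ(r-x))` has mass at most one on `[0, x]`.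
  have key : ∀ n : ℕ, ∀ x, 0 ≤ x → z x ≤ u n x + m ^ n := by
    intro n
    induction n with
    | zero => intro x hx; rw [hu.zero x hx]; simpa using hzle x hx
    | succ n ih =>
      intro x hx
      have hq : ∀ r, 0 ≤ r → (∫ d, F (z (r + d)) ∂ν) - m ^ (n + 1) ≤ ∫ d, F (u n (r + d)) ∂ν := by
        intro r hr
        have : ∫ d, (F (z (r + d)) - m ^ (n + 1)) ∂ν ≤ ∫ d, F (u n (r + d)) ∂ν := by
          refine integral_mono_ae ((hzint r hr).sub (integrable_const _))
            (hF.integrable_comp_shift (hu.anti n) (hu.nonneg n) (hu.le_one n) _) ?_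
          filter_upwards [hν] with d hd
          have hrd : 0 ≤ r + d := by linarith
          rcases le_total (z (r + d)) (u n (r + d)) with h | h
          · have := hF.monotoneOn ⟨hz0 _, hzle _ hrd⟩ ⟨hu.nonneg n _, hu.le_one n _⟩ h
            have := pow_nonneg hm (n + 1)
            linarith
          · have h1 := hF.sub_le _ _ (hu.nonneg n _) h (hzle _ hrd)
            have h2 := mul_le_mul_of_nonneg_left (sub_le_iff_le_add'.2 (ih _ hrd)) hm
            rw [pow_succ']
            linarith
        rwa [integral_sub (hzint r hr) (integrable_const _), integral_const, probReal_univ,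
          one_smul] at this
      have hdz : ∀ r ∈ Set.uIcc 0 x, HasDerivAt (fun r => Real.exp (ρ * r) * z r)
          (ρ * Real.exp (ρ * r) * z r + Real.exp (ρ * r) * z' r) r := fun r _ => by
        have h1 : HasDerivAt (fun r => Real.exp (ρ * r)) (ρ * Real.exp (ρ * r)) r := by
          simpa [mul_comm] using ((hasDerivAt_id r).const_mul ρ).exp
        exact h1.mul (hderiv r)
      have hzc : Continuous z := continuous_iff_continuousAt.2 fun x => (hderiv x).continuousAt
      have hftc := intervalIntegral.integral_eq_sub_of_hasDerivAt hdz
        (Continuous.intervalIntegrable (by fun_prop) _ _)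
      have hle : ∫ r in 0..x, (ρ * Real.exp (ρ * r) * z r + Real.exp (ρ * r) * z' r) ≤
          ∫ r in 0..x, (ρ * Real.exp (ρ * r) * (∫ d, F (u n (r + d)) ∂ν) +
            m ^ (n + 1) * (ρ * Real.exp (ρ * r))) := by
        refine intervalIntegral.integral_mono_on hx
          (Continuous.intervalIntegrable (by fun_prop) _ _)
          ((hu.intervalIntegrable hF n _ _).add
            (Continuous.intervalIntegrable (by fun_prop) _ _)) fun r hr => ?_
        have h1 := mul_le_mul_of_nonneg_left (hsub r hr.1) (Real.exp_pos (ρ * r)).le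
        have h2 := mul_le_mul_of_nonneg_left (hq r hr.1)
          (mul_nonneg hρ.le (Real.exp_pos (ρ * r)).le)
        linarith
      rw [hftc, intervalIntegral.integral_add (hu.intervalIntegrable hF n _ _)
        (Continuous.intervalIntegrable (by fun_prop) _ _), intervalIntegral.integral_const_mul,
        integral_mul_exp_mul, mul_zero, Real.exp_zero, one_mul, hz1] at hle
      have hs := hu.succ n x hx
      have hp := pow_nonneg hm (n + 1)
      refine le_of_mul_le_mul_left ?_ (Real.exp_pos (ρ * x))
      rw [mul_add, hs]
      linarith
  have hlim : Tendsto (fun n : ℕ => (⨆ n, u n x) + m ^ n) atTop (𝓝 ((⨆ n, u n x) + 0)) :=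
    tendsto_const_nhds.add (tendsto_pow_atTop_nhds_zero_of_lt_one hm hm1)
  rw [add_zero] at hlim
  exact ge_of_tendsto' hlim fun n =>
    (key n x hx).trans (add_le_add_left (le_ciSup (hu.bddAbove x) n) _)

/-- The linear solution `e^(-lam x)` is lowered to `z x = exp (-lam x - K A x)` with `A x = ∫₀ˣ a`.
The extra decay `K a` of `z` pays for the loss `e^(-a)` between `m s` and `F s`, so `z` is a
subsolution, and boundedness of `A` keeps `e^(lam x) z x` away from zero. -/
lemma exists_pos_le_exp_mul_iSup (hu : IsRenewalIteration ρ F ν u) (hF : IsSurvivalFunction m F)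
    (hρ : 0 < ρ) (hm : 0 ≤ m) (hm1 : m < 1) (hlam : 0 < lam) (hν : ∀ᵐ d ∂ν, 0 ≤ d)
    (hlap : ρ * m * ∫ d, Real.exp (-lam * d) ∂ν = ρ - lam) {a : ℝ → ℝ} (ha : Continuous a)
    (hanti : Antitone a) (ha0 : ∀ x, 0 ≤ a x) {B : ℝ} (hB : ∀ x, 0 ≤ x → ∫ r in 0..x, a r ≤ B)
    (haF : ∀ x s, 0 ≤ x → 0 ≤ s → s ≤ Real.exp (-lam * x) → m * s * Real.exp (-a x) ≤ F s) :
    ∃ c, 0 < c ∧ ∀ x, 0 ≤ x → c ≤ Real.exp (lam * x) * ⨆ n, u n x := by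
  have hbd : ∀ᵐ d ∂ν, 0 ≤ d ∧ Real.exp (-lam * d) ≤ 1 ∧
      d * Real.exp (-lam * d) ≤ lam⁻¹ * (1 - Real.exp (-lam * d)) := by
    filter_upwards [hν] with d hd
    refine ⟨hd, Real.exp_le_one_iff.2 (by nlinarith), ?_⟩
    have h1 : lam * d + 1 ≤ Real.exp (lam * d) := Real.add_one_le_exp _
    have h2 : Real.exp (lam * d) * Real.exp (-lam * d) = 1 := by
      rw [← Real.exp_add]; simp
    have h3 := mul_le_mul_of_nonneg_right h1 (Real.exp_pos (-lam * d)).le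
    rw [inv_mul_eq_div, le_div_iff₀ hlam]
    nlinarith
  have hexpint : Integrable (fun d => Real.exp (-lam * d)) ν := by
    refine Integrable.of_bound (C := 1) (by fun_prop) ?_
    filter_upwards [hbd] with d hd
    rw [Real.norm_of_nonneg (Real.exp_pos _).le]
    exact hd.2.1
  have hdexpint : Integrable (fun d => d * Real.exp (-lam * d)) ν := by
    refine Integrable.mono' ((integrable_const 1).sub hexpint |>.const_mul lam⁻¹) (by fun_prop) ?_
    filter_upwards [hbd] with d hd
    rw [Real.norm_of_nonneg (mul_nonneg hd.1 (Real.exp_pos _).le)]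
    exact hd.2.2
  set L := ∫ d, Real.exp (-lam * d) ∂ν with hL
  set L₁ := ∫ d, d * Real.exp (-lam * d) ∂ν with hL₁
  have hL0 : 0 ≤ L := integral_nonneg fun d => (Real.exp_pos _).le
  have hL₁le : L₁ ≤ lam⁻¹ * (1 - L) := by
    have := integral_mono_ae hdexpint (((integrable_const 1).sub hexpint).const_mul lam⁻¹)
      (by filter_upwards [hbd] with d hd using hd.2.2)
    rw [integral_const_mul] at this
    change L₁ ≤ lam⁻¹ * ∫ d, (1 - Real.exp (-lam * d)) ∂ν at this
    rwa [integral_sub (integrable_const _) hexpint, integral_const, probReal_univ,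
      one_smul] at this
  have hρlam : 0 ≤ ρ - lam := hlap ▸ by positivity
  -- To first order in `a`, the subsolution inequality asks for `K (1 - ρ m L₁) ≥ ρ - lam`. Since
  -- `L₁ ≤ (1 - L) / lam` and `ρ m L = ρ - lam`, one has `1 - ρ m L₁ ≥ ρ (1 - m) / lam`; this `K`
  -- gives equality with that bound. Here `m < 1` is essential.
  set K := (ρ - lam) * lam / (ρ * (1 - m)) with hK
  have hK0 : 0 ≤ K := by
    have : 0 < 1 - m := by linarith
    positivity
  set A : ℝ → ℝ := fun x => ∫ r in 0..x, a r with hA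
  have hAd : ∀ x, HasDerivAt A (a x) x := fun x => ha.integral_hasStrictDerivAt 0 x |>.hasDerivAt
  have hAint : ∀ x y, IntervalIntegrable a volume x y := fun x y => ha.intervalIntegrable x y
  have hAsub : ∀ x y, A y - A x = ∫ r in x..y, a r := fun x y =>
    intervalIntegral.integral_interval_sub_left (hAint _ _) (hAint _ _)
  have hAmono : Monotone A := fun x y hxy => by
    have := intervalIntegral.integral_nonneg (μ := volume) hxy fun r _ => ha0 r
    have := hAsub x y
    linarith
  have hA0 : A 0 = 0 := by simp [hA]
  have hAle : ∀ x d, 0 ≤ d → A (x + d) - A x ≤ a x * d := fun x d hd => by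
    rw [hAsub]
    have := intervalIntegral.integral_mono_on (μ := volume) (a := x) (b := x + d) (by linarith)
      (hAint _ _) (intervalIntegrable_const (c := a x)) fun r hr => hanti hr.1
    simpa [mul_comm] using this
  set z : ℝ → ℝ := fun x => Real.exp (-lam * x - K * A x) with hz
  have hzd : ∀ x, HasDerivAt z ((-lam - K * a x) * z x) x := fun x => by
    have := (((hasDerivAt_id x).const_mul (-lam)).sub ((hAd x).const_mul K)).exp
    simpa [hz, mul_comm] using this
  have hzanti : Antitone z := fun x y hxy => Real.exp_le_exp.2 (by
    have := mul_le_mul_of_nonneg_left (hAmono hxy) hK0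
    nlinarith)
  have hzc : Continuous z := continuous_iff_continuousAt.2 fun x => (hzd x).continuousAt
  have hzle : ∀ x, 0 ≤ x → z x ≤ Real.exp (-lam * x) := fun x hx => Real.exp_le_exp.2 (by
    have := mul_nonneg hK0 (hA0 ▸ hAmono hx)
    linarith)
  have hsub : ∀ r, 0 ≤ r → (-lam - K * a r) * z r ≤ ρ * ((∫ d, F (z (r + d)) ∂ν) - z r) := by
    intro r hr
    have hFint : Integrable (fun d => F (z (r + d))) ν := by
      have := hF.integrable_comp_shift (ν := ν) (v := fun x => min (z x) 1)
        (fun a b hab => min_le_min_right _ (hzanti hab))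
        (fun x => le_min (Real.exp_pos _).le zero_le_one) (fun x => min_le_right _ _) r
      refine this.congr ?_
      filter_upwards [hν] with d hd
      rw [min_eq_left ((hzle _ (by linarith)).trans (Real.exp_le_one_iff.2 (by nlinarith)))]
    have hpt : ∀ᵐ d ∂ν, m * z r * ((1 - a r) * Real.exp (-lam * d) -
        K * a r * (d * Real.exp (-lam * d))) ≤ F (z (r + d)) := by
      filter_upwards [hν] with d hd
      have hrd : 0 ≤ r + d := by linarith
      refine le_trans ?_ (haF (r + d) (z (r + d)) hrd (Real.exp_pos _).le (hzle _ hrd))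
      rw [mul_assoc m, mul_assoc m]
      refine mul_le_mul_of_nonneg_left ?_ hm
      -- As `a` is antitone, both `a (r + d) ≤ a r` and `A (r + d) - A r ≤ a r * d`, so the loss
      -- over a displacement `d` is expressed through `a r` alone. It is then linearized by `e^(-t)
      -- ≥ 1 - t`.
      have h1 : z r * Real.exp (-lam * d) * Real.exp (-(a r + K * (a r * d))) ≤
          z (r + d) * Real.exp (-a (r + d)) := by
        simp only [hz, ← Real.exp_add]
        refine Real.exp_le_exp.2 ?_
        have h2 := mul_le_mul_of_nonneg_left (hAle r d hd) hK0
        have h3 := hanti (show r ≤ r + d by linarith)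
        linarith
      refine le_trans ?_ h1
      have h4 := Real.add_one_le_exp (-(a r + K * (a r * d)))
      have h5 : 0 ≤ z r * Real.exp (-lam * d) := by positivity
      have h6 := mul_le_mul_of_nonneg_left h4 h5
      linarith
    have hint := integral_mono_ae (((hexpint.const_mul _).sub (hdexpint.const_mul _)).const_mul _)
      hFint hpt
    rw [integral_const_mul, integral_sub'  (hexpint.const_mul _) (hdexpint.const_mul _),
      integral_const_mul, integral_const_mul, ← hL, ← hL₁] at hint
    have h1m : 0 < 1 - m := by linarith
    have h7 : ρ * m * L₁ ≤ 1 - ρ * (1 - m) / lam := by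
      have := mul_le_mul_of_nonneg_left hL₁le (mul_nonneg hρ.le hm)
      refine this.trans (le_of_eq ?_)
      have : ρ * m * (lam⁻¹ * (1 - L)) = lam⁻¹ * (ρ * m - ρ * m * L) := by ring
      rw [this, hlap]
      field_simp
      ring
    have h8 : K * (ρ * (1 - m) / lam) = ρ - lam := by
      rw [hK]; field_simp
    have h9 := mul_le_mul_of_nonneg_left h7
      (mul_nonneg (mul_nonneg hK0 (ha0 r)) (Real.exp_pos _ : 0 < z r).le)
    have h10 := mul_le_mul_of_nonneg_left hint hρ.le
    have h11 : K * a r * z r * (1 - ρ * (1 - m) / lam) = K * a r * z r - a r * z r * (ρ - lam) := by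
      rw [← h8]; ring
    have h12 : ρ * (m * z r * ((1 - a r) * L - K * a r * L₁)) =
        z r * (1 - a r) * (ρ * m * L) - K * a r * z r * (ρ * m * L₁) := by ring
    rw [h12, hlap] at h10
    rw [h11] at h9
    linarith
  have hmain := fun x hx => hu.le_iSup_of_hasDerivAt hF hρ hm hm1 hν hzanti
    (fun x => (Real.exp_pos _).le) (by simp [hz, hA0]) (by fun_prop) hzd hsub (x := x) hx
  refine ⟨Real.exp (-(K * B)), Real.exp_pos _, fun x hx => ?_⟩
  refine le_trans ?_ (mul_le_mul_of_nonneg_left (hmain x hx) (Real.exp_pos _).le)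
  rw [hz, ← Real.exp_add]
  refine Real.exp_le_exp.2 ?_
  have := mul_le_mul_of_nonneg_left (hB x hx) hK0
  simp only [hA]
  linarith

/-- The renewal theorem for `⨆ n, u n`. -/
theorem exists_tendsto_exp_mul_iSup (hu : IsRenewalIteration ρ F ν u)
    (hF : IsSurvivalFunction m F) (hρ : 0 < ρ) (hm : 0 ≤ m) (hlam : 0 < lam)
    (hν : ∀ᵐ d ∂ν, 0 ≤ d) (hlap : ρ * m * ∫ d, Real.exp (-lam * d) ∂ν = ρ - lam) {c : ℝ}
    (hc : 0 < c) (hle : ∀ x, 0 ≤ x → c ≤ Real.exp (lam * x) * ⨆ n, u n x) :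
    ∃ C, 0 < C ∧ Tendsto (fun x => Real.exp (lam * x) * ⨆ n, u n x) atTop (𝓝 C) := by
  set w : ℝ → ℝ := fun x => Real.exp (lam * x) * ⨆ n, u n x with hw
  have hanti := hu.antitoneOn_exp_mul_iSup hF hρ hm hlam hν hlap
  have hanti' : Antitone fun x => w (max x 0) := fun x y hxy =>
    hanti (le_max_right x 0) (le_max_right y 0) (max_le_max_right 0 hxy)
  have hbdd : BddBelow (Set.range fun x => w (max x 0)) :=
    ⟨c, by rintro _ ⟨x, rfl⟩; exact hle _ (le_max_right _ _)⟩
  refine ⟨⨅ x, w (max x 0), hc.trans_le (le_ciInf fun x => hle _ (le_max_right _ _)), ?_⟩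
  -- The limit is the infimum of a nonincreasing function, and the lower bound `c` makes it
  -- positive.
  refine (tendsto_atTop_ciInf hanti' hbdd).congr' ?_
  filter_upwards [eventually_ge_atTop 0] with x hx
  rw [max_eq_left hx]

end IsRenewalIteration

/-! ### The generating function, its linearization and the `k log k` moment. -/

section OffspringLaw

/-- `v ↦ 1 - f (1 - v)`, where `f` is the generating function of `p`. -/
noncomputable def survivalFunction (p : PMF ℕ) (v : ℝ) : ℝ :=
  ∑' k : ℕ, (p k).toReal * (1 - (1 - v) ^ k)

lemma pow_sub_pow_le_mul_sub {a b : ℝ} (hb : 0 ≤ b) (hab : b ≤ a) (ha : a ≤ 1) (k : ℕ) :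
    a ^ k - b ^ k ≤ k * (a - b) := by
  induction k with
  | zero => simp
  | succ k ih =>
    have h1 : a ^ k ≤ 1 := pow_le_one₀ (hb.trans hab) ha
    have h2 : a ^ (k + 1) - b ^ (k + 1) = a ^ k * (a - b) + b * (a ^ k - b ^ k) := by ring
    have h3 : b ^ k ≤ a ^ k := pow_le_pow_left₀ hb hab k
    push_cast
    nlinarith

lemma one_sub_pow_le_quadratic {s : ℝ} (hs : 0 ≤ s) (hs1 : s ≤ 1) (k : ℕ) :
    (1 - s) ^ k ≤ 1 - k * s + (k * s) ^ 2 := by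
  induction k with
  | zero => simp
  | succ k ih =>
    rw [pow_succ]
    push_cast
    have h1 := mul_le_mul_of_nonneg_right ih (sub_nonneg.2 hs1)
    have h2 : 0 ≤ (k : ℝ) ^ 2 * s ^ 3 := by positivity
    have h3 : 0 ≤ (k : ℝ) * s ^ 2 := by positivity
    nlinarith

/-- The factor is `(1 - y)/(1 + y)`: negative for `y ≥ 1`, and at most `1 - y ≤ 1 - k s` otherwise,
where the quadratic bound applies. The loss `2y/(1+y)` is chosen because it is bounded and
increasing in `y` and, along `y = k e^(-lam r)`, integrates to a logarithm of `k`. -/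
lemma mul_le_one_sub_pow {s y : ℝ} (hs : 0 ≤ s) (hs1 : s ≤ 1) (k : ℕ) (hy : k * s ≤ y) :
    k * s * (1 - 2 * y / (1 + y)) ≤ 1 - (1 - s) ^ k := by
  have h0 : 0 ≤ k * s := by positivity
  have hy0 : 0 ≤ y := h0.trans hy
  have h1 : (1 - s) ^ k ≤ 1 := pow_le_one₀ (sub_nonneg.2 hs1) (by linarith)
  have h2 : 1 - 2 * y / (1 + y) = (1 - y) / (1 + y) := by field_simp; ring
  rw [h2]
  rcases le_total 1 y with h | h
  · have : (1 - y) / (1 + y) ≤ 0 := div_nonpos_of_nonpos_of_nonneg (by linarith) (by linarith)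
    nlinarith
  · have h3 := one_sub_pow_le_quadratic hs hs1 k
    have h4 : (1 - y) / (1 + y) ≤ 1 - k * s :=
      (div_le_self (by linarith) (by linarith)).trans (by linarith)
    nlinarith [mul_le_mul_of_nonneg_left h4 h0]

variable {p : PMF ℕ}

lemma PMF.summable_toReal (p : PMF ℕ) : Summable fun k => (p k).toReal :=
  ENNReal.summable_toReal p.tsum_coe_ne_top

lemma PMF.tsum_toReal (p : PMF ℕ) : ∑' k, (p k).toReal = 1 := by
  rw [← ENNReal.tsum_toReal_eq fun k => p.apply_ne_top k, p.tsum_coe, ENNReal.toReal_one]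

lemma summable_mul_toReal (hm : offspringMean p < 1) :
    Summable fun k : ℕ => (k : ℝ) * (p k).toReal := by
  have := ENNReal.summable_toReal (hm.trans ENNReal.one_lt_top).ne
  simpa using this

lemma toReal_offspringMean (p : PMF ℕ) :
    (offspringMean p).toReal = ∑' k : ℕ, (k : ℝ) * (p k).toReal := by
  rw [offspringMean, ENNReal.tsum_toReal_eq fun k =>
    ENNReal.mul_ne_top (ENNReal.natCast_ne_top k) (p.apply_ne_top k)]
  simp

lemma toReal_offspringMean_lt_one (hm : offspringMean p < 1) : (offspringMean p).toReal < 1 := by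
  simpa using (ENNReal.toReal_lt_toReal (hm.trans ENNReal.one_lt_top).ne ENNReal.one_ne_top).2 hm

lemma summable_survivalFunction (p : PMF ℕ) {v : ℝ} (h0 : 0 ≤ v) (h1 : v ≤ 1) :
    Summable fun k : ℕ => (p k).toReal * (1 - (1 - v) ^ k) := by
  refine Summable.of_nonneg_of_le (fun k => ?_) (fun k => ?_) p.summable_toReal
  · have : (1 - v) ^ k ≤ 1 := pow_le_one₀ (sub_nonneg.2 h1) (by linarith)
    exact mul_nonneg ENNReal.toReal_nonneg (by linarith)
  · have : 0 ≤ (1 - v) ^ k := pow_nonneg (sub_nonneg.2 h1) k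
    exact mul_le_of_le_one_right ENNReal.toReal_nonneg (by linarith)

lemma isSurvivalFunction_survivalFunction (hm : offspringMean p < 1) :
    IsSurvivalFunction (offspringMean p).toReal (survivalFunction p) where
  map_zero := by simp [survivalFunction]
  monotoneOn := by
    intro v hv w hw hvw
    refine (summable_survivalFunction p hv.1 hv.2).tsum_le_tsum (fun k => ?_)
      (summable_survivalFunction p hw.1 hw.2)
    have : (1 - w) ^ k ≤ (1 - v) ^ k := pow_le_pow_left₀ (sub_nonneg.2 hw.2) (by linarith) k
    exact mul_le_mul_of_nonneg_left (by linarith) ENNReal.toReal_nonneg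
  sub_le := by
    intro v w h0 hvw h1
    have hsv := summable_survivalFunction p h0 (hvw.trans h1)
    have hsw := summable_survivalFunction p (h0.trans hvw) h1
    rw [survivalFunction, survivalFunction, ← hsw.tsum_sub hsv, toReal_offspringMean,
      ← tsum_mul_right]
    refine (hsw.sub hsv).tsum_le_tsum (fun k => ?_) ((summable_mul_toReal hm).mul_right _)
    have := pow_sub_pow_le_mul_sub (sub_nonneg.2 h1) (show 1 - w ≤ 1 - v by linarith)
      (by linarith) k
    have := mul_le_mul_of_nonneg_left this (ENNReal.toReal_nonneg (a := p k))
    nlinarith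

/-- Concavity: the graph lies above its chord. This keeps the ratio `F s / s` away from zero. -/
lemma mul_survivalFunction_one_le (p : PMF ℕ) {s : ℝ} (h0 : 0 ≤ s) (h1 : s ≤ 1) :
    s * survivalFunction p 1 ≤ survivalFunction p s := by
  rw [survivalFunction, survivalFunction, ← tsum_mul_left]
  refine ((summable_survivalFunction p zero_le_one le_rfl).mul_left s).tsum_le_tsum (fun k => ?_)
    (summable_survivalFunction p h0 h1)
  rw [mul_left_comm]
  refine mul_le_mul_of_nonneg_left ?_ ENNReal.toReal_nonneg
  rcases k with _ | k
  · simp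
  · have : (1 - s) ^ k ≤ 1 := pow_le_one₀ (sub_nonneg.2 h1) (by linarith)
    simp only [sub_self, pow_succ, mul_zero, sub_zero, mul_one]
    nlinarith

lemma survivalFunction_one_pos (hm0 : 0 < (offspringMean p).toReal) :
    0 < survivalFunction p 1 := by
  have hs := summable_survivalFunction p zero_le_one le_rfl
  have hnn : ∀ k : ℕ, 0 ≤ (p k).toReal * (1 - (1 - 1 : ℝ) ^ k) := fun k => by
    refine mul_nonneg ENNReal.toReal_nonneg ?_
    rcases k with _ | k <;> simp
  by_contra hle
  have h0 : survivalFunction p 1 = 0 := le_antisymm (not_lt.1 hle) (tsum_nonneg hnn)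
  have hz := (hasSum_zero_iff_of_nonneg hnn).1 (by rw [← h0]; exact hs.hasSum)
  have : (offspringMean p).toReal = 0 := by
    rw [toReal_offspringMean, ← tsum_zero (α := ℝ) (β := ℕ)]
    refine tsum_congr fun k => ?_
    rcases k with _ | k
    · simp
    · have := congrFun hz (k + 1)
      simp only [sub_self, pow_succ, mul_zero, sub_zero, mul_one, Pi.zero_apply] at this
      rw [this, mul_zero]
  linarith

/-- An upper bound for the relative deviation of `survivalFunction p` from its linearization. -/
noncomputable def linearizationDefect (p : PMF ℕ) (lam x : ℝ) : ℝ :=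
  (survivalFunction p 1)⁻¹ * ∑' k : ℕ, (k : ℝ) * (p k).toReal *
    (2 * (k * Real.exp (-lam * x)) / (1 + k * Real.exp (-lam * x)))

lemma two_mul_div_one_add_mem {y : ℝ} (hy : 0 ≤ y) :
    0 ≤ 2 * y / (1 + y) ∧ 2 * y / (1 + y) ≤ 2 :=
  ⟨by positivity, by rw [div_le_iff₀ (by linarith)]; linarith⟩

lemma linearizationDefect_term_nonneg (p : PMF ℕ) (lam x : ℝ) (k : ℕ) :
    0 ≤ (k : ℝ) * (p k).toReal *
      (2 * (k * Real.exp (-lam * x)) / (1 + k * Real.exp (-lam * x))) := by positivity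

lemma linearizationDefect_term_le (p : PMF ℕ) (lam x : ℝ) (k : ℕ) :
    (k : ℝ) * (p k).toReal *
      (2 * (k * Real.exp (-lam * x)) / (1 + k * Real.exp (-lam * x))) ≤
      (k : ℝ) * (p k).toReal * 2 :=
  mul_le_mul_of_nonneg_left (two_mul_div_one_add_mem (by positivity)).2 (by positivity)

lemma summable_linearizationDefect (hm : offspringMean p < 1) (lam x : ℝ) :
    Summable fun k : ℕ => (k : ℝ) * (p k).toReal *
      (2 * (k * Real.exp (-lam * x)) / (1 + k * Real.exp (-lam * x))) :=
  Summable.of_nonneg_of_le (linearizationDefect_term_nonneg p lam x)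
    (linearizationDefect_term_le p lam x) ((summable_mul_toReal hm).mul_right 2)

lemma survivalFunction_nonneg (p : PMF ℕ) {s : ℝ} (h0 : 0 ≤ s) (h1 : s ≤ 1) :
    0 ≤ survivalFunction p s := by
  refine tsum_nonneg fun k => mul_nonneg ENNReal.toReal_nonneg ?_
  have : (1 - s) ^ k ≤ 1 := pow_le_one₀ (sub_nonneg.2 h1) (by linarith)
  linarith

lemma linearizationDefect_nonneg (p : PMF ℕ) (lam x : ℝ) : 0 ≤ linearizationDefect p lam x :=
  mul_nonneg (inv_nonneg.2 (survivalFunction_nonneg p zero_le_one le_rfl))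
    (tsum_nonneg (linearizationDefect_term_nonneg p lam x))

lemma continuous_linearizationDefect (hm : offspringMean p < 1) (lam : ℝ) :
    Continuous (linearizationDefect p lam) := by
  refine continuous_const.mul (continuous_tsum (u := fun k : ℕ => (k : ℝ) * (p k).toReal * 2)
    (fun k => ?_) ((summable_mul_toReal hm).mul_right 2) fun k x => ?_)
  · exact continuous_const.mul (Continuous.div (by fun_prop) (by fun_prop)
      fun x => by positivity)
  · rw [Real.norm_of_nonneg (linearizationDefect_term_nonneg p lam x k)]
    exact linearizationDefect_term_le p lam x k

lemma antitone_linearizationDefect (hm : offspringMean p < 1) {lam : ℝ} (hlam : 0 ≤ lam) :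
    Antitone (linearizationDefect p lam) := by
  intro x y hxy
  refine mul_le_mul_of_nonneg_left ?_ (inv_nonneg.2 (survivalFunction_nonneg p zero_le_one le_rfl))
  refine (summable_linearizationDefect hm lam y).tsum_le_tsum (fun k => ?_)
    (summable_linearizationDefect hm lam x)
  refine mul_le_mul_of_nonneg_left ?_ (by positivity)
  have h : (k : ℝ) * Real.exp (-lam * y) ≤ k * Real.exp (-lam * x) := by
    have : Real.exp (-lam * y) ≤ Real.exp (-lam * x) := Real.exp_le_exp.2 (by nlinarith)
    gcongr
  rw [div_le_div_iff₀ (by positivity) (by positivity)]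
  nlinarith

/-- For `s > 0` put `r = F s / (m s)`. Termwise comparison gives `m (1 - r) ≤ δ`, and concavity
gives `m r ≥ F 1`. Hence `1/r - 1 = m (1 - r)/(m r)` is at most the defect, and `1/r ≤ 1 + defect ≤
e^defect`. Dividing by `F 1` is what allows an exponential, hence positive, lower bound even where
`δ` is large. -/
lemma mul_exp_neg_linearizationDefect_le (hm : offspringMean p < 1)
    (hm0 : 0 < (offspringMean p).toReal) {lam : ℝ} (hlam : 0 < lam) {x s : ℝ} (hx : 0 ≤ x)
    (h0 : 0 ≤ s) (hs : s ≤ Real.exp (-lam * x)) :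
    (offspringMean p).toReal * s * Real.exp (-linearizationDefect p lam x) ≤
      survivalFunction p s := by
  have h1 : s ≤ 1 := hs.trans (Real.exp_le_one_iff.2 (by nlinarith))
  have hF1 := survivalFunction_one_pos hm0
  have hle := (isSurvivalFunction_survivalFunction hm).le_mul h0 h1
  have hF1m := (isSurvivalFunction_survivalFunction hm).le_mul zero_le_one le_rfl
  have hge := mul_survivalFunction_one_le p h0 h1
  set m := (offspringMean p).toReal
  set δ := ∑' k : ℕ, (k : ℝ) * (p k).toReal *
    (2 * (k * Real.exp (-lam * x)) / (1 + k * Real.exp (-lam * x))) with hδ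
  have hlin : s * (m - δ) ≤ survivalFunction p s := by
    rw [show m = ∑' k : ℕ, (k : ℝ) * (p k).toReal from toReal_offspringMean p, hδ,
      ← (summable_mul_toReal hm).tsum_sub (summable_linearizationDefect hm lam x),
      ← tsum_mul_left]
    refine (((summable_mul_toReal hm).sub (summable_linearizationDefect hm lam x)).mul_left
      s).tsum_le_tsum (fun k => ?_) (summable_survivalFunction p h0 h1)
    have := mul_le_one_sub_pow h0 h1 k (mul_le_mul_of_nonneg_left hs (Nat.cast_nonneg k))
    have := mul_le_mul_of_nonneg_left this (ENNReal.toReal_nonneg (a := p k))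
    linarith
  rcases h0.eq_or_lt with rfl | hspos
  · simpa using survivalFunction_nonneg p le_rfl zero_le_one
  have hms : 0 < m * s := mul_pos hm0 hspos
  set r := survivalFunction p s / (m * s) with hr
  have hFr : survivalFunction p s = m * s * r := by rw [hr]; field_simp
  have hr1 : r ≤ 1 := (div_le_one hms).2 hle
  have hrF : survivalFunction p 1 ≤ m * r := by
    rw [hr]; rw [show m * (survivalFunction p s / (m * s)) = survivalFunction p s / s by field_simp,
      le_div_iff₀ hspos]; linarith
  have hrpos : 0 < r := by
    by_contra h
    nlinarith
  have hrδ : m * (1 - r) ≤ δ := by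
    rw [hFr] at hlin
    have : s * (m - δ) ≤ s * (m * r) := by linarith
    have := le_of_mul_le_mul_left this hspos
    linarith
  rw [hFr]
  refine mul_le_mul_of_nonneg_left ?_ hms.le
  have h2 : r⁻¹ ≤ Real.exp (linearizationDefect p lam x) := by
    have h3 : r⁻¹ - 1 ≤ linearizationDefect p lam x := by
      change _ ≤ (survivalFunction p 1)⁻¹ * δ
      rw [inv_mul_eq_div, le_div_iff₀ hF1]
      have h4 : 0 ≤ r⁻¹ - 1 := by
        have := (one_le_inv₀ hrpos).2 hr1
        linarith
      calc (r⁻¹ - 1) * survivalFunction p 1 ≤ (r⁻¹ - 1) * (m * r) := by gcongr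
        _ = m * (1 - r) := by field_simp
        _ ≤ δ := hrδ
    have := Real.add_one_le_exp (linearizationDefect p lam x)
    linarith
  rw [Real.exp_neg]
  exact inv_le_of_inv_le₀ hrpos h2

/-- The integrand is the derivative of `-(2/lam) log (1 + k e^(-lam r))`. -/
lemma integral_two_mul_div_one_add_le {lam : ℝ} (hlam : 0 < lam) (k : ℕ) (x : ℝ) :
    ∫ r in 0..x, 2 * (k * Real.exp (-lam * r)) / (1 + k * Real.exp (-lam * r)) ≤
      2 / lam * Real.log (1 + k) := by
  have hd : ∀ r ∈ Set.uIcc 0 x,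
      HasDerivAt (fun r => -(2 / lam) * Real.log (1 + k * Real.exp (-lam * r)))
        (2 * (k * Real.exp (-lam * r)) / (1 + k * Real.exp (-lam * r))) r := fun r _ => by
    have h1 : HasDerivAt (fun r => 1 + k * Real.exp (-lam * r))
        (k * (Real.exp (-lam * r) * (-lam * 1))) r :=
      (((hasDerivAt_id r).const_mul (-lam)).exp.const_mul (k : ℝ)).const_add 1
    refine ((h1.log (by positivity)).const_mul (-(2 / lam))).congr_deriv ?_
    field_simp
  rw [intervalIntegral.integral_eq_sub_of_hasDerivAt hd
    (Continuous.intervalIntegrable (Continuous.div (by fun_prop) (by fun_prop)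
      fun r => by positivity) _ _)]
  have : 0 ≤ Real.log (1 + k * Real.exp (-lam * x)) := Real.log_nonneg (by
    have : 0 ≤ (k : ℝ) * Real.exp (-lam * x) := by positivity
    linarith)
  have h2 : 0 ≤ 2 / lam * Real.log (1 + k * Real.exp (-lam * x)) := by positivity
  simp only [mul_zero, Real.exp_zero, mul_one]
  linarith

/-- Integrating term by term leaves a multiple of `∑ k p_k log (1 + k)`, which is finite exactly
because of the `k log k` moment: `log (1 + k) ≤ log k + log 2` for `k ≥ 1`. -/
lemma exists_integral_linearizationDefect_le (hm : offspringMean p < 1)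
    (hLlogL : Summable fun k : ℕ => (k : ℝ) * Real.log k * (p k).toReal) {lam : ℝ}
    (hlam : 0 < lam) :
    ∃ B, ∀ x, 0 ≤ x → ∫ r in 0..x, linearizationDefect p lam r ≤ B := by
  have hlog : ∀ k : ℕ, (k : ℝ) * Real.log (1 + k) ≤ k * Real.log k + k * Real.log 2 := fun k => by
    rcases k.eq_zero_or_pos with rfl | hk
    · simp
    · have hk1 : (1 : ℝ) ≤ k := by exact_mod_cast hk
      rw [← mul_add, ← Real.log_mul (by positivity) (by norm_num)]
      gcongr
      linarith
  have hsum : Summable fun k : ℕ => (k : ℝ) * (p k).toReal * (2 / lam * Real.log (1 + k)) := by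
    refine Summable.of_nonneg_of_le (fun k => ?_) (fun k => ?_)
      ((hLlogL.add ((summable_mul_toReal hm).mul_right (Real.log 2))).mul_left (2 / lam))
    · have : 0 ≤ Real.log (1 + (k : ℝ)) :=
        Real.log_nonneg (by linarith [Nat.cast_nonneg (α := ℝ) k])
      positivity
    · have := mul_le_mul_of_nonneg_left (hlog k)
        (mul_nonneg (show 0 ≤ 2 / lam by positivity) (ENNReal.toReal_nonneg (a := p k)))
      linarith
  refine ⟨(survivalFunction p 1)⁻¹ *
    ∑' k : ℕ, (k : ℝ) * (p k).toReal * (2 / lam * Real.log (1 + k)),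
    fun x hx => ?_⟩
  simp only [linearizationDefect]
  rw [intervalIntegral.integral_const_mul]
  refine mul_le_mul_of_nonneg_left ?_ (inv_nonneg.2 (survivalFunction_nonneg p zero_le_one le_rfl))
  have hcont : ∀ k : ℕ, Continuous fun r => (k : ℝ) * (p k).toReal *
      (2 * (k * Real.exp (-lam * r)) / (1 + k * Real.exp (-lam * r))) := fun k =>
    continuous_const.mul (Continuous.div (by fun_prop) (by fun_prop) fun x => by positivity)
  have hs := intervalIntegral.hasSum_integral_of_dominated_convergence (μ := volume) (a := 0)
    (b := x) (F := fun (k : ℕ) r => (k : ℝ) * (p k).toReal *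
      (2 * (k * Real.exp (-lam * r)) / (1 + k * Real.exp (-lam * r))))
    (f := fun r => ∑' k : ℕ, (k : ℝ) * (p k).toReal *
      (2 * (k * Real.exp (-lam * r)) / (1 + k * Real.exp (-lam * r))))
    (fun k _ => (k : ℝ) * (p k).toReal * 2)
    (fun k => (hcont k).aestronglyMeasurable)
    (fun k => ae_of_all _ fun r _ => by
      rw [Real.norm_of_nonneg (linearizationDefect_term_nonneg p lam r k)]
      exact linearizationDefect_term_le p lam r k)
    (ae_of_all _ fun r _ => (summable_mul_toReal hm).mul_right 2)
    intervalIntegrable_const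
    (ae_of_all _ fun r _ => (summable_linearizationDefect hm lam r).hasSum)
  rw [← hs.tsum_eq]
  refine hs.summable.tsum_le_tsum (fun k => ?_) hsum
  rw [intervalIntegral.integral_const_mul]
  exact mul_le_mul_of_nonneg_left (integral_two_mul_div_one_add_le hlam k x) (by positivity)

end OffspringLaw

/-! ### Exponential moments of laws with one-sided Lévy measure. -/

section ExponentialMoments

lemma norm_pow_sub_pow_le {a b : ℂ} (ha : ‖a‖ ≤ 1) (hb : ‖b‖ ≤ 1) (n : ℕ) :
    ‖a ^ n - b ^ n‖ ≤ n * ‖a - b‖ := by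
  induction n with
  | zero => simp
  | succ n ih =>
    have h : a ^ (n + 1) - b ^ (n + 1) = a ^ n * (a - b) + b * (a ^ n - b ^ n) := by ring
    rw [h]
    refine (norm_add_le _ _).trans ?_
    rw [norm_mul, norm_mul, norm_pow]
    have h1 := mul_le_mul_of_nonneg_right (pow_le_one₀ (norm_nonneg a) ha (n := n))
      (norm_nonneg (a - b))
    have h2 := mul_le_mul_of_nonneg_right hb (norm_nonneg (a ^ n - b ^ n))
    push_cast
    linarith

lemma norm_exp_I_mul_sub_one_sub_le (y : ℝ) :
    ‖1 - Complex.exp (Complex.I * y) + Complex.I * y‖ ≤ 3 * y ^ 2 := by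
  have h0 : 1 - Complex.exp (Complex.I * y) + Complex.I * y =
      -(Complex.exp (Complex.I * y) - 1 - Complex.I * y) := by ring
  have hn : ‖Complex.I * y‖ = |y| := by simp
  rw [h0, norm_neg]
  rcases le_total |y| 1 with h | h
  · refine (Complex.norm_exp_sub_one_sub_id_le (by rwa [hn])).trans ?_
    rw [hn, sq_abs]
    nlinarith [sq_nonneg y]
  · have h1 : ‖Complex.exp (Complex.I * y)‖ = 1 := by
      rw [mul_comm, Complex.norm_exp_ofReal_mul_I]
    calc _ ≤ ‖Complex.exp (Complex.I * y)‖ + ‖(1 : ℂ)‖ + ‖Complex.I * y‖ :=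
          (norm_sub_le _ _).trans (add_le_add_left (norm_sub_le _ _) _)
      _ = 2 + |y| := by rw [h1, hn, norm_one]; ring
      _ ≤ 3 * y ^ 2 := by rw [← sq_abs]; nlinarith

/-- The restriction to `y ≤ 0` permits arbitrarily large `|y|`; through this bound, negative jumps
give exponential moments of every nonnegative order. -/
lemma exp_sub_one_sub_le_sq {y : ℝ} (hy : y ≤ 0) : Real.exp y - 1 - y ≤ y ^ 2 := by
  rcases le_total |y| 1 with h | h
  · exact (le_abs_self _).trans (Real.abs_exp_sub_one_sub_id_le h)
  · have h1 : Real.exp y ≤ 1 := Real.exp_le_one_iff.2 hy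
    rw [abs_of_nonpos hy] at h
    nlinarith

lemma lintegral_exp_mul_conv (μ ν : Measure ℝ) [SFinite ν] (θ : ℝ) :
    ∫⁻ x, ENNReal.ofReal (Real.exp (θ * x)) ∂(μ ∗ ν) =
      (∫⁻ x, ENNReal.ofReal (Real.exp (θ * x)) ∂μ) *
        ∫⁻ x, ENNReal.ofReal (Real.exp (θ * x)) ∂ν := by
  rw [Measure.lintegral_conv (by fun_prop), ← lintegral_mul_const _ (by fun_prop)]
  refine lintegral_congr fun x => ?_
  rw [← lintegral_const_mul _ (by fun_prop)]
  refine lintegral_congr fun y => ?_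
  rw [mul_add, Real.exp_add, ENNReal.ofReal_mul (Real.exp_pos _).le]

lemma exists_convolution_power (μ : Measure ℝ) [IsProbabilityMeasure μ] (n : ℕ) :
    ∃ π : Measure ℝ, IsProbabilityMeasure π ∧ (∀ θ, charFun π θ = charFun μ θ ^ n) ∧
      ∀ θ, ∫⁻ x, ENNReal.ofReal (Real.exp (θ * x)) ∂π =
        (∫⁻ x, ENNReal.ofReal (Real.exp (θ * x)) ∂μ) ^ n := by
  induction n with
  | zero => exact ⟨Measure.dirac 0, inferInstance, by simp, by simp⟩
  | succ n ih =>
    obtain ⟨π, hπ, h1, h2⟩ := ih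
    refine ⟨π ∗ μ, inferInstance, fun θ => ?_, fun θ => ?_⟩
    · rw [charFun_conv, h1, pow_succ]
    · rw [lintegral_exp_mul_conv, h2, pow_succ]

lemma norm_exp_I_mul_mul (θ x : ℝ) : ‖Complex.exp (Complex.I * θ * x)‖ = 1 := by
  have : Complex.I * θ * x = ((θ * x : ℝ) : ℂ) * Complex.I := by push_cast; ring
  rw [this, Complex.norm_exp_ofReal_mul_I]

lemma integrable_exp_I_mul (ν : Measure ℝ) [IsFiniteMeasure ν] (θ : ℝ) :
    Integrable (fun x : ℝ => Complex.exp (Complex.I * θ * x)) ν :=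
  Integrable.of_bound (C := 1) (by fun_prop) (ae_of_all _ fun x => (norm_exp_I_mul_mul θ x).le)

lemma integrable_exp_mul_of_nonpos {ν : Measure ℝ} [IsFiniteMeasure ν] (hν : ∀ᵐ x ∂ν, x < 0)
    {θ : ℝ} (hθ : 0 ≤ θ) : Integrable (fun x : ℝ => Real.exp (θ * x)) ν := by
  refine Integrable.of_bound (C := 1) (by fun_prop) ?_
  filter_upwards [hν] with x hx
  rw [Real.norm_of_nonneg (Real.exp_pos _).le]
  exact Real.exp_le_one_iff.2 (by nlinarith)

/-- The `n`-fold convolution power of a perturbation of `δ₀` of size `ν / n`. -/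
lemma exists_approximate_compound_poisson {ν : Measure ℝ} [IsFiniteMeasure ν]
    (hν : ∀ᵐ x ∂ν, x < 0) {n : ℕ} (hn : 0 < n) (hνn : ν.real Set.univ ≤ n) :
    ∃ π : Measure ℝ, IsProbabilityMeasure π ∧
      (∀ θ : ℝ, ‖charFun π θ -
        Complex.exp (∫ x : ℝ, (Complex.exp (Complex.I * θ * x) - 1) ∂ν)‖ ≤
          n * ‖Complex.exp ((∫ x : ℝ, (Complex.exp (Complex.I * θ * x) - 1) ∂ν) / n) - 1 -
            (∫ x : ℝ, (Complex.exp (Complex.I * θ * x) - 1) ∂ν) / n‖) ∧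
      ∀ θ : ℝ, 0 ≤ θ → ∫⁻ x, ENNReal.ofReal (Real.exp (θ * x)) ∂π ≤
        ENNReal.ofReal (Real.exp (∫ x : ℝ, (Real.exp (θ * x) - 1) ∂ν)) := by
  have hn' : (0 : ℝ) < n := by exact_mod_cast hn
  set r := ν.real Set.univ with hr
  have hr0 : 0 ≤ r := measureReal_nonneg
  have hrn : 0 ≤ 1 - r / n := sub_nonneg.2 ((div_le_one hn').2 hνn)
  -- The mass of `ν` is at most `n`, so the weights are nonnegative. The characteristic function of
  -- `σ` is `1 + w/n`, with `w` the compound Poisson exponent, and its `n`-th power is compared with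
  -- `(e^(w/n))^n`.
  set σ : Measure ℝ := ENNReal.ofReal (1 - r / n) • Measure.dirac 0 +
    ENNReal.ofReal (1 / n) • ν with hσ
  have : IsProbabilityMeasure σ := ⟨by
    rw [hσ, Measure.add_apply, Measure.smul_apply, Measure.smul_apply, measure_univ,
      ← ofReal_measureReal, ← hr, smul_eq_mul, smul_eq_mul, mul_one,
      ← ENNReal.ofReal_mul (by positivity), ← ENNReal.ofReal_add hrn (by positivity)]
    rw [show 1 - r / n + 1 / n * r = 1 by ring, ENNReal.ofReal_one]⟩
  obtain ⟨π, hπ, h1, h2⟩ := exists_convolution_power σ n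
  have hreal : ∀ θ : ℝ, ∫ x : ℝ, (Complex.exp (Complex.I * θ * x) - 1) ∂ν =
      (∫ x : ℝ, Complex.exp (Complex.I * θ * x) ∂ν) - r := fun θ => by
    rw [integral_sub (integrable_exp_I_mul ν θ) (integrable_const _), integral_const]
    simp [hr]
  have hchar : ∀ θ : ℝ, charFun σ θ =
      1 + (∫ x : ℝ, (Complex.exp (Complex.I * θ * x) - 1) ∂ν) / n := fun θ => by
    have hf : ∀ x : ℝ, Complex.exp (θ * x * Complex.I) = Complex.exp (Complex.I * θ * x) :=
      fun x => by ring_nf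
    rw [charFun_apply_real, hσ]
    simp_rw [hf]
    rw [integral_add_measure ((integrable_exp_I_mul _ θ).smul_measure ENNReal.ofReal_ne_top)
      ((integrable_exp_I_mul _ θ).smul_measure ENNReal.ofReal_ne_top), integral_smul_measure,
      integral_smul_measure, integral_dirac, hreal, ENNReal.toReal_ofReal hrn,
      ENNReal.toReal_ofReal (by positivity)]
    simp only [Complex.ofReal_zero, mul_zero, Complex.exp_zero, Complex.real_smul]
    push_cast
    ring
  refine ⟨π, hπ, fun θ => ?_, fun θ hθ => ?_⟩
  · set w := ∫ x : ℝ, (Complex.exp (Complex.I * θ * x) - 1) ∂ν with hw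
    have hre : w.re ≤ 0 := by
      rw [hreal θ] at hw
      have h3 : ‖∫ x : ℝ, Complex.exp (Complex.I * θ * x) ∂ν‖ ≤ r := by
        refine (norm_integral_le_integral_norm _).trans (le_of_eq ?_)
        simp_rw [norm_exp_I_mul_mul]
        simp [hr]
      have h4 := (Complex.re_le_norm _).trans h3
      rw [hw, Complex.sub_re, Complex.ofReal_re]
      linarith
    have hexp : Complex.exp w = Complex.exp (w / n) ^ n := by
      have hnC : (n : ℂ) ≠ 0 := by exact_mod_cast hn.ne'
      rw [← Complex.exp_nat_mul]
      congr 1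
      field_simp
    rw [h1, hexp]
    refine (norm_pow_sub_pow_le (norm_charFun_le_one _) ?_ n).trans ?_
    · rw [Complex.norm_exp, Real.exp_le_one_iff, Complex.div_natCast_re]
      exact div_nonpos_of_nonpos_of_nonneg hre hn'.le
    · rw [hchar, ← norm_neg]
      refine le_of_eq ?_
      congr 2
      ring
  · rw [h2]
    have hint := integrable_exp_mul_of_nonpos hν hθ
    have hI : ∫⁻ x, ENNReal.ofReal (Real.exp (θ * x)) ∂σ =
        ENNReal.ofReal (1 + (∫ x : ℝ, (Real.exp (θ * x) - 1) ∂ν) / n) := by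
      rw [hσ, lintegral_add_measure, lintegral_smul_measure, lintegral_smul_measure,
        lintegral_dirac' _ (by fun_prop), ← ofReal_integral_eq_lintegral_ofReal hint
          (ae_of_all _ fun x => (Real.exp_pos _).le), smul_eq_mul, smul_eq_mul,
        ← ENNReal.ofReal_mul hrn, ← ENNReal.ofReal_mul (by positivity),
        ← ENNReal.ofReal_add (by positivity)
          (mul_nonneg (by positivity) (integral_nonneg fun x => (Real.exp_pos _).le)),
        integral_sub hint (integrable_const _), integral_const]
      congr 1
      simp only [mul_zero, Real.exp_zero, mul_one, smul_eq_mul, ← hr]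
      ring
    rw [hI]
    set w := ∫ x : ℝ, (Real.exp (θ * x) - 1) ∂ν
    calc ENNReal.ofReal (1 + w / n) ^ n ≤ ENNReal.ofReal (Real.exp (w / n)) ^ n := by
          gcongr
          have := Real.add_one_le_exp (w / n)
          linarith
      _ = _ := by
          rw [← ENNReal.ofReal_pow (Real.exp_pos _).le, ← Real.exp_nat_mul]
          congr 2
          field_simp

lemma lintegral_exp_mul_gaussianReal (b : ℝ) (v : ℝ≥0) (θ : ℝ) :
    ∫⁻ x, ENNReal.ofReal (Real.exp (θ * x)) ∂(gaussianReal b v) =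
      ENNReal.ofReal (Real.exp (b * θ + v * θ ^ 2 / 2)) := by
  rw [← ofReal_integral_eq_lintegral_ofReal (integrable_exp_mul_gaussianReal θ)
    (ae_of_all _ fun x => (Real.exp_pos _).le)]
  congr 1
  exact congrFun (mgf_fun_id_gaussianReal (μ := b) (v := v)) θ

/-- Exponential moments pass to weak limits. -/
lemma lintegral_exp_mul_le_of_tendsto_charFun {μ : Measure ℝ} [IsProbabilityMeasure μ]
    {π : ℕ → Measure ℝ} [∀ k, IsProbabilityMeasure (π k)]
    (hlim : ∀ t, Tendsto (fun k => charFun (π k) t) atTop (𝓝 (charFun μ t))) {θ : ℝ} {C : ℝ≥0∞}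
    (hC : ∀ k, ∫⁻ x, ENNReal.ofReal (Real.exp (θ * x)) ∂(π k) ≤ C) :
    ∫⁻ x, ENNReal.ofReal (Real.exp (θ * x)) ∂μ ≤ C := by
  let πp : ℕ → ProbabilityMeasure ℝ := fun k => ⟨π k, inferInstance⟩
  let μp : ProbabilityMeasure ℝ := ⟨μ, inferInstance⟩
  have hweak : Tendsto πp atTop (𝓝 μp) := ProbabilityMeasure.tendsto_of_tendsto_charFun hlim
  rw [ProbabilityMeasure.tendsto_iff_forall_lintegral_tendsto] at hweak
  -- The exponential is unbounded, so weak convergence is applied to its truncation at `M`; monotone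
  -- convergence in `M` finishes.
  have hM : ∀ M : ℕ, ∫⁻ x, min (ENNReal.ofReal (Real.exp (θ * x))) M ∂μ ≤ C := fun M => by
    let f : BoundedContinuousFunction ℝ ℝ≥0 := BoundedContinuousFunction.mkOfBound
      ⟨fun x => min (Real.toNNReal (Real.exp (θ * x))) M, by fun_prop⟩ M fun x y => by
        rw [NNReal.dist_eq, abs_le]
        have h1 : ((min (Real.toNNReal (Real.exp (θ * x))) M : ℝ≥0) : ℝ) ≤ M := by
          exact_mod_cast min_le_right _ _
        have h2 : ((min (Real.toNNReal (Real.exp (θ * y))) M : ℝ≥0) : ℝ) ≤ M := by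
          exact_mod_cast min_le_right _ _
        have h3 := NNReal.coe_nonneg (min (Real.toNNReal (Real.exp (θ * x))) M)
        have h4 := NNReal.coe_nonneg (min (Real.toNNReal (Real.exp (θ * y))) M)
        simp only [ContinuousMap.coe_mk]
        constructor <;> linarith
    have hfx : ∀ x, (f x : ℝ≥0∞) = min (ENNReal.ofReal (Real.exp (θ * x))) M := fun x => by
      change ((min (Real.toNNReal (Real.exp (θ * x))) M : ℝ≥0) : ℝ≥0∞) = _
      rw [ENNReal.coe_min]
      rfl
    have := hweak f
    simp only [hfx, πp, μp, ProbabilityMeasure.coe_mk] at this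
    exact le_of_tendsto' this fun k => (lintegral_mono fun x => min_le_left _ _).trans (hC k)
  have hsup : ∀ x, ENNReal.ofReal (Real.exp (θ * x)) =
      ⨆ M : ℕ, min (ENNReal.ofReal (Real.exp (θ * x))) M := fun x => by
    refine le_antisymm ?_ (iSup_le fun M => min_le_left _ _)
    obtain ⟨M, hM⟩ := exists_nat_ge (Real.exp (θ * x))
    refine le_iSup_of_le M (le_min le_rfl ?_)
    rw [← ENNReal.ofReal_natCast]
    exact ENNReal.ofReal_le_ofReal hM
  rw [lintegral_congr hsup, lintegral_iSup
    (f := fun (M : ℕ) x => min (ENNReal.ofReal (Real.exp (θ * x))) M)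
    (fun M => by fun_prop) fun M N hMN x =>
    min_le_min_left _ (by exact_mod_cast hMN)]
  exact iSup_le hM

lemma integrable_min_one_sq {ν : Measure ℝ}
    (hν2 : ∫⁻ x, ENNReal.ofReal (min 1 (x ^ 2)) ∂ν < ∞) :
    Integrable (fun x : ℝ => min 1 (x ^ 2)) ν :=
  ⟨by fun_prop, (hasFiniteIntegral_iff_ofReal
    (ae_of_all _ fun x => le_min zero_le_one (sq_nonneg x))).2 hν2⟩

lemma integrable_levyKhintchine_integrand {ν : Measure ℝ}
    (hν2 : ∫⁻ x, ENNReal.ofReal (min 1 (x ^ 2)) ∂ν < ∞) (t : ℝ) :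
    Integrable (fun x : ℝ => 1 - Complex.exp (Complex.I * t * x) +
      (if |x| < 1 then Complex.I * t * x else 0)) ν := by
  refine Integrable.mono' ((integrable_min_one_sq hν2).const_mul (2 + 3 * t ^ 2)) ?_
    (ae_of_all _ fun x => ?_)
  · refine Measurable.aestronglyMeasurable (Measurable.add (by fun_prop) ?_)
    exact Measurable.ite (measurableSet_lt (by fun_prop) measurable_const) (by fun_prop)
      measurable_const
  · split_ifs with h
    · have hx2 : x ^ 2 ≤ 1 := by rw [← sq_abs]; exact pow_le_one₀ (abs_nonneg x) h.le
      rw [min_eq_right hx2]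
      have := norm_exp_I_mul_sub_one_sub_le (t * x)
      push_cast at this
      rw [← mul_assoc] at this
      nlinarith [sq_nonneg x]
    · have hx2 : 1 ≤ x ^ 2 := by rw [← sq_abs]; exact one_le_pow₀ (not_lt.1 h)
      rw [min_eq_left hx2, add_zero]
      refine (norm_sub_le _ _).trans ?_
      rw [norm_exp_I_mul_mul, norm_one]
      nlinarith [sq_nonneg t]

/-- A probability measure with a Lévy–Khintchine exponent whose Lévy measure lives on the negative
half-line has positive exponential moments. -/
theorem lintegral_exp_mul_lt_top_of_levyKhintchine {μ ν : Measure ℝ} [IsProbabilityMeasure μ]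
    {b : ℝ} {σsq : ℝ≥0} (hν : ∀ᵐ x ∂ν, x < 0)
    (hν2 : ∫⁻ x, ENNReal.ofReal (min 1 (x ^ 2)) ∂ν < ∞)
    (hchar : ∀ θ, charFun μ θ = Complex.exp (-levyKhintchineExponent b σsq ν θ)) {θ : ℝ}
    (hθ : 0 ≤ θ) : ∫⁻ x, ENNReal.ofReal (Real.exp (θ * x)) ∂μ < ∞ := by
  have hmin0 : ∀ x : ℝ, 0 ≤ min 1 (x ^ 2) := fun x => le_min zero_le_one (sq_nonneg x)
  have hmin := integrable_min_one_sq hν2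
  -- Discarding the jumps larger than `-1/(k+1)` leaves a finite Lévy measure, to which the compound
  -- Poisson approximation applies.
  set T : ℕ → Set ℝ := fun k => Set.Iic (-(1 / ((k : ℝ) + 1))) with hT
  have hTm : ∀ k, MeasurableSet (T k) := fun k => measurableSet_Iic
  have hε : ∀ k : ℕ, 0 < 1 / ((k : ℝ) + 1) ∧ 1 / ((k : ℝ) + 1) ≤ 1 := fun k =>
    ⟨by positivity, (div_le_one (by positivity)).2 (by linarith [Nat.cast_nonneg (α := ℝ) k])⟩
  have hfin : ∀ k, IsFiniteMeasure (ν.restrict (T k)) := fun k => by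
    refine ⟨?_⟩
    rw [Measure.restrict_apply_univ]
    refine (measure_mono fun x hx => ?_).trans_lt
      (hmin.measure_ge_lt_top (ε := (1 / ((k : ℝ) + 1)) ^ 2) (by positivity))
    have h1 := hε k
    have hx' : x ≤ -(1 / ((k : ℝ) + 1)) := hx
    exact le_min (pow_le_one₀ h1.1.le h1.2) (by nlinarith)
  have hneg : ∀ k, ∀ᵐ x ∂(ν.restrict (T k)), x < 0 := fun k => ae_restrict_of_ae hν
  set c : ℕ → ℝ := fun k => ∫ x, (if |x| < 1 then x else 0) ∂(ν.restrict (T k)) with hc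
  set a : ℕ → ℝ → ℂ := fun k t =>
    ∫ x : ℝ, (Complex.exp (Complex.I * t * x) - 1) ∂(ν.restrict (T k)) with ha
  have hitemeas : Measurable fun x : ℝ => if |x| < 1 then x else 0 :=
    Measurable.ite (measurableSet_lt (by fun_prop) measurable_const) measurable_id measurable_const
  have hiteint : ∀ k, Integrable (fun x : ℝ => if |x| < 1 then x else 0) (ν.restrict (T k)) :=
    fun k => Integrable.of_bound (C := 1) hitemeas.aestronglyMeasurable
      (ae_of_all _ fun x => by
        split_ifs with h
        · exact h.le
        · simp)
  have hπ : ∀ k : ℕ, ∃ π : Measure ℝ, IsProbabilityMeasure π ∧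
      (∀ t, ‖charFun π t - Complex.exp (a k t)‖ ≤ 1 / ((k : ℝ) + 1)) ∧
      ∀ t, 0 ≤ t → ∫⁻ x, ENNReal.ofReal (Real.exp (t * x)) ∂π ≤
        ENNReal.ofReal (Real.exp (∫ x : ℝ, (Real.exp (t * x) - 1) ∂(ν.restrict (T k)))) := by
    intro k
    set r := (ν.restrict (T k)).real Set.univ with hr
    have hr0 : 0 ≤ r := measureReal_nonneg
    -- `n ≥ 2r` puts the exponent divided by `n` into the unit disc, where the second-order bound
    -- for the exponential holds. The total error is then `n (2r/n)² = 4r²/n`, and `n ≥ 4r²(k+1)`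
    -- makes it at most `1/(k+1)`.
    obtain ⟨n, hn⟩ := exists_nat_ge (max 1 (max (2 * r) (4 * r ^ 2 * (k + 1))))
    have hn1 : (1 : ℝ) ≤ n := (le_max_left _ _).trans hn
    have hn2 : 2 * r ≤ n := (le_max_left _ _).trans ((le_max_right _ _).trans hn)
    have hn3 : 4 * r ^ 2 * (k + 1) ≤ n := (le_max_right _ _).trans ((le_max_right _ _).trans hn)
    have hn0 : (0 : ℝ) < n := by linarith
    obtain ⟨π, h1, h2, h3⟩ := exists_approximate_compound_poisson (hneg k) (n := n)
      (by exact_mod_cast hn0) (by linarith)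
    refine ⟨π, h1, fun t => (h2 t).trans ?_, h3⟩
    have ha2 : ‖a k t‖ ≤ 2 * r := by
      refine (norm_integral_le_of_norm_le_const (ae_of_all _ fun x => ?_)).trans_eq
        (by rw [hr])
      refine (norm_sub_le _ _).trans_eq ?_
      rw [norm_exp_I_mul_mul, norm_one]; norm_num
    have ha3 : ‖a k t / n‖ ≤ 2 * r / n := by
      rw [norm_div, Complex.norm_natCast]; gcongr
    have ha4 := Complex.norm_exp_sub_one_sub_id_le (ha3.trans ((div_le_one hn0).2 hn2))
    calc (n : ℝ) * _ ≤ n * (2 * r / n) ^ 2 := by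
          refine mul_le_mul_of_nonneg_left (ha4.trans ?_) hn0.le
          gcongr
      _ = 4 * r ^ 2 / n := by field_simp; ring
      _ ≤ 1 / ((k : ℝ) + 1) := by
          rw [div_le_div_iff₀ hn0 (by positivity)]; linarith
  choose π hπprob hπchar hπexp using hπ
  have hΨ : ∀ (k : ℕ) (t : ℝ), Complex.exp (-levyKhintchineExponent b σsq (ν.restrict (T k)) t) =
      charFun (gaussianReal (b - c k) σsq) t * Complex.exp (a k t) := by
    intro k t
    rw [charFun_gaussianReal, ← Complex.exp_add, levyKhintchineExponent]
    congr 1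
    have h1 : ∀ x : ℝ, (1 - Complex.exp (Complex.I * t * x) +
        (if |x| < 1 then Complex.I * t * x else 0)) =
        -(Complex.exp (Complex.I * t * x) - 1) +
          Complex.I * t * ((if |x| < 1 then x else 0 : ℝ) : ℂ) := fun x => by
      split_ifs <;> push_cast <;> ring
    simp_rw [h1]
    have h2 : Integrable (fun x : ℝ => -(Complex.exp (Complex.I * t * x) - 1))
        (ν.restrict (T k)) := ((integrable_exp_I_mul _ t).sub (integrable_const _)).neg
    have h3 : Integrable (fun x : ℝ => Complex.I * t * ((if |x| < 1 then x else 0 : ℝ) : ℂ))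
        (ν.restrict (T k)) := ((hiteint k).ofReal (𝕜 := ℂ)).const_mul _
    rw [integral_add h2 h3, integral_neg, integral_const_mul,
      integral_complex_ofReal]
    simp only [hc, ha]
    push_cast
    ring
  have hlim : ∀ t, Tendsto (fun k => charFun (gaussianReal (b - c k) σsq ∗ π k) t) atTop
      (𝓝 (charFun μ t)) := by
    intro t
    have hg := integrable_levyKhintchine_integrand hν2 t
    have hTmono : Monotone T := fun j k hjk => Set.Iic_subset_Iic.2
      (neg_le_neg (one_div_le_one_div_of_le (by positivity) (by
        have : (j : ℝ) ≤ k := by exact_mod_cast hjk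
        linarith)))
    have hUnion : ∀ᵐ x ∂ν, x ∈ ⋃ k, T k := by
      filter_upwards [hν] with x hx
      obtain ⟨k, hk⟩ := exists_nat_one_div_lt (neg_pos.2 hx)
      exact Set.mem_iUnion.2 ⟨k, by change x ≤ _; linarith⟩
    have h1 := tendsto_setIntegral_of_monotone hTm hTmono hg.integrableOn
    rw [Measure.restrict_eq_self_of_ae_mem hUnion] at h1
    have h2 : Tendsto (fun k => charFun (gaussianReal (b - c k) σsq) t * Complex.exp (a k t)) atTop
        (𝓝 (charFun μ t)) := by
      rw [hchar]
      simp_rw [← hΨ]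
      exact (Complex.continuous_exp.tendsto _).comp (h1.const_add _).neg
    have h3 : Tendsto (fun k => charFun (gaussianReal (b - c k) σsq ∗ π k) t -
        charFun (gaussianReal (b - c k) σsq) t * Complex.exp (a k t)) atTop (𝓝 0) := by
      refine squeeze_zero_norm (fun k => ?_) tendsto_one_div_add_atTop_nhds_zero_nat
      rw [charFun_conv, ← mul_sub, norm_mul]
      exact (mul_le_of_le_one_left (norm_nonneg _) (norm_charFun_le_one _)).trans (hπchar k t)
    simpa using h3.add h2
  -- The constant is uniform in `k`: the centring `-θ c k` of the Gaussian factor compensates the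
  -- small jumps, leaving at most `θ² x²` for each, while the jumps with `|x| ≥ 1` contribute a
  -- nonpositive amount.
  refine (lintegral_exp_mul_le_of_tendsto_charFun hlim
    (C := ENNReal.ofReal (Real.exp (b * θ + σsq * θ ^ 2 / 2 + θ ^ 2 * ∫ x, min 1 (x ^ 2) ∂ν)))
    fun k => ?_).trans_lt ENNReal.ofReal_lt_top
  rw [lintegral_exp_mul_conv, lintegral_exp_mul_gaussianReal]
  refine (mul_le_mul_right (hπexp k θ hθ) _).trans ?_
  rw [← ENNReal.ofReal_mul (Real.exp_pos _).le, ← Real.exp_add]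
  refine ENNReal.ofReal_le_ofReal (Real.exp_le_exp.2 ?_)
  have hexpint := (integrable_exp_mul_of_nonpos (hneg k) hθ).sub (integrable_const (1 : ℝ))
  have h1 : (∫ x : ℝ, (Real.exp (θ * x) - 1) ∂(ν.restrict (T k))) - θ * c k ≤
      θ ^ 2 * ∫ x, min 1 (x ^ 2) ∂ν := by
    calc _ = ∫ x : ℝ, (Real.exp (θ * x) - 1 - θ * (if |x| < 1 then x else 0))
          ∂(ν.restrict (T k)) := by
          rw [hc, ← integral_const_mul]
          exact (integral_sub hexpint ((hiteint k).const_mul θ)).symm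
      _ ≤ ∫ x : ℝ, θ ^ 2 * min 1 (x ^ 2) ∂(ν.restrict (T k)) := by
          refine integral_mono_ae (hexpint.sub ((hiteint k).const_mul θ))
            (hmin.restrict.const_mul _) ?_
          filter_upwards [hneg k] with x hx
          split_ifs with h
          · have hx2 : x ^ 2 ≤ 1 := by rw [← sq_abs]; exact pow_le_one₀ (abs_nonneg x) h.le
            rw [min_eq_right hx2]
            have := exp_sub_one_sub_le_sq (y := θ * x) (by nlinarith)
            nlinarith
          · have : Real.exp (θ * x) ≤ 1 := Real.exp_le_one_iff.2 (by nlinarith)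
            have := mul_nonneg (sq_nonneg θ) (hmin0 x)
            linarith
      _ = θ ^ 2 * ∫ x, min 1 (x ^ 2) ∂(ν.restrict (T k)) := integral_const_mul _ _
      _ ≤ _ := mul_le_mul_of_nonneg_left
          (setIntegral_le_integral hmin (ae_of_all _ hmin0)) (sq_nonneg θ)
  linarith

end ExponentialMoments

/-! ### The Laplace transform of the stable process and positivity of its constant. -/

section StableProcess

lemma measurable_stableLevyDensity (α cPos cNeg : ℝ) : Measurable fun x : ℝ => ENNReal.ofReal
    (if 0 < x then cPos * x ^ (-(1 + α)) else if x < 0 then cNeg * |x| ^ (-(1 + α)) else 0) := by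
  refine (Measurable.ite measurableSet_Ioi (by fun_prop)
    (Measurable.ite measurableSet_Iio ?_ measurable_const)).ennreal_ofReal
  exact ((measurable_id.abs).pow_const _).const_mul _

lemma ae_neg_stableLevyMeasure (α cNeg : ℝ) : ∀ᵐ x ∂(stableLevyMeasure α 0 cNeg), x < 0 := by
  rw [stableLevyMeasure, ae_withDensity_iff (measurable_stableLevyDensity α 0 cNeg)]
  refine ae_of_all _ fun x hx => ?_
  by_contra h
  rw [if_neg h] at hx
  simp at hx

variable {Ω₀ : Type*} [MeasurableSpace Ω₀] {P₀ : Measure Ω₀} {ξ : ℝ≥0 → Ω₀ → ℝ}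
  {α cNeg η : ℝ}

lemma IsStrictlyStableProcess.identDistrib (hξ : IsStrictlyStableProcess α 0 cNeg η ξ P₀)
    {t : ℝ≥0} (ht : 0 < t) :
    IdentDistrib (ξ t) (fun ω => (t : ℝ) ^ (1 / α) * ξ 1 ω) P₀ P₀ := by
  have := (hξ.scaling t ht).comp (measurable_pi_apply (1 : ℝ≥0))
  simpa [Function.comp_def] using this

lemma IsStrictlyStableProcess.mgf_eq (hξ : IsStrictlyStableProcess α 0 cNeg η ξ P₀)
    {t : ℝ≥0} (ht : 0 < t) (θ : ℝ) : mgf (ξ t) P₀ θ = mgf (ξ 1) P₀ (θ * (t : ℝ) ^ (1 / α)) := by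
  have h := ((hξ.identDistrib ht).comp (u := fun x => Real.exp (θ * x)) (by fun_prop)).integral_eq
  simpa [mgf, Function.comp_def, mul_assoc] using h

lemma IsStrictlyStableProcess.mgf_add (hξ : IsStrictlyStableProcess α 0 cNeg η ξ P₀)
    (s t : ℝ≥0) : mgf (ξ (s + t)) P₀ 1 = mgf (ξ s) P₀ 1 * mgf (ξ t) P₀ 1 := by
  have hm := hξ.levy.measurable
  have hind := hξ.levy.indep_increments.indepFun_eval_sub (zero_le (a := s))
    (le_self_add : s ≤ s + t) hξ.levy.start_zero
  have h1 := hind.mgf_add' (t := 1) (hm s).aestronglyMeasurable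
    ((hm (s + t)).sub (hm s)).aestronglyMeasurable
  have h2 : ξ s + (ξ (s + t) - ξ s) = ξ (s + t) := by abel
  rw [h2] at h1
  rw [h1]
  congr 1
  have h := ((hξ.levy.stationary_increments s t).comp (u := fun x => Real.exp (1 * x))
    (by fun_prop)).integral_eq
  simpa [mgf, Function.comp_def] using h

variable [IsProbabilityMeasure P₀]

lemma IsStrictlyStableProcess.integrable_exp_one (hξ : IsStrictlyStableProcess α 0 cNeg η ξ P₀)
    {θ : ℝ} (hθ : 0 ≤ θ) : Integrable (fun ω => Real.exp (θ * ξ 1 ω)) P₀ := by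
  obtain ⟨b, σsq, ht, -⟩ := hξ.triplet
  have hmeas := hξ.levy.measurable 1
  have := Measure.isProbabilityMeasure_map hmeas.aemeasurable (μ := P₀)
  have h := lintegral_exp_mul_lt_top_of_levyKhintchine (μ := P₀.map (ξ 1))
    (ae_neg_stableLevyMeasure α cNeg) ht.lintegral_lt_top
    (fun θ => by simpa using ht.charFun_eq 1 θ) hθ
  rw [lintegral_map (by fun_prop) hmeas] at h
  exact ⟨by fun_prop, (hasFiniteIntegral_iff_ofReal (ae_of_all _ fun ω => (Real.exp_pos _).le)).2 h⟩

lemma IsStrictlyStableProcess.integrable_exp (hξ : IsStrictlyStableProcess α 0 cNeg η ξ P₀)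
    (t : ℝ≥0) {θ : ℝ} (hθ : 0 ≤ θ) : Integrable (fun ω => Real.exp (θ * ξ t ω)) P₀ := by
  rcases eq_or_ne t 0 with rfl | ht
  · refine (integrable_const (1 : ℝ)).congr ?_
    filter_upwards [hξ.levy.start_zero] with ω h
    simp [h]
  · have h := (hξ.identDistrib (pos_iff_ne_zero.2 ht)).comp
      (u := fun x => Real.exp (θ * x)) (by fun_prop)
    refine h.integrable_iff.2 ?_
    have h2 := hξ.integrable_exp_one (θ := θ * (t : ℝ) ^ (1 / α)) (by positivity)
    simpa [Function.comp_def, mul_assoc] using h2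

/-- Independent stationary increments settle rational times. Scaling rewrites the dependence on `t`
as evaluation of the moment generating function of `ξ 1` at `t^(1/α)`, which is continuous, and this
carries the formula to all `t > 0`. -/
lemma IsStrictlyStableProcess.mgf_one_eq_exp (hξ : IsStrictlyStableProcess α 0 cNeg η ξ P₀)
    {t : ℝ≥0} (ht : 0 < t) :
    mgf (ξ t) P₀ 1 = Real.exp (t * laplaceConstant ξ P₀) := by
  have hpos : ∀ s, 0 < mgf (ξ s) P₀ 1 := fun s => mgf_pos (hξ.integrable_exp s zero_le_one)
  set g : ℝ≥0 → ℝ := fun s => Real.log (mgf (ξ s) P₀ 1) with hg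
  have hgadd : ∀ s t, g (s + t) = g s + g t := fun s t => by
    rw [hg]; simp only
    rw [hξ.mgf_add, Real.log_mul (hpos s).ne' (hpos t).ne']
  have hgnat : ∀ (n : ℕ) s, g (n * s) = n * g s := fun n s => by
    induction n with
    | zero =>
      have := hgadd 0 0
      simp only [add_zero] at this
      simp only [Nat.cast_zero, zero_mul]
      linarith
    | succ n ih => rw [Nat.cast_succ, add_mul, one_mul, hgadd, ih]; push_cast; ring
  have hg1 : g 1 = laplaceConstant ξ P₀ := by simp [hg, laplaceConstant, mgf]
  have hgdiv : ∀ k n : ℕ, 0 < n → g (k / n) = (k / n : ℝ) * laplaceConstant ξ P₀ := fun k n hn => by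
    have hn0 : (n : ℝ≥0) ≠ 0 := by exact_mod_cast hn.ne'
    have hn1 : (n : ℝ) ≠ 0 := by exact_mod_cast hn.ne'
    have h1 := hgnat n (k / n)
    rw [mul_div_cancel₀ _ hn0] at h1
    have h2 := hgnat k 1
    rw [mul_one, hg1] at h2
    rw [h2] at h1
    field_simp
    linarith
  have hcont : ContinuousOn (mgf (ξ 1) P₀) (Set.Ioi 0) := by
    refine continuousOn_mgf.mono (interior_maximal (fun θ hθ => ?_) isOpen_Ioi)
    exact hξ.integrable_exp_one (le_of_lt hθ)
  have hlim : Tendsto (fun n : ℕ => ((⌈(t : ℝ) * n⌉₊ : ℝ) / n)) atTop (𝓝 (t : ℝ)) :=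
    (tendsto_nat_ceil_mul_div_atTop t.coe_nonneg).comp tendsto_natCast_atTop_atTop
  have ht' : (0 : ℝ) < t := ht
  have h1 : Tendsto (fun n : ℕ => mgf (ξ 1) P₀ (((⌈(t : ℝ) * n⌉₊ : ℝ) / n) ^ (1 / α))) atTop
      (𝓝 (mgf (ξ 1) P₀ ((t : ℝ) ^ (1 / α)))) :=
    ((hcont.continuousAt (Ioi_mem_nhds (Real.rpow_pos_of_pos ht' _))).tendsto).comp
      (hlim.rpow_const (Or.inl ht'.ne'))
  have h2 : Tendsto (fun n : ℕ => Real.exp (((⌈(t : ℝ) * n⌉₊ : ℝ) / n) * laplaceConstant ξ P₀))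
      atTop (𝓝 (Real.exp (t * laplaceConstant ξ P₀))) :=
    (Real.continuous_exp.tendsto _).comp (hlim.mul_const _)
  rw [hξ.mgf_eq ht, one_mul]
  refine tendsto_nhds_unique h1 (h2.congr' ?_)
  filter_upwards [eventually_gt_atTop 0] with n hn
  have hn1 : (0 : ℝ) < n := by exact_mod_cast hn
  have hk : 0 < ⌈(t : ℝ) * n⌉₊ := Nat.ceil_pos.2 (by positivity)
  have hs : (0 : ℝ≥0) < (⌈(t : ℝ) * n⌉₊ : ℝ≥0) / n := by
    have : (0 : ℝ≥0) < n := by exact_mod_cast hn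
    have : (0 : ℝ≥0) < ⌈(t : ℝ) * n⌉₊ := by exact_mod_cast hk
    positivity
  have h3 := hξ.mgf_eq hs 1
  rw [one_mul] at h3
  have h4 := hgdiv ⌈(t : ℝ) * n⌉₊ n hn
  push_cast at h3
  rw [← h3, ← h4, Real.exp_log (hpos _)]

/-- Scaling trades the parameter for time: `θ ξ_t` has the law of `ξ` at time `t θ^α`. -/
lemma IsStrictlyStableProcess.mgf_eq_exp (hξ : IsStrictlyStableProcess α 0 cNeg η ξ P₀)
    (hα : 0 < α) (t : ℝ≥0) {θ : ℝ} (hθ : 0 ≤ θ) :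
    mgf (ξ t) P₀ θ = Real.exp (t * (laplaceConstant ξ P₀ * θ ^ α)) := by
  rcases hθ.eq_or_lt with rfl | hθ
  · simp [Real.zero_rpow hα.ne']
  rcases eq_or_ne t 0 with rfl | ht
  · have : mgf (ξ 0) P₀ θ = ∫ ω, (1 : ℝ) ∂P₀ := integral_congr_ae (by
      filter_upwards [hξ.levy.start_zero] with ω h
      simp [h])
    simp [this]
  · have ht0 : 0 < t := pos_iff_ne_zero.2 ht
    have ht' : (0 : ℝ) < t := ht0
    have hs : 0 < t * Real.toNNReal (θ ^ α) :=
      mul_pos ht0 (Real.toNNReal_pos.2 (Real.rpow_pos_of_pos hθ _))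
    have h1 := hξ.mgf_eq hs 1
    rw [hξ.mgf_one_eq_exp hs] at h1
    rw [hξ.mgf_eq ht0]
    have h2 : ((t * Real.toNNReal (θ ^ α) : ℝ≥0) : ℝ) = t * θ ^ α := by
      rw [NNReal.coe_mul, Real.coe_toNNReal _ (Real.rpow_pos_of_pos hθ _).le]
    rw [h2] at h1
    have h3 : (t * θ ^ α : ℝ) ^ (1 / α) = θ * (t : ℝ) ^ (1 / α) := by
      rw [Real.mul_rpow ht'.le (Real.rpow_pos_of_pos hθ _).le, ← Real.rpow_mul hθ.le,
        mul_one_div_cancel hα.ne', Real.rpow_one, mul_comm]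
    rw [h3, one_mul] at h1
    rw [← h1]
    ring_nf

/-- With zero Lévy measure `ξ 1` is Gaussian with mean `-η`, so the constant is `-η + σsq/2`. The
variance only helps, and its value need not be determined. -/
lemma IsStrictlyStableProcess.laplaceConstant_pos_of_one (hξ : IsStrictlyStableProcess 1 0 0 η ξ P₀)
    (hη : η < 0) : 0 < laplaceConstant ξ P₀ := by
  obtain ⟨b, σsq, ht, hb⟩ := hξ.triplet
  have hmeas := hξ.levy.measurable 1
  have := Measure.isProbabilityMeasure_map hmeas.aemeasurable (μ := P₀)
  have hν : stableLevyMeasure 1 0 0 = 0 := by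
    have : (fun x : ℝ => ENNReal.ofReal (if 0 < x then 0 * x ^ (-(1 + 1 : ℝ)) else
        if x < 0 then 0 * |x| ^ (-(1 + 1 : ℝ)) else 0)) = 0 := by
      ext x; split_ifs <;> simp
    rw [stableLevyMeasure, this, withDensity_zero]
  have hlaw : P₀.map (ξ 1) = gaussianReal b σsq := by
    refine Measure.ext_of_charFun (funext fun θ => ?_)
    rw [charFun_gaussianReal]
    refine (ht.charFun_eq 1 θ).trans ?_
    rw [levyKhintchineExponent, hν, integral_zero_measure]
    congr 1
    push_cast
    ring
  have h1 := mgf_gaussianReal hlaw 1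
  have h2 : laplaceConstant ξ P₀ = Real.log (mgf (ξ 1) P₀ 1) := by simp [laplaceConstant, mgf]
  rw [h2, h1, Real.log_exp, hb rfl]
  have := σsq.coe_nonneg
  linarith

/-- Bernoulli's inequality `e^ξ ≥ 1 + n (e^(ξ/n) - 1)` gives, in expectation, `e^C ≥ 1 + n (e^(C
n^(-α)) - 1) ≥ 1 + C n^(1-α)`. The right side tends to `1` because `α > 1`. -/
lemma IsStrictlyStableProcess.laplaceConstant_nonneg
    (hξ : IsStrictlyStableProcess α 0 cNeg η ξ P₀) (hα : 1 < α) : 0 ≤ laplaceConstant ξ P₀ := by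
  set C := laplaceConstant ξ P₀ with hC
  have hα0 : 0 < α := by linarith
  have hmgf : ∀ θ, 0 ≤ θ → mgf (ξ 1) P₀ θ = Real.exp (C * θ ^ α) := fun θ hθ => by
    simpa using hξ.mgf_eq_exp hα0 1 hθ
  have hb : ∀ n : ℕ, 0 < n → 1 + C * (n : ℝ) ^ (1 - α) ≤ Real.exp C := fun n hn => by
    have hn0 : (0 : ℝ) < n := by exact_mod_cast hn
    have h1 : ∀ ω, 1 + n * (Real.exp (1 / n * ξ 1 ω) - 1) ≤ Real.exp (1 * ξ 1 ω) := fun ω => by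
      have h2 := one_add_mul_le_pow (a := Real.exp (1 / n * ξ 1 ω) - 1)
        (by have := Real.exp_pos (1 / n * ξ 1 ω); linarith) n
      rw [add_sub_cancel, ← Real.exp_nat_mul] at h2
      refine h2.trans_eq ?_
      congr 1
      field_simp
    have hi : Integrable (fun ω => Real.exp (1 / n * ξ 1 ω) - 1) P₀ :=
      (hξ.integrable_exp_one (by positivity)).sub (integrable_const _)
    have h3 := integral_mono ((integrable_const (1 : ℝ)).add (hi.const_mul (n : ℝ)))
      (hξ.integrable_exp_one zero_le_one) h1
    have h4 : ∫ ω, (1 + (n : ℝ) * (Real.exp (1 / n * ξ 1 ω) - 1)) ∂P₀ =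
        1 + n * (mgf (ξ 1) P₀ (1 / n) - 1) := by
      rw [integral_add (integrable_const _) (hi.const_mul _), integral_const_mul,
        integral_sub (hξ.integrable_exp_one (by positivity)) (integrable_const _)]
      simp [mgf]
    have h5 : ∫ ω, Real.exp (1 * ξ 1 ω) ∂P₀ = Real.exp C := by
      have := hmgf 1 zero_le_one
      simpa [mgf] using this
    simp only [Pi.add_apply] at h3
    rw [h4, h5, hmgf _ (by positivity)] at h3
    refine le_trans ?_ h3
    have h6 := Real.add_one_le_exp (C * (1 / (n : ℝ)) ^ α)
    have h7 : (n : ℝ) ^ (1 - α) = n * (1 / (n : ℝ)) ^ α := by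
      rw [Real.rpow_sub hn0, Real.rpow_one, Real.div_rpow zero_le_one hn0.le, Real.one_rpow]
      ring
    rw [h7]
    nlinarith
  have hlim : Tendsto (fun n : ℕ => 1 + C * (n : ℝ) ^ (1 - α)) atTop (𝓝 (1 + C * 0)) := by
    refine ((Tendsto.const_mul C ?_).const_add 1)
    have := (tendsto_rpow_neg_atTop (show 0 < α - 1 by linarith)).comp
      (tendsto_natCast_atTop_atTop (R := ℝ))
    simpa [Function.comp_def] using this
  have := le_of_tendsto hlim (by filter_upwards [eventually_gt_atTop 0] with n hn using hb n hn)
  rw [mul_zero, add_zero] at this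
  exact Real.one_le_exp_iff.1 this

/-- If the constant vanished, `E[(e^ξ - 1)²] = 1 - 2 + 1 = 0` would force `ξ 1 = 0` almost surely.
The real part of the exponent at `1` would then vanish, hence `∫ (1 - cos x) ν(dx) = 0`, although
the density of `ν` is positive on `(-1, 0)`. -/
lemma IsStrictlyStableProcess.laplaceConstant_ne_zero
    (hξ : IsStrictlyStableProcess α 0 cNeg η ξ P₀) (hα : 1 < α) (hc : 0 < cNeg) :
    laplaceConstant ξ P₀ ≠ 0 := by
  intro hC
  have hα0 : 0 < α := by linarith
  have hmgf : ∀ θ, 0 ≤ θ → ∫ ω, Real.exp (θ * ξ 1 ω) ∂P₀ = 1 := fun θ hθ => by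
    have := hξ.mgf_eq_exp hα0 1 hθ
    simpa [hC, mgf] using this
  have hzero : ∀ᵐ ω ∂P₀, ξ 1 ω = 0 := by
    have h1 : ∀ ω, (Real.exp (1 * ξ 1 ω) - 1) ^ 2 =
        Real.exp (2 * ξ 1 ω) - 2 * Real.exp (1 * ξ 1 ω) + 1 := fun ω => by
      rw [two_mul, Real.exp_add, one_mul]; ring
    have hi1 := hξ.integrable_exp_one (θ := 1) zero_le_one
    have hi2 := hξ.integrable_exp_one (θ := 2) zero_le_two
    have hi : Integrable (fun ω => (Real.exp (1 * ξ 1 ω) - 1) ^ 2) P₀ := by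
      simp_rw [h1]
      exact (hi2.sub (hi1.const_mul 2)).add (integrable_const _)
    have h2 : ∫ ω, (Real.exp (1 * ξ 1 ω) - 1) ^ 2 ∂P₀ = 0 := by
      simp_rw [h1]
      have hi3 : Integrable (fun ω => Real.exp (2 * ξ 1 ω) - 2 * Real.exp (1 * ξ 1 ω)) P₀ :=
        hi2.sub (hi1.const_mul 2)
      rw [integral_add hi3 (integrable_const _), integral_sub hi2 (hi1.const_mul 2),
        integral_const_mul, hmgf 2 zero_le_two,
        hmgf 1 zero_le_one]
      simp
      norm_num
    have h3 := (integral_eq_zero_iff_of_nonneg (fun ω => sq_nonneg _) hi).1 h2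
    filter_upwards [h3] with ω hω
    have h4 : Real.exp (1 * ξ 1 ω) - 1 = 0 := by simpa using hω
    have h5 : Real.exp (1 * ξ 1 ω) = 1 := by linarith
    rw [Real.exp_eq_one_iff] at h5
    linarith
  obtain ⟨b, σsq, ht, -⟩ := hξ.triplet
  set ν := stableLevyMeasure α 0 cNeg with hν
  have hchar : Complex.exp (-levyKhintchineExponent b σsq ν 1) = 1 := by
    have h1 := ht.charFun_eq 1 1
    rw [Measure.map_congr (g := fun _ => (0 : ℝ)) hzero, Measure.map_const, measure_univ, one_smul,
      charFun_dirac] at h1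
    simpa using h1.symm
  have hint := integrable_levyKhintchine_integrand ht.lintegral_lt_top 1
  have hre : ∀ x : ℝ, (1 - Complex.exp (Complex.I * (1 : ℝ) * x) +
      (if |x| < 1 then Complex.I * (1 : ℝ) * x else 0)).re = 1 - Real.cos x := fun x => by
    have h1 : Complex.I * ((1 : ℝ) : ℂ) * x = (x : ℂ) * Complex.I := by push_cast; ring
    rw [h1, Complex.exp_mul_I, ← Complex.ofReal_cos, ← Complex.ofReal_sin]
    split_ifs <;> simp [-Complex.ofReal_cos, -Complex.ofReal_sin]
  have hnorm : (levyKhintchineExponent b σsq ν 1).re = 0 := by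
    have h1 := congrArg norm hchar
    rw [Complex.norm_exp, norm_one, Real.exp_eq_one_iff] at h1
    simpa using h1
  have hint' : Integrable (fun x => 1 - Real.cos x) ν := by
    have := hint.re
    simpa only [RCLike.re_eq_complex_re, hre] using this
  have hIre : (∫ x : ℝ, (1 - Complex.exp (Complex.I * (1 : ℝ) * x) +
      (if |x| < 1 then Complex.I * (1 : ℝ) * x else 0)) ∂ν).re = ∫ x, (1 - Real.cos x) ∂ν := by
    have := integral_re hint
    simp only [RCLike.re_eq_complex_re, hre] at this
    exact this.symm
  have hnn : ∀ x : ℝ, 0 ≤ 1 - Real.cos x := fun x => sub_nonneg.2 (Real.cos_le_one x)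
  have hI0 : ∫ x, (1 - Real.cos x) ∂ν = 0 := by
    have h1 : (levyKhintchineExponent b σsq ν 1).re = σsq / 2 + ∫ x, (1 - Real.cos x) ∂ν := by
      rw [levyKhintchineExponent, Complex.add_re, hIre]
      congr 1
      simp
    have h2 : 0 ≤ ∫ x, (1 - Real.cos x) ∂ν := integral_nonneg hnn
    have h3 := σsq.coe_nonneg
    linarith
  have hae := (integral_eq_zero_iff_of_nonneg hnn hint').1 hI0
  rw [hν, stableLevyMeasure] at hae
  rw [Filter.EventuallyEq, ae_withDensity_iff (measurable_stableLevyDensity α 0 cNeg)] at hae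
  have hvol : volume (Set.Ioo (-1 : ℝ) 0) = 0 := by
    refine measure_mono_null (fun x hx => ?_) (ae_iff.1 hae)
    simp only [Set.mem_ofPred_eq, Classical.not_imp]
    refine ⟨?_, ?_⟩
    · rw [if_neg (not_lt.2 hx.2.le), if_pos hx.2]
      refine (ENNReal.ofReal_pos.2 (mul_pos hc (Real.rpow_pos_of_pos ?_ _))).ne'
      exact abs_pos.2 hx.2.ne
    · have h1 := Real.cos_lt_cos_of_nonneg_of_le_pi (x := 0) (y := -x) le_rfl
        (by have := Real.pi_gt_three; linarith [hx.1]) (by linarith [hx.2])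
      rw [Real.cos_neg, Real.cos_zero] at h1
      simp only [Pi.zero_apply]
      linarith
  rw [Real.volume_Ioo] at hvol
  simp at hvol

theorem IsStrictlyStableProcess.laplaceConstant_pos
    (hξ : IsStrictlyStableProcess α 0 cNeg η ξ P₀)
    (hα : (1 < α ∧ α < 2 ∧ 0 < cNeg) ∨ (α = 1 ∧ cNeg = 0 ∧ η < 0)) :
    0 < laplaceConstant ξ P₀ := by
  rcases hα with ⟨h1, -, h2⟩ | ⟨rfl, rfl, h2⟩
  · exact (hξ.laplaceConstant_nonneg h1).lt_of_ne' (hξ.laplaceConstant_ne_zero h1 h2)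
  · exact hξ.laplaceConstant_pos_of_one h2

end StableProcess

/-! ### Random walks killed at a memoryless time: first passages and maxima. -/

section RandomWalk

/-- The position after `k` steps of the random walk with increments `x`. -/
noncomputable def walk (k : ℕ) (x : ℕ → ℝ) : ℝ := ∑ i ∈ Finset.range k, x i

/-- The maximum of the positions of the random walk with increments `x` at the times before `k`. -/
noncomputable def walkMax : ℕ → (ℕ → ℝ) → ℝ
  | 0, _ => 0
  | k + 1, x => max (walkMax k x) (walk k x)

/-- The increments after time `k`. -/
def shiftSeq (k : ℕ) (x : ℕ → ℝ) : ℕ → ℝ := fun i => x (k + i)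

/-- The walk exceeds the level `a` for the first time at time `k`. -/
def firstPassage (a : ℝ) (k : ℕ) : Set (ℕ → ℝ) := {x | (∀ i < k, walk i x ≤ a) ∧ a < walk k x}

lemma walk_zero (x : ℕ → ℝ) : walk 0 x = 0 := by simp [walk]

lemma walk_succ (k : ℕ) (x : ℕ → ℝ) : walk (k + 1) x = walk k x + x k := by
  simp [walk, Finset.sum_range_succ]

lemma walk_add (k l : ℕ) (x : ℕ → ℝ) : walk (k + l) x = walk k x + walk l (shiftSeq k x) := by
  simp [walk, shiftSeq, Finset.sum_range_add]

lemma walkMax_nonneg (k : ℕ) (x : ℕ → ℝ) : 0 ≤ walkMax k x := by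
  induction k with
  | zero => exact le_rfl
  | succ k ih => exact le_max_of_le_left ih

lemma lt_walkMax_iff {a : ℝ} (ha : 0 ≤ a) (k : ℕ) (x : ℕ → ℝ) :
    a < walkMax k x ↔ ∃ i < k, a < walk i x := by
  induction k with
  | zero => simp [walkMax, ha]
  | succ k ih =>
    rw [walkMax, lt_max_iff, ih]
    constructor
    · rintro (⟨i, hi, h⟩ | h)
      · exact ⟨i, by omega, h⟩
      · exact ⟨k, by omega, h⟩
    · rintro ⟨i, hi, h⟩
      rcases Nat.lt_succ_iff_lt_or_eq.1 hi with h' | rfl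
      · exact Or.inl ⟨i, h', h⟩
      · exact Or.inr h

/-- A first passage over `a ≥ 0` sets a new record, so the past maximum is forgotten. The remaining
length is `l + 1` because only positions strictly before the final time count, and the passage time
must be among them. -/
lemma walkMax_add_of_firstPassage {a : ℝ} (ha : 0 ≤ a) {k : ℕ} {x : ℕ → ℝ}
    (hx : x ∈ firstPassage a k) (l : ℕ) :
    walkMax (k + (l + 1)) x = walk k x + walkMax (l + 1) (shiftSeq k x) := by
  induction l with
  | zero =>
    have h1 : walkMax k x ≤ a := by
      by_contra h
      obtain ⟨i, hi, h2⟩ := (lt_walkMax_iff ha k x).1 (not_le.1 h)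
      exact (hx.1 i hi).not_gt h2
    have h2 : walkMax 1 (shiftSeq k x) = 0 := by simp [walkMax, walk_zero]
    rw [h2, add_zero]
    exact max_eq_right (h1.trans hx.2.le)
  | succ l ih =>
    rw [← add_assoc, walkMax, ih, walk_add, max_add_add_left]
    rfl

lemma measurable_walk (k : ℕ) : Measurable (walk k) := by
  unfold walk
  fun_prop

lemma measurable_walkMax (k : ℕ) : Measurable (walkMax k) := by
  induction k with
  | zero => exact measurable_const
  | succ k ih => exact ih.max (measurable_walk k)

lemma measurable_shiftSeq (k : ℕ) : Measurable (shiftSeq k) :=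
  measurable_pi_lambda _ fun i => measurable_pi_apply (k + i)

lemma measurableSet_firstPassage (a : ℝ) (k : ℕ) : MeasurableSet (firstPassage a k) := by
  have : firstPassage a k = (⋂ i ∈ Finset.range k, {x | walk i x ≤ a}) ∩ {x | a < walk k x} := by
    ext x; simp [firstPassage]
  rw [this]
  refine MeasurableSet.inter (Finset.measurableSet_biInter _ fun i _ => ?_) ?_
  · exact measurableSet_le (measurable_walk i) measurable_const
  · exact measurableSet_lt measurable_const (measurable_walk k)

lemma existsUnique_firstPassage {a : ℝ} {k : ℕ} {x : ℕ → ℝ} (h : a < walk k x) :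
    ∃ j ≤ k, x ∈ firstPassage a j := by
  classical
  have hex : ∃ j, a < walk j x := ⟨k, h⟩
  exact ⟨Nat.find hex, Nat.find_min' hex h, fun i hi => not_lt.1 (Nat.find_min hex hi),
    Nat.find_spec hex⟩

lemma firstPassage_unique {a : ℝ} {j k : ℕ} {x : ℕ → ℝ} (hj : x ∈ firstPassage a j)
    (hk : x ∈ firstPassage a k) : j = k := by
  rcases lt_trichotomy j k with h | h | h
  · exact absurd hj.2 (hk.1 j h).not_gt
  · exact h
  · exact absurd hk.2 (hj.1 k h).not_gt

variable (μ : Measure ℝ) [IsProbabilityMeasure μ]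

/-- The law of the increments of a random walk with step law `μ`. -/
noncomputable def stepLaw : Measure (ℕ → ℝ) := Measure.infinitePi fun _ => μ

instance : IsProbabilityMeasure (stepLaw μ) := by unfold stepLaw; infer_instance

lemma iIndepFun_stepLaw : iIndepFun (fun i (x : ℕ → ℝ) => x i) (stepLaw μ) := by
  have := iIndepFun_infinitePi (P := fun _ : ℕ => μ) (X := fun _ => (id : ℝ → ℝ))
    (fun _ => measurable_id)
  exact this

lemma map_shiftSeq_stepLaw (k : ℕ) : (stepLaw μ).map (shiftSeq k) = stepLaw μ := by
  have h1 : iIndepFun (fun i (x : ℕ → ℝ) => x (k + i)) (stepLaw μ) :=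
    (iIndepFun_stepLaw μ).precomp (g := fun i => k + i) (add_right_injective k)
  have h2 := h1.map_fun_eq_infinitePi_map (fun i => measurable_pi_apply _)
  have h3 : ∀ i : ℕ, (stepLaw μ).map (fun x => x (k + i)) = μ := fun i =>
    Measure.infinitePi_map_eval (fun _ => μ) (k + i)
  simp_rw [h3] at h2
  exact h2

lemma indepFun_shiftSeq (k : ℕ) :
    IndepFun (fun (x : ℕ → ℝ) (i : Finset.range k) => x i) (shiftSeq k) (stepLaw μ) := by
  refine IndepFun.indepFun_process (by fun_prop) (fun i => measurable_pi_apply (k + i)) fun J => ?_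
  have h := (iIndepFun_stepLaw μ).indepFun_finset (Finset.range k)
    (J.map (addLeftEmbedding k)) ?_ (fun i => by fun_prop)
  · have h2 := h.comp (φ := id) (ψ := fun (y : J.map (addLeftEmbedding k) → ℝ) (j : J) =>
      y ⟨k + j, Finset.mem_map.2 ⟨j, j.2, rfl⟩⟩) measurable_id (by fun_prop)
    exact h2
  · rw [Finset.disjoint_left]
    intro i hi hi'
    obtain ⟨j, -, rfl⟩ := Finset.mem_map.1 hi'
    simp at hi

/-- First passage at `k` is determined by the first `k` increments, which are independent of the
later ones. Summation over `k` then gives the strong Markov property. -/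
lemma lintegral_firstPassage_mul (a : ℝ) (k : ℕ) {g : (ℕ → ℝ) → ℝ≥0∞} (hg : Measurable g) :
    ∫⁻ x, (firstPassage a k).indicator 1 x * g (shiftSeq k x) ∂(stepLaw μ) =
      stepLaw μ (firstPassage a k) * ∫⁻ x, g x ∂(stepLaw μ) := by
  let w : (i : ℕ) → i ≤ k → (Finset.range k → ℝ) → ℝ := fun i hi y =>
    ∑ j : Fin i, y ⟨j, Finset.mem_range.2 (j.2.trans_le hi)⟩
  have hw : ∀ i (hi : i ≤ k) (x : ℕ → ℝ), w i hi (fun j : Finset.range k => x j) = walk i x :=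
    fun i hi x => by rw [walk, Finset.sum_range]
  have hwm : ∀ i hi, Measurable (w i hi) := fun i hi => by fun_prop
  let B : Set (Finset.range k → ℝ) :=
    {y | (∀ i : Fin k, w i i.2.le y ≤ a) ∧ a < w k le_rfl y}
  have hB : MeasurableSet B := by
    have : B = (⋂ i : Fin k, {y | w i i.2.le y ≤ a}) ∩ {y | a < w k le_rfl y} := by
      ext y; simp [B]
    rw [this]
    exact (MeasurableSet.iInter fun i : Fin k =>
      measurableSet_le (hwm i i.2.le) measurable_const).inter
      (measurableSet_lt measurable_const (hwm k le_rfl))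
  have hBi : ∀ x : ℕ → ℝ, (firstPassage a k).indicator (1 : (ℕ → ℝ) → ℝ≥0∞) x =
      B.indicator 1 (fun j : Finset.range k => x j) := fun x => by
    have : x ∈ firstPassage a k ↔ (fun j : Finset.range k => x j) ∈ B := by
      simp only [firstPassage, B, Set.mem_ofPred_eq, hw]
      exact and_congr_left fun _ => ⟨fun h i => h i i.2, fun h i hi => h ⟨i, hi⟩⟩
    by_cases h : x ∈ firstPassage a k
    · rw [Set.indicator_of_mem h, Set.indicator_of_mem (this.1 h)]; rfl
    · rw [Set.indicator_of_notMem h, Set.indicator_of_notMem (mt this.2 h)]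
  have hind := (indepFun_shiftSeq μ k).comp
    (φ := B.indicator (1 : (Finset.range k → ℝ) → ℝ≥0∞)) (ψ := g)
    (measurable_one.indicator hB) hg
  have h1 := lintegral_mul_eq_lintegral_mul_lintegral_of_indepFun
    ((measurable_one.indicator hB).comp (by fun_prop)) (hg.comp (measurable_shiftSeq k)) hind
  simp only [Pi.mul_apply, Function.comp_apply] at h1
  simp_rw [← hBi] at h1
  rw [h1, lintegral_indicator_one (measurableSet_firstPassage a k)]
  congr 1
  conv_rhs => rw [← map_shiftSeq_stepLaw μ k]
  rw [lintegral_map hg (measurable_shiftSeq k)]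

/-- The memoryless property of a law on `ℕ`. -/
def IsMemoryless (τ : Measure ℕ) (r : ℝ≥0∞) : Prop :=
  ∀ (k : ℕ) (g : ℕ → ℝ≥0∞), ∫⁻ n, (if k < n then g (n - k) else 0) ∂τ = r ^ k * ∫⁻ n, g n ∂τ

variable {τ : Measure ℕ} {r : ℝ≥0∞}

/-- The strong Markov property at the first passage over `a` of a walk killed at an independent
memoryless time. -/
lemma lintegral_tsum_firstPassage (hτ : IsMemoryless τ r) (a : ℝ)
    {g : ℕ → (ℕ → ℝ) → ℝ≥0∞} (hg : ∀ n, Measurable (g n)) :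
    ∫⁻ n, ∫⁻ x, ∑' k, (if k < n then (firstPassage a k).indicator 1 x * g (n - k) (shiftSeq k x)
      else 0) ∂(stepLaw μ) ∂τ =
    (∑' k, r ^ k * stepLaw μ (firstPassage a k)) * ∫⁻ n, ∫⁻ x, g n x ∂(stepLaw μ) ∂τ := by
  have hmeas : ∀ k n, Measurable fun x => if k < n then
      (firstPassage a k).indicator (1 : (ℕ → ℝ) → ℝ≥0∞) x * g (n - k) (shiftSeq k x) else 0 :=
    fun k n => by
      split_ifs
      · exact (measurable_one.indicator (measurableSet_firstPassage a k)).mul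
          ((hg _).comp (measurable_shiftSeq k))
      · exact measurable_const
  have h1 : ∀ n, ∫⁻ x, ∑' k, (if k < n then (firstPassage a k).indicator 1 x *
      g (n - k) (shiftSeq k x) else 0) ∂(stepLaw μ) =
      ∑' k, stepLaw μ (firstPassage a k) * (if k < n then ∫⁻ x, g (n - k) x ∂(stepLaw μ) else 0) :=
    fun n => by
      rw [lintegral_tsum fun k => (hmeas k n).aemeasurable]
      refine tsum_congr fun k => ?_
      split_ifs with h
      · exact lintegral_firstPassage_mul μ a k (hg _)
      · simp
  simp_rw [h1]
  rw [lintegral_tsum fun k => Measurable.aemeasurable (measurable_of_countable _),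
    ← ENNReal.tsum_mul_right]
  refine tsum_congr fun k => ?_
  rw [lintegral_const_mul _ (measurable_of_countable _),
    hτ k (fun n => ∫⁻ x, g n x ∂(stepLaw μ))]
  ring

/-- At most one term survives, the one at the first passage time; such a time below `n` exists
precisely when the maximum exceeds `a`. -/
lemma tsum_firstPassage_eq {a : ℝ} (ha : 0 ≤ a) (n : ℕ) (x : ℕ → ℝ)
    (g : ℕ → (ℕ → ℝ) → ℝ≥0∞) {c : ℝ≥0∞}
    (hc : ∀ k < n, x ∈ firstPassage a k → g (n - k) (shiftSeq k x) = c) :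
    ∑' k, (if k < n then (firstPassage a k).indicator 1 x * g (n - k) (shiftSeq k x) else 0) =
      if a < walkMax n x then c else 0 := by
  split_ifs with h
  · obtain ⟨i, hi, h2⟩ := (lt_walkMax_iff ha n x).1 h
    obtain ⟨j, hj, h3⟩ := existsUnique_firstPassage h2
    rw [tsum_eq_single j]
    · rw [if_pos (hj.trans_lt hi), Set.indicator_of_mem h3, hc j (hj.trans_lt hi) h3]
      simp
    · intro k hk
      rw [Set.indicator_of_notMem fun h4 => hk (firstPassage_unique h4 h3), zero_mul, ite_self]
  · refine ENNReal.tsum_eq_zero.2 fun k => ?_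
    split_ifs with hk
    · rw [Set.indicator_of_notMem, zero_mul]
      exact fun h2 => h ((lt_walkMax_iff ha n x).2 ⟨k, hk, h2.2⟩)
    · rfl

/-- The probability that the killed walk exceeds `a`. -/
noncomputable def walkTail (μ : Measure ℝ) [IsProbabilityMeasure μ] (τ : Measure ℕ) (a : ℝ) :
    ℝ≥0∞ := ∫⁻ n, ∫⁻ x, (if a < walkMax n x then 1 else 0) ∂(stepLaw μ) ∂τ

lemma tsum_firstPassage_eq_walkTail [IsProbabilityMeasure τ] (hτ : IsMemoryless τ r) {a : ℝ}
    (ha : 0 ≤ a) :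
    ∑' k, r ^ k * stepLaw μ (firstPassage a k) = walkTail μ τ a := by
  have h := lintegral_tsum_firstPassage μ hτ a (g := fun _ _ => 1) fun n => measurable_const
  simp only [lintegral_one, measure_univ, mul_one] at h
  rw [← h, walkTail]
  refine lintegral_congr fun n => lintegral_congr fun x => ?_
  have := tsum_firstPassage_eq ha n x (g := fun _ _ => 1) (c := 1) fun _ _ _ => rfl
  simpa only [mul_one] using this

/-- The maximum of a killed walk is independent of the distance to it at the killing time. -/
theorem lintegral_walkMax_sub_walk [IsProbabilityMeasure τ] (hτ : IsMemoryless τ r) {a : ℝ}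
    (ha : 0 ≤ a) {ψ : ℝ → ℝ≥0∞}
    (hψ : Measurable ψ) :
    ∫⁻ n, ∫⁻ x, (if a < walkMax n x then ψ (walkMax n x - walk n x) else 0) ∂(stepLaw μ) ∂τ =
      walkTail μ τ a * ∫⁻ n, ∫⁻ x, ψ (walkMax n x - walk n x) ∂(stepLaw μ) ∂τ := by
  rw [← tsum_firstPassage_eq_walkTail μ hτ ha, ← lintegral_tsum_firstPassage μ hτ a
    (g := fun n x => ψ (walkMax n x - walk n x))
    fun n => hψ.comp ((measurable_walkMax n).sub (measurable_walk n))]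
  refine lintegral_congr fun n => lintegral_congr fun x => ?_
  -- Restarting at the first passage moves the maximum and the endpoint by the same amount, so their
  -- difference is unchanged.
  refine (tsum_firstPassage_eq ha n x (g := fun n x => ψ (walkMax n x - walk n x))
    (c := ψ (walkMax n x - walk n x)) fun k hk hx => ?_).symm
  obtain ⟨l, rfl⟩ := Nat.exists_eq_add_of_lt hk
  have h1 : k + l + 1 - k = l + 1 := by omega
  simp only [h1]
  rw [add_assoc k l 1, walkMax_add_of_firstPassage ha hx, walk_add k (l + 1) x]
  congr 1
  ring

lemma measurable_lt_walkMax (b : ℝ) (n : ℕ) :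
    Measurable fun x => if b < walkMax n x then (1 : ℝ≥0∞) else 0 :=
  Measurable.ite (measurableSet_lt measurable_const (measurable_walkMax n)) measurable_const
    measurable_const

lemma walkTail_mul_walkTail [IsProbabilityMeasure τ] (hτ : IsMemoryless τ r) {a : ℝ}
    (ha : 0 ≤ a) (b : ℝ) :
    walkTail μ τ a * walkTail μ τ b =
      ∫⁻ n, ∫⁻ x, ∑' k, (if k < n then (firstPassage a k).indicator 1 x *
        (if b < walkMax (n - k) (shiftSeq k x) then 1 else 0) else 0) ∂(stepLaw μ) ∂τ := by
  rw [lintegral_tsum_firstPassage μ hτ a (measurable_lt_walkMax b),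
    tsum_firstPassage_eq_walkTail μ hτ ha]
  rfl

/-- Passing `a` and then climbing by more than `b` leads above `a + b`; the overshoot over `a` only
helps in this direction. -/
lemma walkTail_mul_le [IsProbabilityMeasure τ] (hτ : IsMemoryless τ r) {a : ℝ} (ha : 0 ≤ a)
    (b : ℝ) : walkTail μ τ a * walkTail μ τ b ≤ walkTail μ τ (a + b) := by
  rw [walkTail_mul_walkTail μ hτ ha]
  refine lintegral_mono fun n => lintegral_mono fun x => ?_
  have hle : ∀ k, (if k < n then (firstPassage a k).indicator 1 x *
      (if b < walkMax (n - k) (shiftSeq k x) then (1 : ℝ≥0∞) else 0) else 0) ≤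
      if k < n then (firstPassage a k).indicator 1 x * (if a + b < walkMax n x then 1 else 0)
        else 0 := fun k => by
    split_ifs with h1 h2 h3 h3
    · exact le_rfl
    · by_cases hx : x ∈ firstPassage a k
      · refine absurd ?_ h3
        obtain ⟨l, rfl⟩ := Nat.exists_eq_add_of_lt h1
        have h4 : k + l + 1 - k = l + 1 := by omega
        rw [h4] at h2
        rw [add_assoc k l 1, walkMax_add_of_firstPassage ha hx]
        have := hx.2
        linarith
      · simp [Set.indicator_of_notMem hx]
    · simp
    · simp
    · exact le_rfl
  refine (ENNReal.tsum_le_tsum hle).trans ?_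
  rw [tsum_firstPassage_eq ha n x (g := fun _ _ => if a + b < walkMax n x then 1 else 0)
    fun _ _ _ => rfl]
  split_ifs <;> simp

/-- A killed walk with small upward steps has little overshoot. -/
lemma walkTail_add_le [IsProbabilityMeasure τ] (hτ : IsMemoryless τ r) {a b ε : ℝ} (ha : 0 ≤ a)
    (hb : 0 ≤ b) (hε : 0 ≤ ε) :
    walkTail μ τ (a + b + ε) ≤
      walkTail μ τ a * walkTail μ τ b + μ (Set.Ioi ε) * (1 - r)⁻¹ := by
  -- The expected number of steps larger than `ε` before killing: step `i` is made with probability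
  -- `r^i`.
  have hjump : ∫⁻ n, ∫⁻ x, ∑' i : ℕ, (if i < n then (Set.Ioi ε).indicator 1 (x i) else 0)
      ∂(stepLaw μ) ∂τ = μ (Set.Ioi ε) * (1 - r)⁻¹ := by
    have hm : ∀ i n : ℕ, Measurable fun x : ℕ → ℝ =>
        if i < n then (Set.Ioi ε).indicator (1 : ℝ → ℝ≥0∞) (x i) else 0 := fun i n => by
      split_ifs
      · exact (measurable_one.indicator measurableSet_Ioi).comp (measurable_pi_apply i)
      · exact measurable_const
    have h1 : ∀ n : ℕ, ∫⁻ x, ∑' i : ℕ, (if i < n then (Set.Ioi ε).indicator 1 (x i) else 0)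
        ∂(stepLaw μ) = ∑' i : ℕ, if i < n then μ (Set.Ioi ε) else 0 := fun n => by
      rw [lintegral_tsum fun i => (hm i n).aemeasurable]
      refine tsum_congr fun i => ?_
      split_ifs
      · have h2 : (stepLaw μ).map (fun x => x i) = μ :=
          Measure.infinitePi_map_eval (fun _ => μ) i
        have h3 := lintegral_map (μ := stepLaw μ) (f := (Set.Ioi ε).indicator (1 : ℝ → ℝ≥0∞))
          (measurable_one.indicator measurableSet_Ioi) (measurable_pi_apply i)
        rw [← h3]
        change ∫⁻ y, _ ∂((stepLaw μ).map (fun x => x i)) = _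
        rw [h2, lintegral_indicator_one measurableSet_Ioi]
      · simp
    simp_rw [h1]
    rw [lintegral_tsum fun i => Measurable.aemeasurable (measurable_of_countable _)]
    simp_rw [hτ _ (fun _ => μ (Set.Ioi ε)), lintegral_const, measure_univ, mul_one]
    rw [ENNReal.tsum_mul_right, ENNReal.tsum_geometric, mul_comm]
  have hm2 : ∀ n, Measurable fun x : ℕ → ℝ => ∑' k, (if k < n then
      (firstPassage a k).indicator (1 : (ℕ → ℝ) → ℝ≥0∞) x *
        (if b < walkMax (n - k) (shiftSeq k x) then 1 else 0) else 0) := fun n => by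
    refine Measurable.tsum fun k => ?_
    split_ifs
    · exact (measurable_one.indicator (measurableSet_firstPassage a k)).mul
        ((measurable_lt_walkMax b _).comp (measurable_shiftSeq k))
    · exact measurable_const
  rw [← hjump, walkTail_mul_walkTail μ hτ ha, ← lintegral_add_left (measurable_of_countable _)]
  refine lintegral_mono fun n => ?_
  simp only
  rw [← lintegral_add_left (hm2 n)]
  refine lintegral_mono fun x => ?_
  split_ifs with h
  · obtain ⟨i, hi, h2⟩ := (lt_walkMax_iff (by positivity) n x).1 h
    obtain ⟨k, hk, h3⟩ := existsUnique_firstPassage (show a < walk i x by linarith)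
    have hkn := hk.trans_lt hi
    obtain ⟨l, rfl⟩ := Nat.exists_eq_add_of_lt hkn
    -- Either the overshoot over `a` is at most `ε`, so that the restarted walk still has to climb
    -- by more than `b`, or the step that crossed `a` was larger than `ε`.
    by_cases hstep : walk k x ≤ a + ε
    · refine le_add_right ?_
      refine le_trans ?_ (ENNReal.le_tsum k)
      have h4 : k + l + 1 - k = l + 1 := by omega
      rw [add_assoc k l 1, walkMax_add_of_firstPassage ha h3] at h
      rw [if_pos hkn, Set.indicator_of_mem h3, h4, if_pos (by linarith)]
      simp
    · refine le_add_left ?_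
      rcases k with _ | k
      · rw [walk_zero] at hstep; exact absurd (by positivity) hstep
      · refine le_trans ?_ (ENNReal.le_tsum k)
        have h5 := h3.1 k (Nat.lt_succ_self k)
        rw [walk_succ] at hstep
        rw [if_pos (by omega), Set.indicator_of_mem (by
          change ε < x k
          linarith)]
        rfl
  · exact zero_le

end RandomWalk

/-! ### The exponential lifetime and its discretization. -/

section ExponentialLaw

lemma measurable_exponentialPDF (r : ℝ) : Measurable (exponentialPDF r) :=
  (measurable_exponentialPDFReal r).ennreal_ofReal

lemma lintegral_expMeasure (r : ℝ) (f : ℝ → ℝ≥0∞) (hf : Measurable f) :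
    ∫⁻ x, f x ∂(expMeasure r) = ∫⁻ x, exponentialPDF r x * f x := by
  change ∫⁻ x, f x ∂(volume.withDensity (exponentialPDF r)) = _
  rw [lintegral_withDensity_eq_lintegral_mul _
    (measurable_exponentialPDF r) hf]
  rfl

lemma lintegral_exp_mul_expMeasure_of_lt {r c : ℝ} (hr : 0 < r) (hc : c < r) :
    ∫⁻ x, ENNReal.ofReal (Real.exp (c * x)) ∂(expMeasure r) = ENNReal.ofReal (r / (r - c)) := by
  have hrc : 0 < r - c := by linarith
  rw [lintegral_expMeasure _ _ (by fun_prop)]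
  have h : ∀ x, exponentialPDF r x * ENNReal.ofReal (Real.exp (c * x)) =
      ENNReal.ofReal (r / (r - c)) * exponentialPDF (r - c) x := fun x => by
    rcases lt_or_ge x 0 with hx | hx
    · rw [exponentialPDF_of_neg hx, exponentialPDF_of_neg hx, zero_mul, mul_zero]
    · rw [exponentialPDF_of_nonneg hx, exponentialPDF_of_nonneg hx,
        ← ENNReal.ofReal_mul (by positivity), ← ENNReal.ofReal_mul (by positivity), mul_assoc,
        ← Real.exp_add]
      congr 1
      rw [show -(r * x) + c * x = -((r - c) * x) by ring]
      field_simp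
  simp_rw [h]
  rw [lintegral_const_mul _ (measurable_exponentialPDF _),
    lintegral_exponentialPDF_eq_one hrc, mul_one]

/-- Together with the finite case this makes the rate of an exponential law visible as the abscissa
of its exponential moments; the rate of the supremum is identified in this way. -/
lemma lintegral_exp_mul_expMeasure_of_ge {r c : ℝ} (hr : 0 < r) (hc : r ≤ c) :
    ∫⁻ x, ENNReal.ofReal (Real.exp (c * x)) ∂(expMeasure r) = ∞ := by
  rw [lintegral_expMeasure _ _ (by fun_prop), eq_top_iff]
  calc ∞ = ∫⁻ x in Set.Ici (0 : ℝ), ENNReal.ofReal r := by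
        rw [setLIntegral_const, Real.volume_Ici, ENNReal.mul_top (ENNReal.ofReal_pos.2 hr).ne']
    _ ≤ ∫⁻ x in Set.Ici (0 : ℝ), exponentialPDF r x * ENNReal.ofReal (Real.exp (c * x)) := by
        refine setLIntegral_mono' measurableSet_Ici fun x (hx : 0 ≤ x) => ?_
        rw [exponentialPDF_of_nonneg hx, ← ENNReal.ofReal_mul (by positivity), mul_assoc,
          ← Real.exp_add]
        refine ENNReal.ofReal_le_ofReal (le_mul_of_one_le_right hr.le (Real.one_le_exp ?_))
        nlinarith
    _ ≤ _ := setLIntegral_le_lintegral _ _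

lemma ae_pos_expMeasure {r : ℝ} : ∀ᵐ x ∂(expMeasure r), 0 < x := by
  change ∀ᵐ x ∂(volume.withDensity (exponentialPDF r)), 0 < x
  rw [ae_withDensity_iff (measurable_exponentialPDF r)]
  filter_upwards [Measure.ae_ne volume (0 : ℝ)] with x hx h
  by_contra h0
  exact h (exponentialPDF_of_neg (lt_of_le_of_ne (not_lt.1 h0) hx))

/-- The law of the lifetime of a particle. -/
noncomputable def lifeLaw : Measure ℝ≥0 := (expMeasure 1).map Real.toNNReal

instance : IsProbabilityMeasure lifeLaw :=
  have := isProbabilityMeasure_expMeasure one_pos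
  Measure.isProbabilityMeasure_map (by fun_prop)

lemma lintegral_lifeLaw {f : ℝ≥0 → ℝ≥0∞} (hf : Measurable f) :
    ∫⁻ t, f t ∂lifeLaw = ∫⁻ x, f (Real.toNNReal x) ∂(expMeasure 1) :=
  lintegral_map hf (by fun_prop)

lemma ae_pos_lifeLaw : ∀ᵐ t ∂lifeLaw, 0 < t := by
  rw [lifeLaw, ae_map_iff (by fun_prop) measurableSet_Ioi]
  filter_upwards [ae_pos_expMeasure] with x hx
  exact Real.toNNReal_pos.2 hx

lemma lintegral_exp_mul_lifeLaw (c : ℝ) :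
    ∫⁻ t : ℝ≥0, ENNReal.ofReal (Real.exp (c * t)) ∂lifeLaw =
      ∫⁻ x, ENNReal.ofReal (Real.exp (c * x)) ∂(expMeasure 1) := by
  rw [lintegral_lifeLaw (by fun_prop)]
  refine lintegral_congr_ae ?_
  filter_upwards [ae_pos_expMeasure] with x hx
  rw [Real.coe_toNNReal _ hx.le]

lemma lintegral_lifeLaw_shift (t : ℝ≥0) {g : ℝ≥0 → ℝ≥0∞} (hg : Measurable g) :
    ∫⁻ s, (if t < s then g (s - t) else 0) ∂lifeLaw =
      ENNReal.ofReal (Real.exp (-t)) * ∫⁻ s, g s ∂lifeLaw := by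
  have hm : Measurable fun s => if t < s then g (s - t) else 0 :=
    Measurable.ite measurableSet_Ioi (hg.comp (by fun_prop)) measurable_const
  have hpdf := measurable_exponentialPDF 1
  have hg' : Measurable fun x => g (Real.toNNReal x) := hg.comp measurable_real_toNNReal
  have hm' : Measurable fun x => if t < Real.toNNReal x then g (Real.toNNReal x - t) else 0 :=
    hm.comp measurable_real_toNNReal
  rw [lintegral_lifeLaw hm, lintegral_lifeLaw hg,
    lintegral_expMeasure _ _ hm', lintegral_expMeasure _ _ hg',
    ← lintegral_const_mul _ (by fun_prop),
    ← lintegral_add_right_eq_self _ (t : ℝ)]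
  refine lintegral_congr_ae ?_
  filter_upwards [Measure.ae_ne volume (0 : ℝ)] with x hx
  rcases hx.lt_or_gt with hx | hx
  · have h1 : ¬ t < Real.toNNReal (x + t) := by
      rw [not_lt, Real.toNNReal_le_iff_le_coe]; linarith
    rw [if_neg h1, exponentialPDF_of_neg hx]
    simp
  · have ht := t.coe_nonneg
    have h1 : Real.toNNReal (x + t) = Real.toNNReal x + t := by
      rw [Real.toNNReal_add hx.le ht, Real.toNNReal_coe]
    have h2 : t < Real.toNNReal x + t := lt_add_of_pos_left _ (Real.toNNReal_pos.2 hx)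
    rw [h1, if_pos h2, add_tsub_cancel_right, exponentialPDF_of_nonneg hx.le,
      exponentialPDF_of_nonneg (by linarith), ← mul_assoc, ← ENNReal.ofReal_mul (by positivity)]
    congr 2
    rw [show -(1 * (x + (t : ℝ))) = -t + -(1 * x) by ring, Real.exp_add]
    ring

/-- The number of points of the dyadic grid of mesh `2⁻ⁿ` in `[0, t)`. -/
noncomputable def dyadicSteps (n : ℕ) (t : ℝ≥0) : ℕ := ⌈t * 2 ^ n⌉₊

lemma measurable_dyadicSteps (n : ℕ) : Measurable (dyadicSteps n) :=
  Nat.measurable_ceil.comp (by fun_prop)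

lemma lt_dyadicSteps_iff {n k : ℕ} {t : ℝ≥0} : k < dyadicSteps n t ↔ (k : ℝ≥0) / 2 ^ n < t := by
  rw [dyadicSteps, Nat.lt_ceil, div_lt_iff₀ (by positivity)]

lemma dyadicSteps_sub (n k : ℕ) (t : ℝ≥0) :
    dyadicSteps n (t - k / 2 ^ n) = dyadicSteps n t - k := by
  rw [dyadicSteps, dyadicSteps, tsub_mul, div_mul_cancel₀ _ (by positivity), Nat.ceil_sub_natCast]

/-- Ceilings commute with subtraction of integers, so lack of memory of the lifetime at grid times
passes to the number of steps. -/
lemma isMemoryless_dyadicSteps (n : ℕ) : IsMemoryless (lifeLaw.map (dyadicSteps n))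
    (ENNReal.ofReal (Real.exp (-(1 / 2 ^ n)))) := by
  intro k g
  have hg : Measurable g := measurable_of_countable g
  rw [lintegral_map (measurable_of_countable _) (measurable_dyadicSteps n),
    lintegral_map hg (measurable_dyadicSteps n)]
  have h := lintegral_lifeLaw_shift (k / 2 ^ n) (hg.comp (measurable_dyadicSteps n))
  simp only [Function.comp_apply, dyadicSteps_sub] at h
  simp only [lt_dyadicSteps_iff]
  rw [h, ← ENNReal.ofReal_pow (Real.exp_pos _).le, ← Real.exp_nat_mul]
  congr 3
  push_cast
  ring

instance (n : ℕ) : IsProbabilityMeasure (lifeLaw.map (dyadicSteps n)) :=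
  Measure.isProbabilityMeasure_map (measurable_dyadicSteps n).aemeasurable

end ExponentialLaw

/-! ### Suprema and endpoints of càdlàg paths through dyadic grids. -/

section PathFunctionals

/-- The increments of a path along the dyadic grid of mesh `2⁻ⁿ`. -/
noncomputable def dyadicIncr (n : ℕ) (f : ℝ≥0 → ℝ) : ℕ → ℝ :=
  fun i => f ((i + 1 : ℕ) / 2 ^ n) - f (i / 2 ^ n)

/-- The maximum of a path on the dyadic grid of mesh `2⁻ⁿ` before time `t`. -/
noncomputable def dyadicMax (n : ℕ) (f : ℝ≥0 → ℝ) (t : ℝ≥0) : ℝ :=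
  walkMax (dyadicSteps n t) (dyadicIncr n f)

/-- The supremum over `[0, t)` of a path started from `0`, through its values on dyadic grids. -/
noncomputable def pathSup (f : ℝ≥0 → ℝ) (t : ℝ≥0) : ℝ := ⨆ n, dyadicMax n f t

/-- The first point of the dyadic grid of mesh `2⁻ⁿ` after `t`. -/
noncomputable def dyadicCeil (n : ℕ) (t : ℝ≥0) : ℝ≥0 := dyadicSteps n t / 2 ^ n

/-- The value at `t` of a right-continuous path, through its values on dyadic grids. -/
noncomputable def pathEnd (f : ℝ≥0 → ℝ) (t : ℝ≥0) : ℝ :=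
  limsup (fun n => f (dyadicCeil n t)) atTop

lemma walk_dyadicIncr (n k : ℕ) (f : ℝ≥0 → ℝ) :
    walk k (dyadicIncr n f) = f (k / 2 ^ n) - f 0 := by
  rw [walk]
  simp only [dyadicIncr]
  rw [Finset.sum_range_sub (fun i : ℕ => f (i / 2 ^ n))]
  simp

lemma lt_dyadicMax_iff {n : ℕ} {f : ℝ≥0 → ℝ} (hf : f 0 = 0) {t : ℝ≥0} {a : ℝ} (ha : 0 ≤ a) :
    a < dyadicMax n f t ↔ ∃ k : ℕ, (k : ℝ≥0) / 2 ^ n < t ∧ a < f (k / 2 ^ n) := by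
  simp only [dyadicMax, lt_walkMax_iff ha, lt_dyadicSteps_iff, walk_dyadicIncr, hf, sub_zero]

lemma dyadicMax_nonneg (n : ℕ) (f : ℝ≥0 → ℝ) (t : ℝ≥0) : 0 ≤ dyadicMax n f t :=
  walkMax_nonneg _ _

lemma dyadicMax_mono {f : ℝ≥0 → ℝ} (hf : f 0 = 0) (t : ℝ≥0) :
    Monotone fun n => dyadicMax n f t := by
  refine monotone_nat_of_le_succ fun n => ?_
  by_contra h
  obtain ⟨k, hk, h2⟩ := (lt_dyadicMax_iff hf (dyadicMax_nonneg _ _ _)).1 (not_le.1 h)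
  have h3 : ((2 * k : ℕ) : ℝ≥0) / 2 ^ (n + 1) = k / 2 ^ n := by
    push_cast
    rw [pow_succ]
    field_simp
  exact lt_irrefl _ ((lt_dyadicMax_iff hf (dyadicMax_nonneg (n + 1) f t)).2
    ⟨2 * k, by rwa [h3], by rwa [h3]⟩)

lemma le_dyadicCeil (n : ℕ) (t : ℝ≥0) : t ≤ dyadicCeil n t := by
  rw [dyadicCeil, le_div_iff₀ (by positivity)]
  exact Nat.le_ceil _

lemma dyadicCeil_lt (n : ℕ) (t : ℝ≥0) : dyadicCeil n t < t + 1 / 2 ^ n := by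
  rw [dyadicCeil, div_lt_iff₀ (by positivity), add_mul, one_div_mul_cancel (by positivity)]
  exact Nat.ceil_lt_add_one zero_le

lemma tendsto_one_div_two_pow_nnreal : Tendsto (fun n : ℕ => (1 : ℝ≥0) / 2 ^ n) atTop (𝓝 0) := by
  have := NNReal.tendsto_pow_atTop_nhds_zero_of_lt_one (r := 1 / 2) (by
    rw [← NNReal.coe_lt_coe]; norm_num)
  simpa using this

lemma tendsto_dyadicCeil (t : ℝ≥0) :
    Tendsto (fun n => dyadicCeil n t) atTop (𝓝[Set.Ici t] t) := by
  refine tendsto_nhdsWithin_iff.2 ⟨?_, Eventually.of_forall fun n => le_dyadicCeil n t⟩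
  have h : Tendsto (fun n : ℕ => t + 1 / 2 ^ n) atTop (𝓝 t) := by
    simpa using tendsto_one_div_two_pow_nnreal.const_add t
  exact tendsto_of_tendsto_of_tendsto_of_le_of_le tendsto_const_nhds h
    (fun n => le_dyadicCeil n t) fun n => (dyadicCeil_lt n t).le

lemma IsCadlag.tendsto_dyadicCeil {f : ℝ≥0 → ℝ} (hf : IsCadlag f) (t : ℝ≥0) :
    Tendsto (fun n => f (dyadicCeil n t)) atTop (𝓝 (f t)) :=
  (hf t).1.tendsto.comp (_root_.tendsto_dyadicCeil t)

lemma IsCadlag.pathEnd_eq {f : ℝ≥0 → ℝ} (hf : IsCadlag f) (t : ℝ≥0) : pathEnd f t = f t :=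
  (hf.tendsto_dyadicCeil t).limsup_eq

lemma IsCadlag.exists_forall_le {f : ℝ≥0 → ℝ} (hf : IsCadlag f) (t : ℝ≥0) :
    ∃ C, ∀ s ≤ t, f s ≤ C := by
  have hloc : ∀ s ∈ Set.Icc 0 t, ∃ U ∈ 𝓝[Set.Icc 0 t] s, ∃ C, ∀ r ∈ U, f r ≤ C := by
    intro s _
    obtain ⟨hr, l, hl⟩ := hf s
    have h1 : ∀ᶠ r in 𝓝[<] s, f r ≤ l + 1 := hl.eventually_le_const (by linarith)
    have h2 : ∀ᶠ r in 𝓝[≥] s, f r ≤ f s + 1 := hr.tendsto.eventually_le_const (by linarith)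
    have h3 : ∀ᶠ r in 𝓝 s, f r ≤ max (l + 1) (f s + 1) := by
      rw [← nhdsLT_sup_nhdsGE, eventually_sup]
      exact ⟨h1.mono fun r h => le_max_of_le_left h, h2.mono fun r h => le_max_of_le_right h⟩
    exact ⟨_, mem_nhdsWithin_of_mem_nhds h3, _, fun r hr => hr⟩
  have := isCompact_Icc.induction_on (s := Set.Icc 0 t) (p := fun U => ∃ C, ∀ r ∈ U, f r ≤ C)
    ⟨0, by simp⟩ (fun U V hUV ⟨C, hC⟩ => ⟨C, fun r hr => hC r (hUV hr)⟩)
    (fun U V ⟨C, hC⟩ ⟨C', hC'⟩ => ⟨max C C', fun r hr => hr.elim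
      (fun h => le_max_of_le_left (hC r h)) fun h => le_max_of_le_right (hC' r h)⟩) hloc
  obtain ⟨C, hC⟩ := this
  exact ⟨C, fun s hs => hC s ⟨zero_le, hs⟩⟩

lemma IsCadlag.bddAbove_dyadicMax {f : ℝ≥0 → ℝ} (hf : IsCadlag f) (hf0 : f 0 = 0) (t : ℝ≥0) :
    BddAbove (Set.range fun n => dyadicMax n f t) := by
  obtain ⟨C, hC⟩ := hf.exists_forall_le t
  refine ⟨max C 0, ?_⟩
  rintro _ ⟨n, rfl⟩
  by_contra h
  obtain ⟨k, hk, h2⟩ := (lt_dyadicMax_iff hf0 (le_max_right C 0)).1 (not_le.1 h)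
  exact (hC _ hk.le).not_gt ((le_max_left C 0).trans_lt h2)

lemma IsCadlag.tendsto_dyadicMax {f : ℝ≥0 → ℝ} (hf : IsCadlag f) (hf0 : f 0 = 0) (t : ℝ≥0) :
    Tendsto (fun n => dyadicMax n f t) atTop (𝓝 (pathSup f t)) :=
  tendsto_atTop_ciSup (dyadicMax_mono hf0 t) (hf.bddAbove_dyadicMax hf0 t)

lemma IsCadlag.dyadicMax_le_pathSup {f : ℝ≥0 → ℝ} (hf : IsCadlag f) (hf0 : f 0 = 0) (n : ℕ)
    (t : ℝ≥0) : dyadicMax n f t ≤ pathSup f t :=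
  le_ciSup (hf.bddAbove_dyadicMax hf0 t) n

lemma pathSup_nonneg (f : ℝ≥0 → ℝ) (t : ℝ≥0) : 0 ≤ pathSup f t :=
  Real.iSup_nonneg fun n => dyadicMax_nonneg n f t

/-- By right-continuity, a path above `a` at `s < t` is still above `a` at fine grid points just
after `s`, which are still before `t`. -/
lemma IsCadlag.lt_pathSup_iff {f : ℝ≥0 → ℝ} (hf : IsCadlag f) (hf0 : f 0 = 0) {t : ℝ≥0} {a : ℝ}
    (ha : 0 ≤ a) : a < pathSup f t ↔ ∃ s < t, a < f s := by
  constructor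
  · intro h
    obtain ⟨n, hn⟩ := exists_lt_of_lt_ciSup h
    obtain ⟨k, hk, h2⟩ := (lt_dyadicMax_iff hf0 ha).1 hn
    exact ⟨_, hk, h2⟩
  · rintro ⟨s, hs, h⟩
    have h1 := (hf.tendsto_dyadicCeil s).eventually_const_lt h
    have h2 := ((tendsto_nhdsWithin_iff.1 (_root_.tendsto_dyadicCeil s)).1).eventually_lt_const hs
    obtain ⟨n, h3, h4⟩ := (h1.and h2).exists
    exact ((lt_dyadicMax_iff hf0 ha).2 ⟨dyadicSteps n s, h4, h3⟩).trans_le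
      (hf.dyadicMax_le_pathSup hf0 n t)

lemma measurable_dyadicIncr (n : ℕ) : Measurable (dyadicIncr n) :=
  measurable_pi_lambda _ fun _ => (measurable_pi_apply _).sub (measurable_pi_apply _)

lemma measurable_dyadicMax (n : ℕ) :
    Measurable fun q : (ℝ≥0 → ℝ) × ℝ≥0 => dyadicMax n q.1 q.2 := by
  have h : Measurable fun q : (ℕ → ℝ) × ℕ => walkMax q.2 q.1 :=
    measurable_from_prod_countable_left measurable_walkMax
  exact h.comp (((measurable_dyadicIncr n).comp measurable_fst).prodMk
    ((measurable_dyadicSteps n).comp measurable_snd))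

lemma measurable_pathSup : Measurable fun q : (ℝ≥0 → ℝ) × ℝ≥0 => pathSup q.1 q.2 :=
  Measurable.iSup measurable_dyadicMax

/-- Evaluation at a variable time is not jointly measurable for the product σ-algebra on all paths.
The functional involves only countably many coordinates and agrees with evaluation on càdlàg paths.
-/
lemma measurable_pathEnd : Measurable fun q : (ℝ≥0 → ℝ) × ℝ≥0 => pathEnd q.1 q.2 := by
  refine Measurable.limsup fun n => ?_
  have h : Measurable fun q : (ℝ≥0 → ℝ) × ℕ => q.1 (q.2 / 2 ^ n) :=
    measurable_from_prod_countable_left fun k => measurable_pi_apply (k / 2 ^ n : ℝ≥0)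
  exact h.comp (measurable_fst.prodMk ((measurable_dyadicSteps n).comp measurable_snd))

end PathFunctionals

/-! ### The Lévy process at an independent exponential time. -/

section KilledLevyProcess

/-- The supremum of a process before an independent time. -/
noncomputable def killedSup {Ω₀ : Type*} (ξ : ℝ≥0 → Ω₀ → ℝ) (q : Ω₀ × ℝ≥0) : ℝ :=
  pathSup (fun s => ξ s q.1) q.2

/-- The value of a process at an independent time. -/
noncomputable def killedEnd {Ω₀ : Type*} (ξ : ℝ≥0 → Ω₀ → ℝ) (q : Ω₀ × ℝ≥0) : ℝ :=
  pathEnd (fun s => ξ s q.1) q.2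

variable {Ω₀ : Type*} [MeasurableSpace Ω₀] {P₀ : Measure Ω₀} {ξ : ℝ≥0 → Ω₀ → ℝ}

lemma IsLevyProcess.measurable_path (hL : IsLevyProcess ξ P₀) :
    Measurable fun ω s => ξ s ω :=
  measurable_pi_lambda _ hL.measurable

lemma IsLevyProcess.measurable_path_prodMk (hL : IsLevyProcess ξ P₀) :
    Measurable fun q : Ω₀ × ℝ≥0 => ((fun s => ξ s q.1), q.2) :=
  (hL.measurable_path.comp measurable_fst).prodMk measurable_snd

lemma IsLevyProcess.measurable_killedSup (hL : IsLevyProcess ξ P₀) : Measurable (killedSup ξ) := by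
  have h := measurable_pathSup.comp hL.measurable_path_prodMk
  rw [Function.comp_def] at h
  exact h

lemma IsLevyProcess.measurable_killedEnd (hL : IsLevyProcess ξ P₀) : Measurable (killedEnd ξ) := by
  have h := measurable_pathEnd.comp hL.measurable_path_prodMk
  rw [Function.comp_def] at h
  exact h

lemma IsLevyProcess.measurableSet_lt_killedSup (hL : IsLevyProcess ξ P₀) (a : ℝ) :
    MeasurableSet {q | a < killedSup ξ q} :=
  measurableSet_lt measurable_const hL.measurable_killedSup

lemma IsLevyProcess.ae_prod_isCadlag (hL : IsLevyProcess ξ P₀) :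
    ∀ᵐ q ∂(P₀.prod lifeLaw), IsCadlag (fun s => ξ s q.1) ∧ ξ 0 q.1 = 0 :=
  Measure.quasiMeasurePreserving_fst.ae (hL.cadlag.and hL.start_zero)

lemma IsLevyProcess.map_dyadicIncr (hL : IsLevyProcess ξ P₀) (n : ℕ) {μ : Measure ℝ}
    [IsProbabilityMeasure μ] (hμ : P₀.map (ξ (1 / 2 ^ n)) = μ) :
    P₀.map (fun ω => dyadicIncr n (fun s => ξ s ω)) = stepLaw μ := by
  have hmono : Monotone fun i : ℕ => (i : ℝ≥0) / 2 ^ n := fun i j hij => by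
    simp only
    gcongr
  have h1 : P₀.map (fun ω => dyadicIncr n (fun s => ξ s ω)) = Measure.infinitePi fun i : ℕ =>
      P₀.map (fun ω => ξ ((i + 1 : ℕ) / 2 ^ n) ω - ξ (i / 2 ^ n) ω) :=
    (hL.indep_increments.nat hmono).map_fun_eq_infinitePi_map
      fun i => (hL.measurable _).sub (hL.measurable _)
  have h2 : ∀ i : ℕ, P₀.map (fun ω => ξ ((i + 1 : ℕ) / 2 ^ n) ω - ξ (i / 2 ^ n) ω) = μ := by
    intro i
    have h3 := (hL.stationary_increments (i / 2 ^ n) (1 / 2 ^ n)).map_eq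
    rw [hμ] at h3
    rw [← h3, Nat.cast_add, Nat.cast_one, add_div]
  simp_rw [h2] at h1
  exact h1

/-- Values and maxima along the dyadic grids approximate those of the killed process. -/
lemma IsLevyProcess.ae_tendsto_dyadic (hL : IsLevyProcess ξ P₀) :
    ∀ᵐ q ∂(P₀.prod lifeLaw),
      (∀ a : ℝ, ∀ᶠ n in atTop, (a < walkMax (dyadicSteps n q.2) (dyadicIncr n fun s => ξ s q.1) ↔
        a < killedSup ξ q)) ∧
      Tendsto (fun n => walkMax (dyadicSteps n q.2) (dyadicIncr n fun s => ξ s q.1) -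
        walk (dyadicSteps n q.2) (dyadicIncr n fun s => ξ s q.1)) atTop
        (𝓝 (killedSup ξ q - killedEnd ξ q)) := by
  filter_upwards [hL.ae_prod_isCadlag] with q ⟨hq, h0⟩
  have h1 := hq.tendsto_dyadicMax h0 q.2
  refine ⟨fun a => ?_, ?_⟩
  · rcases lt_or_ge a (killedSup ξ q) with h | h
    · filter_upwards [h1.eventually_const_lt h] with n hn
      exact iff_of_true hn h
    · exact Eventually.of_forall fun n => iff_of_false
        (not_lt.2 ((hq.dyadicMax_le_pathSup h0 n q.2).trans h)) (not_lt.2 h)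
  · simp_rw [walk_dyadicIncr, h0, sub_zero]
    refine h1.sub ?_
    rw [killedEnd, hq.pathEnd_eq]
    exact hq.tendsto_dyadicCeil q.2

variable [IsProbabilityMeasure P₀]

lemma IsLevyProcess.lintegral_dyadic (hL : IsLevyProcess ξ P₀) (n : ℕ) {μ : Measure ℝ}
    [IsProbabilityMeasure μ] (hμ : P₀.map (ξ (1 / 2 ^ n)) = μ) {Φ : ℕ → (ℕ → ℝ) → ℝ≥0∞}
    (hΦ : ∀ k, Measurable (Φ k)) :
    ∫⁻ q, Φ (dyadicSteps n q.2) (dyadicIncr n (fun s => ξ s q.1)) ∂(P₀.prod lifeLaw) =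
      ∫⁻ k, ∫⁻ x, Φ k x ∂(stepLaw μ) ∂(lifeLaw.map (dyadicSteps n)) := by
  have hincr : Measurable fun ω => dyadicIncr n (fun s => ξ s ω) :=
    (measurable_dyadicIncr n).comp hL.measurable_path
  have hΦ' : Measurable fun q : (ℕ → ℝ) × ℕ => Φ q.2 q.1 :=
    measurable_from_prod_countable_left hΦ
  rw [lintegral_prod_symm _ (Measurable.aemeasurable ?_),
    lintegral_map (measurable_of_countable _) (measurable_dyadicSteps n)]
  · refine lintegral_congr fun t => ?_
    rw [← hL.map_dyadicIncr n hμ, lintegral_map (hΦ _) hincr]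
  · exact hΦ'.comp ((hincr.comp measurable_fst).prodMk
      ((measurable_dyadicSteps n).comp measurable_snd))

/-- The grid maxima increase to the supremum, so the indicators of the strict inequality eventually
stabilize on almost every path; boundedness of `ψ` supplies the domination. -/
lemma IsLevyProcess.tendsto_walkTail (hL : IsLevyProcess ξ P₀) {μ : ℕ → Measure ℝ}
    [∀ n, IsProbabilityMeasure (μ n)] (hμ : ∀ n, P₀.map (ξ (1 / 2 ^ n)) = μ n) {ψ : ℝ → ℝ≥0∞}
    (hψ : Continuous ψ) {K : ℝ≥0∞} (hK : K ≠ ∞) (hψK : ∀ x, ψ x ≤ K) (a : ℝ) :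
    Tendsto (fun n => ∫⁻ k, ∫⁻ x, (if a < walkMax k x then ψ (walkMax k x - walk k x) else 0)
      ∂(stepLaw (μ n)) ∂(lifeLaw.map (dyadicSteps n))) atTop
      (𝓝 (∫⁻ q, (if a < killedSup ξ q then ψ (killedSup ξ q - killedEnd ξ q) else 0)
        ∂(P₀.prod lifeLaw))) := by
  have hm : ∀ k, Measurable fun x => if a < walkMax k x then ψ (walkMax k x - walk k x) else 0 :=
    fun k => Measurable.ite (measurableSet_lt measurable_const (measurable_walkMax k))
      (hψ.measurable.comp ((measurable_walkMax k).sub (measurable_walk k))) measurable_const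
  have h1 : ∀ n, _ := fun n => hL.lintegral_dyadic n (hμ n) hm
  simp_rw [← h1]
  have hincr : ∀ n, Measurable fun ω => dyadicIncr n (fun s => ξ s ω) := fun n =>
    (measurable_dyadicIncr n).comp hL.measurable_path
  have hm' : Measurable fun q : (ℕ → ℝ) × ℕ =>
      if a < walkMax q.2 q.1 then ψ (walkMax q.2 q.1 - walk q.2 q.1) else 0 :=
    measurable_from_prod_countable_left hm
  refine tendsto_lintegral_of_dominated_convergence (fun _ => K) (fun n => ?_)
    (fun n => ae_of_all _ fun q => ?_) (by simp [hK]) ?_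
  · exact hm'.comp (((hincr n).comp measurable_fst).prodMk
      ((measurable_dyadicSteps n).comp measurable_snd))
  · simp only
    split_ifs
    · exact hψK _
    · exact zero_le
  · filter_upwards [hL.ae_tendsto_dyadic] with q ⟨hq1, hq2⟩
    by_cases h : a < killedSup ξ q
    · rw [if_pos h]
      refine ((hψ.tendsto _).comp hq2).congr' ?_
      filter_upwards [hq1 a] with n hn
      rw [if_pos (hn.2 h)]
      rfl
    · rw [if_neg h]
      refine tendsto_const_nhds.congr' ?_
      filter_upwards [hq1 a] with n hn
      rw [if_neg (mt hn.1 h)]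

lemma IsLevyProcess.tendsto_walkTail_killedSup (hL : IsLevyProcess ξ P₀) {μ : ℕ → Measure ℝ}
    [∀ n, IsProbabilityMeasure (μ n)] (hμ : ∀ n, P₀.map (ξ (1 / 2 ^ n)) = μ n) (a : ℝ) :
    Tendsto (fun n => walkTail (μ n) (lifeLaw.map (dyadicSteps n)) a) atTop
      (𝓝 ((P₀.prod lifeLaw) {q | a < killedSup ξ q})) := by
  have h := hL.tendsto_walkTail hμ (ψ := fun _ => 1) continuous_const ENNReal.one_ne_top
    (fun _ => le_rfl) a
  rw [← lintegral_indicator_one (hL.measurableSet_lt_killedSup a)]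
  simpa only [walkTail, Set.indicator_apply, Set.mem_ofPred_eq, Pi.one_apply] using h

lemma IsLevyProcess.lintegral_ite_killedSup (hL : IsLevyProcess ξ P₀) {ψ : ℝ → ℝ≥0∞}
    (hψ : Continuous ψ) {K : ℝ≥0∞} (hK : K ≠ ∞) (hψK : ∀ x, ψ x ≤ K) {a : ℝ} (ha : 0 ≤ a) :
    ∫⁻ q, (if a < killedSup ξ q then ψ (killedSup ξ q - killedEnd ξ q) else 0)
      ∂(P₀.prod lifeLaw) = (P₀.prod lifeLaw) {q | a < killedSup ξ q} *
        ∫⁻ q, ψ (killedSup ξ q - killedEnd ξ q) ∂(P₀.prod lifeLaw) := by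
  have hμ : ∀ n : ℕ, IsProbabilityMeasure (P₀.map (ξ (1 / 2 ^ n))) := fun n =>
    Measure.isProbabilityMeasure_map (hL.measurable _).aemeasurable
  have h1 := hL.tendsto_walkTail (fun n => rfl) hψ hK hψK a
  -- Maxima are nonnegative, so the level `-1` removes the indicator.
  have h2 := hL.tendsto_walkTail (fun n => rfl) hψ hK hψK (-1)
  have hpos : ∀ q, (-1 : ℝ) < killedSup ξ q := fun q =>
    lt_of_lt_of_le (by norm_num) (pathSup_nonneg _ _)
  have hpos' : ∀ k x, (-1 : ℝ) < walkMax k x := fun k x =>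
    lt_of_lt_of_le (by norm_num) (walkMax_nonneg _ _)
  simp only [hpos, hpos', if_true] at h2
  have h3 := hL.tendsto_walkTail_killedSup (fun n => rfl) a
  have hfin : ∫⁻ q, ψ (killedSup ξ q - killedEnd ξ q) ∂(P₀.prod lifeLaw) ≠ ∞ := by
    refine ne_top_of_le_ne_top hK ((lintegral_mono fun q => hψK _).trans ?_)
    simp
  refine tendsto_nhds_unique h1 ((ENNReal.Tendsto.mul h3 (Or.inr hfin) h2
    (Or.inr (measure_ne_top _ _))).congr fun n => ?_)
  exact (lintegral_walkMax_sub_walk _ (isMemoryless_dyadicSteps n) ha hψ.measurable).symm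

/-- The supremum of a Lévy process before an independent exponential time is independent of the
distance to it at that time. -/
theorem IsLevyProcess.indepFun_killedSup (hL : IsLevyProcess ξ P₀) :
    IndepFun (killedSup ξ) (fun q => killedSup ξ q - killedEnd ξ q) (P₀.prod lifeLaw) := by
  have hS := hL.measurable_killedSup
  have hD : Measurable fun q => killedSup ξ q - killedEnd ξ q := hS.sub hL.measurable_killedEnd
  -- The factorization is known for bounded continuous test functions, which determine finite
  -- measures. Levels `a < 0` are trivial since the supremum is nonnegative.
  have key : ∀ a : ℝ, ((P₀.prod lifeLaw).restrict {q | a < killedSup ξ q}).map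
      (fun q => killedSup ξ q - killedEnd ξ q) = (P₀.prod lifeLaw) {q | a < killedSup ξ q} •
        (P₀.prod lifeLaw).map (fun q => killedSup ξ q - killedEnd ξ q) := by
    intro a
    rcases lt_or_ge a 0 with ha | ha
    · have : {q | a < killedSup ξ q} = Set.univ :=
        Set.eq_univ_of_forall fun q => ha.trans_le (pathSup_nonneg _ _)
      rw [this, Measure.restrict_univ, measure_univ, one_smul]
    · have := Measure.smul_finite ((P₀.prod lifeLaw).map
        (fun q => killedSup ξ q - killedEnd ξ q))
        (measure_ne_top (P₀.prod lifeLaw) {q | a < killedSup ξ q})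
      refine ext_of_forall_lintegral_eq_of_IsFiniteMeasure fun f => ?_
      have hf : Continuous fun x => (f x : ℝ≥0∞) :=
        ENNReal.continuous_coe.comp f.continuous
      rw [lintegral_smul_measure, lintegral_map hf.measurable hD, lintegral_map hf.measurable hD,
        smul_eq_mul, ← hL.lintegral_ite_killedSup hf (K := nndist f 0) ENNReal.coe_ne_top
          (fun x => ENNReal.coe_le_coe.2 (BoundedContinuousFunction.NNReal.upper_bound f x)) ha,
        ← lintegral_indicator (hL.measurableSet_lt_killedSup a)]
      rfl
  rw [indepFun_iff_measure_inter_preimage_eq_mul]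
  intro A B hA hB
  have := Measure.smul_finite ((P₀.prod lifeLaw).map (killedSup ξ))
    (measure_ne_top (P₀.prod lifeLaw) ((fun q => killedSup ξ q - killedEnd ξ q) ⁻¹' B))
  have h1 : ((P₀.prod lifeLaw).restrict ((fun q => killedSup ξ q - killedEnd ξ q) ⁻¹' B)).map
      (killedSup ξ) = (P₀.prod lifeLaw) ((fun q => killedSup ξ q - killedEnd ξ q) ⁻¹' B) •
        (P₀.prod lifeLaw).map (killedSup ξ) := by
    refine ext_of_generate_finite (Set.range Set.Ioi) ?_ isPiSystem_Ioi ?_ ?_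
    · rw [BorelSpace.measurable_eq (α := ℝ), borel_eq_generateFrom_Ioi]
    · rintro _ ⟨a, rfl⟩
      have h2 := congrArg (fun m => m B) (key a)
      simp only [Measure.smul_apply, smul_eq_mul] at h2
      rw [Measure.map_apply hD hB, Measure.map_apply hD hB, Measure.restrict_apply (hD hB)] at h2
      rw [Measure.map_apply hS measurableSet_Ioi, Measure.restrict_apply (hS measurableSet_Ioi),
        Measure.smul_apply, Measure.map_apply hS measurableSet_Ioi, smul_eq_mul, mul_comm,
        Set.inter_comm]
      exact h2
    · rw [Measure.map_apply hS MeasurableSet.univ, Measure.smul_apply,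
        Measure.map_apply hS MeasurableSet.univ]
      simp
  have h3 := congrArg (fun m => m A) h1
  simp only [Measure.smul_apply, smul_eq_mul] at h3
  rwa [Measure.map_apply hS hA, Measure.map_apply hS hA, Measure.restrict_apply (hS hA),
    mul_comm] at h3

lemma IsLevyProcess.lintegral_killedEnd (hL : IsLevyProcess ξ P₀) {f : ℝ → ℝ≥0∞}
    (hf : Measurable f) :
    ∫⁻ q, f (killedEnd ξ q) ∂(P₀.prod lifeLaw) = ∫⁻ t, ∫⁻ ω, f (ξ t ω) ∂P₀ ∂lifeLaw := by
  have hm : Measurable fun q => f (killedEnd ξ q) := hf.comp hL.measurable_killedEnd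
  rw [lintegral_prod_symm _ hm.aemeasurable]
  refine lintegral_congr fun t => lintegral_congr_ae ?_
  filter_upwards [hL.cadlag] with ω hω
  rw [killedEnd, hω.pathEnd_eq]

end KilledLevyProcess

/-! ### The supremum before the exponential time is memoryless. -/

section MaximumAtExponentialTime

/-- Cauchy's functional equation for antitone functions. -/
lemma eq_exp_of_antitone_of_mul {g : ℝ → ℝ} (hpos : ∀ a, 0 ≤ a → 0 < g a)
    (hanti : ∀ a b, 0 ≤ a → a ≤ b → g b ≤ g a)
    (hmul : ∀ a b, 0 ≤ a → 0 ≤ b → g (a + b) = g a * g b) {a : ℝ} (ha : 0 ≤ a) :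
    g a = Real.exp (Real.log (g 1) * a) := by
  set c := Real.log (g 1) with hc
  have h0 : g 0 = 1 := by
    have h := hmul 0 0 le_rfl le_rfl
    rw [add_zero] at h
    have := hpos 0 le_rfl
    exact (mul_right_cancel₀ this.ne' (by linarith : 1 * g 0 = g 0 * g 0)).symm
  have hc0 : c ≤ 0 := Real.log_nonpos (hpos 1 zero_le_one).le
    (h0 ▸ hanti 0 1 le_rfl zero_le_one)
  have hnat : ∀ (n : ℕ) (x : ℝ), 0 ≤ x → Real.log (g (n * x)) = n * Real.log (g x) := by
    intro n x hx
    induction n with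
    | zero => simp [h0]
    | succ n ih =>
      have hnx : 0 ≤ n * x := by positivity
      rw [Nat.cast_succ, add_mul, one_mul, hmul _ _ hnx hx,
        Real.log_mul (hpos _ hnx).ne' (hpos _ hx).ne', ih]
      ring
  have hnat' : ∀ n : ℕ, Real.log (g n) = n * c := fun n => by
    simpa using hnat n 1 zero_le_one
  -- `n a` lies between two consecutive integers, at which `log g` differs by `c`. The error is thus
  -- bounded uniformly in `n` after multiplication by `n`, hence zero.
  have hbound : ∀ n : ℕ, n * |Real.log (g a) - c * a| ≤ -c := by
    intro n
    have hna : 0 ≤ n * a := by positivity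
    have h1 := Nat.floor_le hna
    have h2 := (Nat.lt_floor_add_one (n * a)).le
    have h3 := Real.log_le_log (hpos _ hna) (hanti _ _ (Nat.cast_nonneg _) h1)
    have h4 := Real.log_le_log (hpos _ (by positivity)) (hanti _ _ hna h2)
    rw [hnat n a ha, hnat'] at h3
    rw [hnat n a ha, ← Nat.cast_succ, hnat', Nat.cast_succ] at h4
    rw [← abs_of_nonneg (Nat.cast_nonneg (α := ℝ) n), ← abs_mul, abs_le]
    constructor <;> nlinarith
  have hzero : Real.log (g a) = c * a := by
    by_contra h
    have h1 : 0 < |Real.log (g a) - c * a| := abs_pos.2 (sub_ne_zero.2 h)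
    obtain ⟨n, hn⟩ := exists_nat_gt (-c / |Real.log (g a) - c * a|)
    rw [div_lt_iff₀ h1] at hn
    exact (hbound n).not_gt hn
  rw [← hzero, Real.exp_log (hpos a ha)]

variable {Ω₀ : Type*} [MeasurableSpace Ω₀] {P₀ : Measure Ω₀} [IsProbabilityMeasure P₀]
  {ξ : ℝ≥0 → Ω₀ → ℝ} {α cNeg η : ℝ}

lemma IsStrictlyStableProcess.lintegral_exp (hξ : IsStrictlyStableProcess α 0 cNeg η ξ P₀)
    (hα : 0 < α) (t : ℝ≥0) {θ : ℝ} (hθ : 0 ≤ θ) :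
    ∫⁻ ω, ENNReal.ofReal (Real.exp (θ * ξ t ω)) ∂P₀ =
      ENNReal.ofReal (Real.exp (laplaceConstant ξ P₀ * θ ^ α * t)) := by
  rw [← ofReal_integral_eq_lintegral_ofReal (hξ.integrable_exp t hθ)
    (ae_of_all _ fun ω => (Real.exp_pos _).le)]
  have := hξ.mgf_eq_exp hα t hθ
  rw [mgf] at this
  rw [this, mul_comm (t : ℝ)]

lemma IsStrictlyStableProcess.measure_lt_le (hξ : IsStrictlyStableProcess α 0 cNeg η ξ P₀)
    (hα : 0 < α) (t : ℝ≥0) {θ : ℝ} (hθ : 0 ≤ θ) (ε : ℝ) :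
    P₀ {ω | ε < ξ t ω} ≤
      ENNReal.ofReal (Real.exp (laplaceConstant ξ P₀ * θ ^ α * t - θ * ε)) := by
  have hm : Measurable fun ω => ENNReal.ofReal (Real.exp (θ * ξ t ω)) := by
    have := hξ.levy.measurable t
    fun_prop
  have h1 := mul_meas_ge_le_lintegral (μ := P₀) hm (ENNReal.ofReal (Real.exp (θ * ε)))
  rw [hξ.lintegral_exp hα t hθ] at h1
  have h2 : P₀ {ω | ε < ξ t ω} ≤ P₀ {ω | ENNReal.ofReal (Real.exp (θ * ε)) ≤
      ENNReal.ofReal (Real.exp (θ * ξ t ω))} := by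
    refine measure_mono fun ω (hω : ε < ξ t ω) => ENNReal.ofReal_le_ofReal (Real.exp_le_exp.2 ?_)
    gcongr
  have h3 : (1 : ℝ≥0∞) = ENNReal.ofReal (Real.exp (-(θ * ε))) *
      ENNReal.ofReal (Real.exp (θ * ε)) := by
    rw [← ENNReal.ofReal_mul (Real.exp_pos _).le, ← Real.exp_add]
    simp
  calc P₀ {ω | ε < ξ t ω} ≤ ENNReal.ofReal (Real.exp (-(θ * ε))) *
        (ENNReal.ofReal (Real.exp (θ * ε)) * P₀ {ω | ENNReal.ofReal (Real.exp (θ * ε)) ≤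
          ENNReal.ofReal (Real.exp (θ * ξ t ω))}) := by
        rw [← mul_assoc, ← h3, one_mul]
        exact h2
    _ ≤ ENNReal.ofReal (Real.exp (-(θ * ε))) *
        ENNReal.ofReal (Real.exp (laplaceConstant ξ P₀ * θ ^ α * t)) := by gcongr
    _ = _ := by
        rw [← ENNReal.ofReal_mul (Real.exp_pos _).le, ← Real.exp_add]
        congr 2
        ring

/-- The choice `θ = 2^(n/α)` in the Chernoff bound makes `C θ^α 2^(-n) = C`. A grid increment then
exceeds `ε` with probability at most `e^(C - ε 2^(n/α))`, which beats the mean number of steps, of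
order `2^n`. -/
lemma IsStrictlyStableProcess.tendsto_overshoot (hξ : IsStrictlyStableProcess α 0 cNeg η ξ P₀)
    (hα : 0 < α) {ε : ℝ} (hε : 0 < ε) :
    Tendsto (fun n : ℕ => P₀ {ω | ε < ξ (1 / 2 ^ n) ω} *
      (1 - ENNReal.ofReal (Real.exp (-(1 / 2 ^ n))))⁻¹) atTop (𝓝 0) := by
  have hx : Tendsto (fun n : ℕ => ((2 : ℝ) ^ n) ^ (1 / α)) atTop atTop :=
    (tendsto_rpow_atTop (by positivity)).comp (tendsto_pow_atTop_atTop_of_one_lt one_lt_two)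
  have hlim := ((tendsto_rpow_mul_exp_neg_mul_atTop_nhds_zero α ε hε).comp hx).const_mul
    (2 * Real.exp (laplaceConstant ξ P₀))
  rw [mul_zero] at hlim
  have hlim' := ENNReal.tendsto_ofReal hlim
  rw [ENNReal.ofReal_zero] at hlim'
  refine tendsto_of_tendsto_of_tendsto_of_le_of_le tendsto_const_nhds hlim' (fun _ => zero_le)
    fun n => ?_
  have h2n : (1 : ℝ) ≤ 2 ^ n := one_le_pow₀ one_le_two
  have hpow : (((2 : ℝ) ^ n) ^ (1 / α)) ^ α = 2 ^ n := by
    rw [← Real.rpow_mul (by positivity), one_div_mul_cancel hα.ne', Real.rpow_one]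
  have h1 := hξ.measure_lt_le hα (1 / 2 ^ n) (θ := ((2 : ℝ) ^ n) ^ (1 / α)) (by positivity) ε
  rw [hpow] at h1
  have h2 : (1 - ENNReal.ofReal (Real.exp (-(1 / 2 ^ n))))⁻¹ ≤ ENNReal.ofReal (2 * 2 ^ n) := by
    set h : ℝ := 1 / 2 ^ n with hh
    have hh0 : 0 < h := by positivity
    have hh1 : h ≤ 1 := by rw [hh, div_le_one (by positivity)]; exact h2n
    have h3 : h / 2 ≤ 1 - Real.exp (-h) := by
      have h4 : Real.exp (-h) * (1 + h) ≤ 1 := by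
        calc Real.exp (-h) * (1 + h) ≤ Real.exp (-h) * Real.exp h := by
              gcongr
              linarith [Real.add_one_le_exp h]
          _ = 1 := by rw [← Real.exp_add]; simp
      nlinarith [Real.exp_pos (-h)]
    rw [← ENNReal.ofReal_one, ← ENNReal.ofReal_sub _ (Real.exp_pos _).le,
      ← ENNReal.ofReal_inv_of_pos (by linarith)]
    refine ENNReal.ofReal_le_ofReal ?_
    rw [show (2 : ℝ) * 2 ^ n = (h / 2)⁻¹ by rw [hh]; field_simp]
    exact inv_anti₀ (by positivity) h3
  refine (mul_le_mul' h1 h2).trans_eq ?_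
  rw [← ENNReal.ofReal_mul (Real.exp_pos _).le]
  congr 1
  simp only [Function.comp_apply, hpow]
  rw [show laplaceConstant ξ P₀ * 2 ^ n * ((1 / 2 ^ n : ℝ≥0) : ℝ) - ((2 : ℝ) ^ n) ^ (1 / α) * ε =
    laplaceConstant ξ P₀ + -ε * ((2 : ℝ) ^ n) ^ (1 / α) by
      push_cast
      field_simp
      ring, Real.exp_add]
  ring

/-- The tail function of the supremum before an exponential time is multiplicative. -/
lemma IsStrictlyStableProcess.measure_lt_killedSup_add
    (hξ : IsStrictlyStableProcess α 0 cNeg η ξ P₀) (hα : 0 < α) {a b : ℝ} (ha : 0 ≤ a)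
    (hb : 0 ≤ b) :
    (P₀.prod lifeLaw) {q | a + b < killedSup ξ q} =
      (P₀.prod lifeLaw) {q | a < killedSup ξ q} * (P₀.prod lifeLaw) {q | b < killedSup ξ q} := by
  have hL := hξ.levy
  have hμ : ∀ n : ℕ, IsProbabilityMeasure (P₀.map (ξ (1 / 2 ^ n))) := fun n =>
    Measure.isProbabilityMeasure_map (hL.measurable _).aemeasurable
  have hlim : ∀ a, _ := hL.tendsto_walkTail_killedSup (fun n => rfl)
  have hprod := ENNReal.Tendsto.mul (hlim a) (Or.inr (measure_ne_top _ _)) (hlim b)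
    (Or.inr (measure_ne_top _ _))
  refine le_antisymm ?_ (le_of_tendsto_of_tendsto' hprod (hlim (a + b)) fun n =>
    walkTail_mul_le _ (isMemoryless_dyadicSteps n) ha b)
  -- The overshoot estimate needs a margin `ε` over the level; the strict inequality defining the
  -- event lets the margin shrink to zero afterwards.
  have hε : ∀ ε : ℝ, 0 < ε → (P₀.prod lifeLaw) {q | a + b + ε < killedSup ξ q} ≤
      (P₀.prod lifeLaw) {q | a < killedSup ξ q} * (P₀.prod lifeLaw) {q | b < killedSup ξ q} := by
    intro ε hε
    have h1 := hprod.add (hξ.tendsto_overshoot hα hε)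
    rw [add_zero] at h1
    refine le_of_tendsto_of_tendsto' (hlim (a + b + ε)) h1 fun n => ?_
    refine (walkTail_add_le _ (isMemoryless_dyadicSteps n) ha hb hε.le).trans_eq ?_
    rw [Measure.map_apply (hL.measurable _) measurableSet_Ioi]
    rfl
  have hU : {q | a + b < killedSup ξ q} =
      ⋃ k : ℕ, {q : Ω₀ × ℝ≥0 | a + b + 1 / ((k : ℝ) + 1) < killedSup ξ q} := by
    ext q
    simp only [Set.mem_ofPred_eq, Set.mem_iUnion]
    constructor
    · intro h
      obtain ⟨k, hk⟩ := exists_nat_one_div_lt (sub_pos.2 h)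
      exact ⟨k, by linarith⟩
    · rintro ⟨k, hk⟩
      have : 0 < 1 / ((k : ℝ) + 1) := by positivity
      linarith
  rw [hU, Monotone.measure_iUnion]
  · exact iSup_le fun k => hε _ (by positivity)
  · intro k l hkl q hq
    simp only [Set.mem_ofPred_eq] at hq ⊢
    have : 1 / ((l : ℝ) + 1) ≤ 1 / ((k : ℝ) + 1) := by gcongr
    linarith

end MaximumAtExponentialTime

/-! ### The joint law of the supremum and the endpoint at the exponential time. -/

section LawAtExponentialTime

lemma expMeasure_Ioi {r : ℝ} (hr : 0 < r) {a : ℝ} (ha : 0 ≤ a) :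
    expMeasure r (Set.Ioi a) = ENNReal.ofReal (Real.exp (-(r * a))) := by
  have := isProbabilityMeasure_expMeasure hr
  have h1 : (expMeasure r).real (Set.Iic a) = 1 - Real.exp (-(r * a)) := by
    rw [← cdf_eq_real, cdf_expMeasure_eq hr, if_pos ha]
  rw [← ofReal_measureReal, ← Set.compl_Iic, probReal_compl_eq_one_sub measurableSet_Iic, h1,
    sub_sub_cancel]

variable {Ω₀ : Type*} [MeasurableSpace Ω₀] {P₀ : Measure Ω₀} [IsProbabilityMeasure P₀]
  {ξ : ℝ≥0 → Ω₀ → ℝ} {α cNeg η : ℝ}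

lemma IsStrictlyStableProcess.lintegral_exp_killedEnd
    (hξ : IsStrictlyStableProcess α 0 cNeg η ξ P₀) (hα : 0 < α) {θ : ℝ} (hθ : 0 ≤ θ) :
    ∫⁻ q, ENNReal.ofReal (Real.exp (θ * killedEnd ξ q)) ∂(P₀.prod lifeLaw) =
      ∫⁻ x, ENNReal.ofReal (Real.exp (laplaceConstant ξ P₀ * θ ^ α * x)) ∂(expMeasure 1) := by
  rw [hξ.levy.lintegral_killedEnd (f := fun x => ENNReal.ofReal (Real.exp (θ * x)))
    (by fun_prop), ← lintegral_exp_mul_lifeLaw]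
  exact lintegral_congr fun t => hξ.lintegral_exp hα t hθ

/-- The supremum excludes time `t`, so an upward jump at `t` must be ruled out. Such a jump would
make the increment over `[t - h, t]` exceed `ε`. The Chernoff bound with `h → 0` leaves `e^(-θε)`,
and `θ → ∞` gives zero. -/
lemma IsStrictlyStableProcess.ae_le_pathSup (hξ : IsStrictlyStableProcess α 0 cNeg η ξ P₀)
    (hα : 0 < α) {t : ℝ≥0} (ht : 0 < t) : ∀ᵐ ω ∂P₀, ξ t ω ≤ pathSup (fun s => ξ s ω) t := by
  have hL := hξ.levy
  have key : ∀ ε : ℝ, 0 < ε → P₀ {ω | pathSup (fun s => ξ s ω) t + ε < ξ t ω} = 0 := by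
    intro ε hε
    have h1 : ∀ θ : ℝ, 0 ≤ θ → ∀ h : ℝ≥0, 0 < h → h ≤ t →
        P₀ {ω | pathSup (fun s => ξ s ω) t + ε < ξ t ω} ≤
          ENNReal.ofReal (Real.exp (laplaceConstant ξ P₀ * θ ^ α * h - θ * ε)) := by
      intro θ hθ h hh hht
      have hmeas : MeasurableSet {x : ℝ | ε < x} := measurableSet_Ioi
      have h2 := (hL.stationary_increments (t - h) h).measure_mem_eq hmeas
      rw [tsub_add_cancel_of_le hht] at h2
      refine le_trans ?_ (hξ.measure_lt_le hα h hθ ε)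
      change _ ≤ P₀ (ξ h ⁻¹' {x : ℝ | ε < x})
      rw [← h2]
      refine measure_mono_ae ?_
      filter_upwards [hL.cadlag, hL.start_zero] with ω hω h0 h3
      have h4 : ξ (t - h) ω ≤ pathSup (fun s => ξ s ω) t := by
        by_contra h5
        exact lt_irrefl _ ((hω.lt_pathSup_iff h0 (pathSup_nonneg _ _)).2
          ⟨t - h, tsub_lt_self ht hh, not_le.1 h5⟩)
      change ε < ξ t ω - ξ (t - h) ω
      have h3' : pathSup (fun s => ξ s ω) t + ε < ξ t ω := h3
      linarith
    have h2 : ∀ θ : ℝ, 0 ≤ θ → P₀ {ω | pathSup (fun s => ξ s ω) t + ε < ξ t ω} ≤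
        ENNReal.ofReal (Real.exp (-ε * θ)) := by
      intro θ hθ
      have hlim : Tendsto (fun h : ℝ≥0 => ENNReal.ofReal
          (Real.exp (laplaceConstant ξ P₀ * θ ^ α * h - θ * ε))) (𝓝[>] 0)
          (𝓝 (ENNReal.ofReal (Real.exp (laplaceConstant ξ P₀ * θ ^ α * (0 : ℝ≥0) - θ * ε)))) := by
        refine Tendsto.mono_left (ENNReal.tendsto_ofReal (Continuous.tendsto ?_ _))
          nhdsWithin_le_nhds
        fun_prop
      have h3 := ge_of_tendsto hlim (b := P₀ {ω | pathSup (fun s => ξ s ω) t + ε < ξ t ω}) (by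
        filter_upwards [Ioc_mem_nhdsGT ht] with h hh
        exact h1 θ hθ h hh.1 hh.2)
      refine h3.trans_eq ?_
      congr 2
      simp only [NNReal.coe_zero]
      ring
    have hlim : Tendsto (fun θ : ℝ => ENNReal.ofReal (Real.exp (-ε * θ))) atTop (𝓝 0) := by
      rw [← ENNReal.ofReal_zero]
      exact ENNReal.tendsto_ofReal (Real.tendsto_exp_atBot.comp
        (tendsto_id.const_mul_atTop_of_neg (neg_lt_zero.2 hε)))
    refine le_antisymm (ge_of_tendsto hlim ?_) zero_le
    filter_upwards [eventually_ge_atTop 0] with θ hθ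
    exact h2 θ hθ
  have h1 : ∀ᵐ ω ∂P₀, ∀ k : ℕ, ξ t ω ≤ pathSup (fun s => ξ s ω) t + 1 / ((k : ℝ) + 1) := by
    refine ae_all_iff.2 fun k => ?_
    rw [ae_iff]
    simpa only [not_le] using key (1 / ((k : ℝ) + 1)) (by positivity)
  filter_upwards [h1] with ω hω
  by_contra h
  obtain ⟨k, hk⟩ := exists_nat_one_div_lt (sub_pos.2 (not_le.1 h))
  linarith [hω k]

lemma IsStrictlyStableProcess.ae_killedEnd_le_killedSup
    (hξ : IsStrictlyStableProcess α 0 cNeg η ξ P₀) (hα : 0 < α) :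
    ∀ᵐ q ∂(P₀.prod lifeLaw), killedEnd ξ q ≤ killedSup ξ q := by
  have hL := hξ.levy
  rw [Measure.ae_prod_iff_ae_ae
    (measurableSet_le hL.measurable_killedEnd hL.measurable_killedSup)]
  have hm := measurableSet_le hL.measurable_killedEnd hL.measurable_killedSup
  rw [Measure.ae_ae_comm hm]
  filter_upwards [ae_pos_lifeLaw] with t ht
  filter_upwards [hξ.ae_le_pathSup hα ht, hL.cadlag] with ω h hω
  rw [killedEnd, hω.pathEnd_eq]
  exact h

/-- The Wiener–Hopf factorization: the endpoint is `S - D` with `S` and `D` independent. -/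
lemma IsStrictlyStableProcess.lintegral_exp_killedEnd_eq_mul
    (hξ : IsStrictlyStableProcess α 0 cNeg η ξ P₀) (θ : ℝ) :
    ∫⁻ q, ENNReal.ofReal (Real.exp (θ * killedEnd ξ q)) ∂(P₀.prod lifeLaw) =
      (∫⁻ q, ENNReal.ofReal (Real.exp (θ * killedSup ξ q)) ∂(P₀.prod lifeLaw)) *
      ∫⁻ q, ENNReal.ofReal (Real.exp (-θ * (killedSup ξ q - killedEnd ξ q)))
        ∂(P₀.prod lifeLaw) := by
  have hL := hξ.levy
  have hS := hL.measurable_killedSup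
  have hY := hL.measurable_killedEnd
  have h := lintegral_mul_eq_lintegral_mul_lintegral_of_indepFun
    (f := fun q => ENNReal.ofReal (Real.exp (θ * killedSup ξ q)))
    (g := fun q => ENNReal.ofReal (Real.exp (-θ * (killedSup ξ q - killedEnd ξ q))))
    (by fun_prop) (by fun_prop) (hL.indepFun_killedSup.comp
      (φ := fun x => ENNReal.ofReal (Real.exp (θ * x)))
      (ψ := fun x => ENNReal.ofReal (Real.exp (-θ * x))) (by fun_prop) (by fun_prop))
  rw [← h]
  refine lintegral_congr fun q => ?_
  rw [Pi.mul_apply, ← ENNReal.ofReal_mul (Real.exp_pos _).le, ← Real.exp_add]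
  congr 2
  ring

lemma IsStrictlyStableProcess.lintegral_exp_neg_le_one
    (hξ : IsStrictlyStableProcess α 0 cNeg η ξ P₀) (hα : 0 < α) {θ : ℝ} (hθ : 0 ≤ θ) :
    ∫⁻ q, ENNReal.ofReal (Real.exp (-θ * (killedSup ξ q - killedEnd ξ q)))
      ∂(P₀.prod lifeLaw) ≤ 1 := by
  calc _ ≤ ∫⁻ q : Ω₀ × ℝ≥0, 1 ∂(P₀.prod lifeLaw) := by
        refine lintegral_mono_ae ?_
        filter_upwards [hξ.ae_killedEnd_le_killedSup hα] with q hq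
        rw [← ENNReal.ofReal_one]
        refine ENNReal.ofReal_le_ofReal (Real.exp_le_one_iff.2 ?_)
        nlinarith
    _ = 1 := by simp

lemma IsStrictlyStableProcess.lintegral_exp_neg_ne_zero
    (hξ : IsStrictlyStableProcess α 0 cNeg η ξ P₀) (θ : ℝ) :
    ∫⁻ q, ENNReal.ofReal (Real.exp (-θ * (killedSup ξ q - killedEnd ξ q)))
      ∂(P₀.prod lifeLaw) ≠ 0 := by
  have hS := hξ.levy.measurable_killedSup
  have hY := hξ.levy.measurable_killedEnd
  intro h
  rw [lintegral_eq_zero_iff (by fun_prop)] at h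
  obtain ⟨q, hq⟩ := h.exists
  simp only [Pi.zero_apply, ENNReal.ofReal_eq_zero] at hq
  exact (Real.exp_pos _).not_ge hq

/-- The supremum before an exponential time is exponentially distributed. -/
lemma IsStrictlyStableProcess.exists_map_killedSup
    (hξ : IsStrictlyStableProcess α 0 cNeg η ξ P₀) (hα : 0 < α)
    (hC : 0 < laplaceConstant ξ P₀) :
    ∃ r : ℝ, 0 < r ∧ (P₀.prod lifeLaw).map (killedSup ξ) = expMeasure r := by
  have hS := hξ.levy.measurable_killedSup
  set Q := P₀.prod lifeLaw
  set g : ℝ → ℝ := fun a => Q.real {q | a < killedSup ξ q} with hg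
  have hmul : ∀ a b, 0 ≤ a → 0 ≤ b → g (a + b) = g a * g b := fun a b ha hb => by
    simp only [hg, Measure.real, hξ.measure_lt_killedSup_add hα ha hb, ENNReal.toReal_mul, Q]
  have hanti : Antitone g := fun a b hab => by
    refine measureReal_mono fun q hq => ?_
    exact lt_of_le_of_lt hab hq
  have hg0 : ∀ a, 0 ≤ g a := fun a => measureReal_nonneg
  have hpow : ∀ (a : ℝ) (n : ℕ), 0 ≤ a → g ((n + 1 : ℕ) * a) = g a ^ (n + 1) := fun a n ha => by
    induction n with
    | zero => simp
    | succ n ih =>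
      rw [Nat.cast_succ, add_mul, one_mul, hmul _ _ (by positivity) ha, ih, pow_succ (g a) (n + 1)]
  -- If the supremum vanished almost surely, the endpoint would be nonpositive with exponential
  -- moments at most one; but its moment at the `θ` with `C θ^α = 1` is infinite.
  have hzero : g 0 ≠ 0 := by
    intro h0
    have h1 : ∀ᵐ q ∂Q, killedSup ξ q ≤ 0 := by
      rw [ae_iff]
      simp only [not_le]
      exact (measureReal_eq_zero_iff).1 h0
    set θ := (1 / laplaceConstant ξ P₀) ^ (1 / α) with hθ
    have hθ0 : 0 ≤ θ := by positivity
    have h2 := hξ.lintegral_exp_killedEnd hα hθ0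
    rw [hθ, ← Real.rpow_mul (by positivity), one_div_mul_cancel hα.ne', Real.rpow_one,
      mul_one_div_cancel hC.ne', lintegral_exp_mul_expMeasure_of_ge one_pos le_rfl] at h2
    have h3 : ∫⁻ q, ENNReal.ofReal (Real.exp (θ * killedEnd ξ q)) ∂Q ≤ 1 := by
      calc _ ≤ ∫⁻ q : Ω₀ × ℝ≥0, 1 ∂Q := by
            refine lintegral_mono_ae ?_
            filter_upwards [h1, hξ.ae_killedEnd_le_killedSup hα] with q hq hq2
            rw [← ENNReal.ofReal_one]
            refine ENNReal.ofReal_le_ofReal (Real.exp_le_one_iff.2 ?_)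
            nlinarith
        _ = 1 := by simp [Q]
    rw [h2] at h3
    simp at h3
  -- Multiplicativity would spread a zero at `1` to every `1/(n+1)`, hence to `0` by continuity from
  -- below.
  have hpos1 : 0 < g 1 := by
    rcases (hg0 1).eq_or_lt with h | h
    · exfalso
      apply hzero
      have h1 : ∀ n : ℕ, g (1 / ((n : ℝ) + 1)) = 0 := fun n => by
        have h2 := hpow (1 / ((n : ℝ) + 1)) n (by positivity)
        rw [Nat.cast_succ, mul_one_div_cancel (by positivity), ← h] at h2
        exact pow_eq_zero_iff (Nat.succ_ne_zero n) |>.1 h2.symm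
      refine (measureReal_eq_zero_iff).2 ?_
      have hU : {q | (0 : ℝ) < killedSup ξ q} =
          ⋃ k : ℕ, {q : Ω₀ × ℝ≥0 | 1 / ((k : ℝ) + 1) < killedSup ξ q} := by
        ext q
        simp only [Set.mem_ofPred_eq, Set.mem_iUnion]
        exact ⟨fun h => exists_nat_one_div_lt h, fun ⟨k, hk⟩ => lt_trans (by positivity) hk⟩
      rw [hU, measure_iUnion_null_iff]
      exact fun k => (measureReal_eq_zero_iff).1 (h1 k)
    · exact h
  have hpos : ∀ a, 0 ≤ a → 0 < g a := fun a ha => by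
    obtain ⟨n, hn⟩ := exists_nat_ge a
    refine lt_of_lt_of_le ?_ (hanti (hn.trans (Nat.cast_le.2 n.le_succ)))
    have := hpow 1 n zero_le_one
    rw [mul_one] at this
    rw [this]
    positivity
  -- Otherwise `g` would equal one at every integer, and the supremum would be infinite almost
  -- surely.
  have hlt1 : g 1 < 1 := by
    by_contra h
    have h1 : ∀ n : ℕ, 1 ≤ g n := fun n => by
      refine le_trans ?_ (hanti (Nat.cast_le.2 n.le_succ))
      have := hpow 1 n zero_le_one
      rw [mul_one] at this
      rw [this]
      exact one_le_pow₀ (not_lt.1 h)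
    have h2 : Tendsto (fun n : ℕ => Q {q | (n : ℝ) < killedSup ξ q}) atTop
        (𝓝 (Q (⋂ n : ℕ, {q | (n : ℝ) < killedSup ξ q}))) := by
      refine tendsto_measure_iInter_atTop (fun n => (measurableSet_lt measurable_const
        hS).nullMeasurableSet) (fun n m hnm q hq => ?_) ⟨0, measure_ne_top _ _⟩
      exact lt_of_le_of_lt (Nat.cast_le (α := ℝ).2 hnm) hq
    have h3 : (⋂ n : ℕ, {q | (n : ℝ) < killedSup ξ q}) = ∅ := by
      ext q
      simp only [Set.mem_iInter, Set.mem_ofPred_eq, Set.mem_empty_iff_false, iff_false, not_forall,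
        not_lt]
      exact exists_nat_ge _
    rw [h3, measure_empty] at h2
    have h4 := (ENNReal.tendsto_toReal ENNReal.zero_ne_top).comp h2
    exact absurd (ge_of_tendsto' h4 h1) (by norm_num)
  refine ⟨-Real.log (g 1), neg_pos.2 (Real.log_neg hpos1 hlt1), ?_⟩
  have hr := neg_pos.2 (Real.log_neg hpos1 hlt1)
  have := isProbabilityMeasure_expMeasure hr
  have : IsProbabilityMeasure (Q.map (killedSup ξ)) :=
    Measure.isProbabilityMeasure_map hS.aemeasurable
  have hIoi : ∀ a, 0 ≤ a → Q.map (killedSup ξ) (Set.Ioi a) =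
      expMeasure (-Real.log (g 1)) (Set.Ioi a) := fun a ha => by
    rw [Measure.map_apply hS measurableSet_Ioi, expMeasure_Ioi hr ha, neg_mul, neg_neg,
      ← eq_exp_of_antitone_of_mul hpos (fun _ _ _ h => hanti h) hmul ha, ofReal_measureReal]
    rfl
  refine ext_of_generate_finite (Set.range Set.Ioi) ?_ isPiSystem_Ioi ?_ (by simp)
  · rw [BorelSpace.measurable_eq (α := ℝ), borel_eq_generateFrom_Ioi]
  · rintro _ ⟨a, rfl⟩
    rcases lt_or_ge a 0 with ha | ha
    · trans 1
      · rw [Measure.map_apply hS measurableSet_Ioi, show killedSup ξ ⁻¹' Set.Ioi a = Set.univ from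
          Set.eq_univ_of_forall fun q => lt_of_lt_of_le ha (pathSup_nonneg _ _), measure_univ]
      · symm
        rw [← mem_ae_iff_prob_eq_one measurableSet_Ioi]
        filter_upwards [ae_pos_expMeasure] with x hx
        exact ha.trans hx
    · exact hIoi a ha

/-- The joint law of the supremum before an exponential time and the value at that time. -/
theorem IsStrictlyStableProcess.exists_map_killedSup_killedEnd
    (hξ : IsStrictlyStableProcess α 0 cNeg η ξ P₀) (hα : 0 < α)
    (hC : 0 < laplaceConstant ξ P₀) {ρ : ℝ} (hρ : ρ = (1 / laplaceConstant ξ P₀) ^ (1 / α)) :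
    ∃ ν : Measure ℝ, IsProbabilityMeasure ν ∧ (∀ᵐ d ∂ν, 0 ≤ d) ∧
      (P₀.prod lifeLaw).map (fun q => (killedSup ξ q, killedEnd ξ q)) =
        ((expMeasure ρ).prod ν).map (fun s => (s.1, s.1 - s.2)) ∧
      ∀ θ, 0 ≤ θ → θ < ρ → ρ * (1 - laplaceConstant ξ P₀ * θ ^ α) *
        ∫ d, Real.exp (-θ * d) ∂ν = ρ - θ := by
  have hS := hξ.levy.measurable_killedSup
  have hY := hξ.levy.measurable_killedEnd
  have hD : Measurable fun q => killedSup ξ q - killedEnd ξ q := hS.sub hY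
  obtain ⟨r, hr, hlaw⟩ := hξ.exists_map_killedSup hα hC
  set C := laplaceConstant ξ P₀ with hCdef
  have hES : ∀ θ : ℝ, ∫⁻ q, ENNReal.ofReal (Real.exp (θ * killedSup ξ q)) ∂(P₀.prod lifeLaw) =
      ∫⁻ x, ENNReal.ofReal (Real.exp (θ * x)) ∂(expMeasure r) := fun θ => by
    rw [← hlaw, lintegral_map (by fun_prop) hS]
  have hprod : ∀ θ : ℝ, 0 ≤ θ → _ := fun θ hθ => (hξ.lintegral_exp_killedEnd hα hθ).symm.trans
    ((hξ.lintegral_exp_killedEnd_eq_mul θ).trans (by rw [hES]))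
  -- In the factorization the factor from `D` lies in `(0, 1]`, so the other two integrals are
  -- finite for the same `θ`: the endpoint requires `C θ^α < 1`, the supremum requires `θ < r`.
  -- Comparing thresholds gives `r = ρ`.
  have hiff : ∀ θ : ℝ, 0 ≤ θ → (θ < r ↔ C * θ ^ α < 1) := by
    intro θ hθ
    have h := hprod θ hθ
    constructor
    · intro h1
      by_contra h2
      rw [lintegral_exp_mul_expMeasure_of_ge one_pos (not_lt.1 h2),
        lintegral_exp_mul_expMeasure_of_lt hr h1] at h
      exact (ENNReal.mul_lt_top ENNReal.ofReal_lt_top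
        ((hξ.lintegral_exp_neg_le_one hα hθ).trans_lt ENNReal.one_lt_top)).ne h.symm
    · intro h1
      by_contra h2
      rw [lintegral_exp_mul_expMeasure_of_ge hr (not_lt.1 h2),
        lintegral_exp_mul_expMeasure_of_lt one_pos h1,
        ENNReal.top_mul (hξ.lintegral_exp_neg_ne_zero θ)] at h
      exact ENNReal.ofReal_ne_top h
  have hρ0 : 0 < ρ := by rw [hρ]; positivity
  have hρα : C * ρ ^ α = 1 := by
    rw [hρ, ← Real.rpow_mul (by positivity), one_div_mul_cancel hα.ne', Real.rpow_one,
      mul_one_div_cancel hC.ne']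
  have hrρ : r = ρ := by
    refine le_antisymm (not_lt.1 fun h => ?_) (not_lt.1 fun h => ?_)
    · exact ((hiff ρ hρ0.le).1 h).ne hρα
    · refine lt_irrefl r ((hiff r hr.le).2 ?_)
      rw [← hρα]
      gcongr
  subst hrρ
  have : IsProbabilityMeasure ((P₀.prod lifeLaw).map fun q => killedSup ξ q - killedEnd ξ q) :=
    Measure.isProbabilityMeasure_map hD.aemeasurable
  refine ⟨(P₀.prod lifeLaw).map fun q => killedSup ξ q - killedEnd ξ q, this, ?_, ?_, ?_⟩
  · rw [ae_map_iff hD.aemeasurable measurableSet_Ici]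
    filter_upwards [hξ.ae_killedEnd_le_killedSup hα] with q hq
    exact sub_nonneg.2 hq
  · rw [← hlaw, ← (indepFun_iff_map_prod_eq_prod_map_map hS.aemeasurable hD.aemeasurable).1
      hξ.levy.indepFun_killedSup, Measure.map_map (by fun_prop) (hS.prodMk hD)]
    congr 1
    ext q <;> simp
  · intro θ hθ hθr
    have h := hprod θ hθ
    have h1 := (hiff θ hθ).1 hθr
    rw [lintegral_exp_mul_expMeasure_of_lt hr hθr,
      lintegral_exp_mul_expMeasure_of_lt one_pos h1] at h
    rw [integral_map hD.aemeasurable (by fun_prop),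
      integral_eq_lintegral_of_nonneg_ae (ae_of_all _ fun _ => (Real.exp_pos _).le)
        (by fun_prop)]
    have h2 := congrArg ENNReal.toReal h
    rw [ENNReal.toReal_mul, ENNReal.toReal_ofReal (by
      have : 0 < 1 - C * θ ^ α := by linarith
      positivity), ENNReal.toReal_ofReal (by
      have : 0 < r - θ := by linarith
      positivity)] at h2
    have h3 : 1 - C * θ ^ α ≠ 0 := by linarith
    have h4 : r - θ ≠ 0 := by linarith
    rw [div_eq_iff h3] at h2
    generalize (∫⁻ q, ENNReal.ofReal (Real.exp (-θ * (killedSup ξ q - killedEnd ξ q)))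
      ∂(P₀.prod lifeLaw)).toReal = L at h2 ⊢
    field_simp at h2
    linarith

end LawAtExponentialTime

/-! ### Independent marks on the labels and the branching property. -/

section TreeLaw

variable {X : Type*} [MeasurableSpace X] (m : Measure X) [IsProbabilityMeasure m]

/-- The law of a family of independent marks with law `m` attached to the labels. -/
noncomputable def treeLaw : Measure (Label → X) := Measure.infinitePi fun _ => m

instance : IsProbabilityMeasure (treeLaw m) := by unfold treeLaw; infer_instance

/-- The marks of the descendants of the `i`-th child of the ancestor. -/
def subtree (r : Label → X) (i : ℕ) : Label → X := fun u => r (u ++ [i])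

lemma measurable_subtree (i : ℕ) : Measurable fun r : Label → X => subtree r i :=
  measurable_pi_lambda _ fun u => measurable_pi_apply (u ++ [i])

lemma iIndepFun_treeLaw : iIndepFun (fun u (r : Label → X) => r u) (treeLaw m) := by
  have := iIndepFun_infinitePi (P := fun _ : Label => m) (X := fun _ => (id : X → X))
    (fun _ => measurable_id)
  exact this

/-- Labels carry the most recent birth index first, so the child of the ancestor from which a
particle descends is the last entry. Injectivity makes the marks of different subtrees come from
disjoint labels. -/
lemma append_singleton_injective : Function.Injective fun q : ℕ × Label => q.2 ++ [q.1] := by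
  rintro ⟨i, u⟩ ⟨j, v⟩ h
  have := List.append_inj' h rfl
  simp_all

lemma map_subtree_treeLaw :
    (treeLaw m).map subtree = Measure.infinitePi fun _ : ℕ => treeLaw m := by
  have h1 : iIndepFun (fun (q : ℕ × Label) (r : Label → X) => r (q.2 ++ [q.1])) (treeLaw m) :=
    (iIndepFun_treeLaw m).precomp append_singleton_injective
  have h2 := h1.map_fun_eq_infinitePi_map (fun q => measurable_pi_apply _)
  have h3 : ∀ q : ℕ × Label, (treeLaw m).map (fun r => r (q.2 ++ [q.1])) = m := fun q =>
    Measure.infinitePi_map_eval (fun _ => m) (q.2 ++ [q.1])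
  simp_rw [h3] at h2
  have h4 := Measure.infinitePi_map_curry (ι := ℕ) (κ := Label) (fun _ _ => m)
  rw [← h2, Measure.map_map (by fun_prop) (by fun_prop)] at h4
  exact h4

lemma indepFun_subtree : IndepFun (fun r : Label → X => r []) subtree (treeLaw m) := by
  have h1 : IndepFun (fun r : Label → X => r []) (fun r (q : ℕ × Label) => r (q.2 ++ [q.1]))
      (treeLaw m) := by
    refine IndepFun.indepFun_process (by fun_prop) (fun q => measurable_pi_apply _) fun J => ?_
    have h := (iIndepFun_treeLaw m).indepFun_finset {[]}
      (J.map ⟨_, append_singleton_injective⟩) ?_ (fun i => by fun_prop)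
    · have hφ : Measurable fun y : ({[]} : Finset Label) → X =>
          y ⟨[], Finset.mem_singleton_self _⟩ := measurable_pi_apply _
      exact h.comp (φ := fun y => y ⟨[], Finset.mem_singleton_self _⟩)
        (ψ := fun (y : J.map ⟨_, append_singleton_injective⟩ → X) (j : J) =>
          y ⟨(j : ℕ × Label).2 ++ [(j : ℕ × Label).1], Finset.mem_map.2 ⟨j, j.2, rfl⟩⟩)
        hφ (by fun_prop)
    · rw [Finset.disjoint_singleton_left, Finset.mem_map]
      rintro ⟨q, -, hq⟩
      simp at hq
  exact h1.comp (ψ := fun (y : ℕ × Label → X) i u => y (i, u)) measurable_id (by fun_prop)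

lemma measurable_subtrees : Measurable (subtree : (Label → X) → ℕ → Label → X) :=
  measurable_pi_lambda _ measurable_subtree

/-- The branching property. -/
lemma map_prodMk_subtree_treeLaw :
    (treeLaw m).map (fun r => (r [], subtree r)) =
      m.prod (Measure.infinitePi fun _ : ℕ => treeLaw m) := by
  rw [(indepFun_iff_map_prod_eq_prod_map_map (measurable_pi_apply _).aemeasurable
    measurable_subtrees.aemeasurable).1 (indepFun_subtree m), map_subtree_treeLaw]
  congr 1
  exact Measure.infinitePi_map_eval (fun _ => m) []

end TreeLaw

/-! ### Exceedance of a level within finitely many generations. -/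

section TreeExceedance

/-- Some particle of generation less than `n` exceeds `x`: the mark of a particle consists of its
maximal displacement, its displacement at death and its number of children. -/
def TreeExceeds : ℕ → ℝ → (Label → (ℝ × ℝ) × ℕ) → Prop
  | 0, _, _ => False
  | n + 1, x, r => x < (r []).1.1 ∨ ∃ i < (r []).2, TreeExceeds n (x - (r []).1.2) (subtree r i)

lemma TreeExceeds.anti {n : ℕ} {x y : ℝ} (hxy : x ≤ y) {r : Label → (ℝ × ℝ) × ℕ}
    (h : TreeExceeds n y r) : TreeExceeds n x r := by
  induction n generalizing x y r with
  | zero => exact h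
  | succ n ih =>
    rcases h with h | ⟨i, hi, h⟩
    · exact Or.inl (hxy.trans_lt h)
    · exact Or.inr ⟨i, hi, ih (by linarith) h⟩

lemma TreeExceeds.succ {n : ℕ} {x : ℝ} {r : Label → (ℝ × ℝ) × ℕ}
    (h : TreeExceeds n x r) : TreeExceeds (n + 1) x r := by
  induction n generalizing x r with
  | zero => exact h.elim
  | succ n ih =>
    rcases h with h | ⟨i, hi, h⟩
    · exact Or.inl h
    · exact Or.inr ⟨i, hi, ih h⟩

lemma measurableSet_treeExceeds (n : ℕ) :
    MeasurableSet {q : ℝ × (Label → (ℝ × ℝ) × ℕ) | TreeExceeds n q.1 q.2} := by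
  induction n with
  | zero => exact MeasurableSet.empty
  | succ n ih =>
    have h : {q : ℝ × (Label → (ℝ × ℝ) × ℕ) | TreeExceeds (n + 1) q.1 q.2} =
        {q | q.1 < (q.2 []).1.1} ∪ ⋃ i : ℕ, ({q | i < (q.2 []).2} ∩
          (fun q => (q.1 - (q.2 []).1.2, subtree q.2 i)) ⁻¹'
            {q | TreeExceeds n q.1 q.2}) := by
      ext q
      simp [TreeExceeds]
    rw [h]
    refine (measurableSet_lt (by fun_prop) (by fun_prop)).union (MeasurableSet.iUnion fun i =>
      (measurableSet_lt (by fun_prop) (by fun_prop)).inter (Measurable.prodMk ?_ ?_ ih))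
    · fun_prop
    · exact (measurable_subtree i).comp measurable_snd

lemma measurableSet_treeExceeds_right (n : ℕ) (x : ℝ) :
    MeasurableSet {r : Label → (ℝ × ℝ) × ℕ | TreeExceeds n x r} :=
  (measurable_prodMk_left (x := x)) (measurableSet_treeExceeds n)

variable (m : Measure ((ℝ × ℝ) × ℕ))

/-- The probability that some particle of generation less than `n` exceeds `x`. -/
noncomputable def treeTail (n : ℕ) (x : ℝ) : ℝ := (treeLaw m).real {r | TreeExceeds n x r}

lemma treeTail_zero (x : ℝ) : treeTail m 0 x = 0 := by simp [treeTail, TreeExceeds]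

lemma treeTail_nonneg (n : ℕ) (x : ℝ) : 0 ≤ treeTail m n x := measureReal_nonneg

variable [IsProbabilityMeasure m]

/-- Given the ancestor's mark, the level is respected when its own path stays below it and each
child's subtree stays below the level lowered by the place of death. The subtrees are independent
copies, whence the power. -/
lemma treeLaw_not_treeExceeds_succ (n : ℕ) (x : ℝ) :
    treeLaw m {r | ¬ TreeExceeds (n + 1) x r} =
      ∫⁻ a, (if a.1.1 ≤ x then (treeLaw m {r | ¬ TreeExceeds n (x - a.1.2) r}) ^ a.2
        else 0) ∂m := by
  have hset : MeasurableSet {q : ((ℝ × ℝ) × ℕ) × (ℕ → Label → (ℝ × ℝ) × ℕ) |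
      q.1.1.1 ≤ x ∧ ∀ i < q.1.2, ¬ TreeExceeds n (x - q.1.1.2) (q.2 i)} := by
    have h : {q : ((ℝ × ℝ) × ℕ) × (ℕ → Label → (ℝ × ℝ) × ℕ) |
        q.1.1.1 ≤ x ∧ ∀ i < q.1.2, ¬ TreeExceeds n (x - q.1.1.2) (q.2 i)} =
        {q | q.1.1.1 ≤ x} ∩ ⋂ i : ℕ, ({q | i < q.1.2} ∩
          (fun q => (x - q.1.1.2, q.2 i)) ⁻¹' {q | TreeExceeds n q.1 q.2})ᶜ := by
      ext q
      simp
    rw [h]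
    exact (measurableSet_le (by fun_prop) (by fun_prop)).inter (MeasurableSet.iInter fun i =>
      ((measurableSet_lt (by fun_prop) (by fun_prop)).inter
        (Measurable.prodMk (by fun_prop) (by fun_prop) (measurableSet_treeExceeds n))).compl)
  have h1 : {r : Label → (ℝ × ℝ) × ℕ | ¬ TreeExceeds (n + 1) x r} =
      (fun r => (r [], subtree r)) ⁻¹' {q | q.1.1.1 ≤ x ∧
        ∀ i < q.1.2, ¬ TreeExceeds n (x - q.1.1.2) (q.2 i)} := by
    ext r
    simp [TreeExceeds]
  rw [h1, ← Measure.map_apply (Measurable.prodMk (by fun_prop) measurable_subtrees) hset,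
    map_prodMk_subtree_treeLaw, Measure.prod_apply hset]
  refine lintegral_congr fun a => ?_
  split_ifs with ha
  · have h2 : Prod.mk a ⁻¹' {q : ((ℝ × ℝ) × ℕ) × (ℕ → Label → (ℝ × ℝ) × ℕ) |
        q.1.1.1 ≤ x ∧ ∀ i < q.1.2, ¬ TreeExceeds n (x - q.1.1.2) (q.2 i)} =
        Set.pi (Finset.range a.2) fun _ => {r | ¬ TreeExceeds n (x - a.1.2) r} := by
      ext f
      simp [ha, Set.mem_pi]
    have h3 := (measurableSet_treeExceeds_right n (x - a.1.2)).compl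
    rw [h2, Measure.infinitePi_pi _ fun _ _ => by exact h3]
    simp
  · have h2 : Prod.mk a ⁻¹' {q : ((ℝ × ℝ) × ℕ) × (ℕ → Label → (ℝ × ℝ) × ℕ) |
        q.1.1.1 ≤ x ∧ ∀ i < q.1.2, ¬ TreeExceeds n (x - q.1.1.2) (q.2 i)} = ∅ := by
      ext f
      simp [ha]
    rw [h2, measure_empty]

lemma treeTail_le_one (n : ℕ) (x : ℝ) : treeTail m n x ≤ 1 := measureReal_le_one

lemma antitone_treeTail (n : ℕ) : Antitone (treeTail m n) := fun _ _ hxy =>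
  measureReal_mono fun _ h => TreeExceeds.anti hxy h

lemma monotone_treeTail (x : ℝ) : Monotone fun n => treeTail m n x :=
  monotone_nat_of_le_succ fun _ => measureReal_mono fun _ h => TreeExceeds.succ h

lemma treeLaw_not_treeExceeds (n : ℕ) (x : ℝ) :
    treeLaw m {r | ¬ TreeExceeds n x r} = ENNReal.ofReal (1 - treeTail m n x) := by
  rw [treeTail, ← probReal_compl_eq_one_sub (measurableSet_treeExceeds_right n x),
    ofReal_measureReal]
  rfl

end TreeExceedance

/-! ### The integral equation for the exceedance probabilities. -/

section TreeRenewal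

lemma PMF.summable_toReal_mul_pow (p : PMF ℕ) {w : ℝ} (h0 : 0 ≤ w) (h1 : w ≤ 1) :
    Summable fun k => (p k).toReal * w ^ k :=
  Summable.of_nonneg_of_le (fun k => by positivity)
    (fun k => mul_le_of_le_one_right ENNReal.toReal_nonneg (pow_le_one₀ h0 h1)) p.summable_toReal

lemma one_sub_survivalFunction (p : PMF ℕ) {v : ℝ} (h0 : 0 ≤ v) (h1 : v ≤ 1) :
    1 - survivalFunction p v = ∑' k, (p k).toReal * (1 - v) ^ k := by
  have h2 := summable_survivalFunction p h0 h1
  have h3 := p.summable_toReal.tsum_sub h2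
  rw [p.tsum_toReal] at h3
  rw [survivalFunction, ← h3]
  exact tsum_congr fun k => by ring

lemma lintegral_pow_toMeasure (p : PMF ℕ) {v : ℝ} (h0 : 0 ≤ v) (h1 : v ≤ 1) :
    ∫⁻ k, ENNReal.ofReal (1 - v) ^ k ∂p.toMeasure = ENNReal.ofReal (1 - survivalFunction p v) := by
  have hv : 0 ≤ 1 - v := sub_nonneg.2 h1
  rw [one_sub_survivalFunction p h0 h1, ENNReal.ofReal_tsum_of_nonneg (fun k => by positivity)
    (p.summable_toReal_mul_pow hv (by linarith)), lintegral_countable']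
  refine tsum_congr fun k => ?_
  rw [ENNReal.ofReal_mul ENNReal.toReal_nonneg, ENNReal.ofReal_toReal (p.apply_ne_top k),
    ENNReal.ofReal_pow hv, p.toMeasure_apply_singleton k (measurableSet_singleton k), mul_comm]

lemma setLIntegral_expMeasure {r : ℝ} {x : ℝ} {f : ℝ → ℝ≥0∞} (hf : Measurable f) :
    ∫⁻ s, (if s ≤ x then f s else 0) ∂(expMeasure r) =
      ∫⁻ s in Set.Ioc 0 x, ENNReal.ofReal (r * Real.exp (-(r * s))) * f s := by
  rw [lintegral_expMeasure _ _ (Measurable.ite measurableSet_Iic hf measurable_const),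
    ← lintegral_indicator measurableSet_Ioc]
  refine lintegral_congr_ae ?_
  filter_upwards [Measure.ae_ne volume (0 : ℝ)] with s hs
  rcases hs.lt_or_gt with hs | hs
  · rw [exponentialPDF_of_neg hs, zero_mul, Set.indicator_of_notMem fun h => hs.not_gt h.1]
  · rw [exponentialPDF_of_nonneg hs.le, Set.indicator_apply]
    by_cases h : s ≤ x
    · rw [if_pos h, if_pos ⟨hs, h⟩]
    · rw [if_neg h, if_neg fun h2 => h h2.2, mul_zero]

variable {κ : Measure (ℝ × ℝ)} [IsProbabilityMeasure κ] {ν : Measure ℝ} [IsProbabilityMeasure ν]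
  {ρ : ℝ} {p : PMF ℕ}

lemma ofReal_one_sub_treeTail_succ (n : ℕ) (x : ℝ) :
    ENNReal.ofReal (1 - treeTail (κ.prod p.toMeasure) (n + 1) x) =
      ∫⁻ z, (if z.1 ≤ x then
        ENNReal.ofReal (1 - survivalFunction p (treeTail (κ.prod p.toMeasure) n (x - z.2)))
        else 0) ∂κ := by
  have hanti := antitone_treeTail (κ.prod p.toMeasure) n
  have hmeas : Measurable fun a : (ℝ × ℝ) × ℕ => if a.1.1 ≤ x then
      ENNReal.ofReal (1 - treeTail (κ.prod p.toMeasure) n (x - a.1.2)) ^ a.2 else 0 := by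
    have := hanti.measurable
    refine Measurable.ite (measurableSet_le (by fun_prop) (by fun_prop)) ?_ measurable_const
    fun_prop
  rw [← treeLaw_not_treeExceeds, treeLaw_not_treeExceeds_succ]
  simp_rw [treeLaw_not_treeExceeds]
  rw [lintegral_prod _ hmeas.aemeasurable]
  refine lintegral_congr fun z => ?_
  simp only
  split_ifs
  · exact lintegral_pow_toMeasure p (treeTail_nonneg _ _ _) (treeTail_le_one _ _ _)
  · simp

/-- The exceedance probabilities of the branching process are the iterates of a renewal
equation. -/
theorem isRenewalIteration_treeTail (hρ : 0 < ρ) (hm : offspringMean p < 1)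
    (hκ : κ = ((expMeasure ρ).prod ν).map fun s => (s.1, s.1 - s.2)) :
    IsRenewalIteration ρ (survivalFunction p) ν (treeTail (κ.prod p.toMeasure)) where
  zero x _ := treeTail_zero _ x
  nonneg := treeTail_nonneg _
  le_one := treeTail_le_one _
  anti := antitone_treeTail _
  succ n x hx := by
    have hF := isSurvivalFunction_survivalFunction hm
    set u := treeTail (κ.prod p.toMeasure) with hu
    have hu0 : ∀ y, u n y ∈ Set.Icc (0 : ℝ) 1 := fun y =>
      ⟨treeTail_nonneg _ _ _, treeTail_le_one _ _ _⟩
    have hFu : ∀ y, survivalFunction p (u n y) ∈ Set.Icc (0 : ℝ) 1 := fun y =>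
      ⟨hF.nonneg (hu0 y).1 (hu0 y).2, (hF.le_mul (hu0 y).1 (hu0 y).2).trans
        (mul_le_one₀ (toReal_offspringMean_lt_one hm).le (hu0 y).1 (hu0 y).2)⟩
    have hanti : Antitone fun y => survivalFunction p (u n y) := fun y z hyz =>
      hF.monotoneOn (hu0 z) (hu0 y) (antitone_treeTail _ n hyz)
    have hint : ∀ y, Integrable (fun d => survivalFunction p (u n (y + d))) ν := fun y =>
      Integrable.of_bound (hanti.measurable.comp (measurable_const_add y)).aestronglyMeasurable 1
        (ae_of_all _ fun d => by
          rw [Real.norm_of_nonneg (hFu _).1]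
          exact (hFu _).2)
    set q : ℝ → ℝ := fun r => ∫ d, survivalFunction p (u n (r + d)) ∂ν with hq
    have hqanti : Antitone q := fun y z hyz =>
      integral_mono (hint z) (hint y) fun d => hanti (by linarith)
    have hq1 : ∀ y, q y ≤ 1 := fun y => by
      calc q y ≤ ∫ _, (1 : ℝ) ∂ν :=
            integral_mono (hint y) (integrable_const 1) fun d => (hFu _).2
        _ = 1 := by simp
    have hinner : ∀ y, ∫⁻ d, ENNReal.ofReal (1 - survivalFunction p (u n (y + d))) ∂ν =
        ENNReal.ofReal (1 - q y) := fun y => by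
      have hi : Integrable (fun d => 1 - survivalFunction p (u n (y + d))) ν :=
        (integrable_const 1).sub (hint y)
      rw [← ofReal_integral_eq_lintegral_ofReal hi
        (ae_of_all _ fun d => sub_nonneg.2 (hFu _).2),
        integral_sub (integrable_const 1) (hint y)]
      simp [hq]
    have hFm := hanti.measurable
    have hqm := hqanti.measurable
    -- With `S = s` and `Y = s - D`, the level left to the children is `x - s + D`. Integrating over
    -- `D` gives `q (x - s)`, and `s` carries the exponential density.
    have h1 : ENNReal.ofReal (1 - u (n + 1) x) = ∫⁻ s in Set.Ioc 0 x,
        ENNReal.ofReal (ρ * Real.exp (-(ρ * s)) * (1 - q (x - s))) := by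
      have hmeas : Measurable fun z : ℝ × ℝ => if z.1 ≤ x then
          ENNReal.ofReal (1 - survivalFunction p (u n (x - z.2))) else 0 := by
        refine Measurable.ite (measurableSet_le (by fun_prop) (by fun_prop)) ?_ measurable_const
        have : Measurable fun z : ℝ × ℝ => survivalFunction p (u n (x - z.2)) :=
          hFm.comp (by fun_prop)
        fun_prop
      have hshift : Measurable fun s : ℝ × ℝ => (s.1, s.1 - s.2) := by fun_prop
      have hmeas2 : Measurable fun s : ℝ × ℝ => if s.1 ≤ x then
          ENNReal.ofReal (1 - survivalFunction p (u n (x - (s.1 - s.2)))) else 0 :=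
        hmeas.comp hshift
      have : IsProbabilityMeasure (expMeasure ρ) := isProbabilityMeasure_expMeasure hρ
      rw [hu, ofReal_one_sub_treeTail_succ, ← hu, hκ, lintegral_map hmeas hshift,
        lintegral_prod _ hmeas2.aemeasurable]
      have h2 : ∀ s : ℝ, ∫⁻ d, (if s ≤ x then
          ENNReal.ofReal (1 - survivalFunction p (u n (x - (s - d)))) else 0) ∂ν =
          if s ≤ x then ENNReal.ofReal (1 - q (x - s)) else 0 := fun s => by
        split_ifs
        · rw [← hinner]
          refine lintegral_congr fun d => ?_
          rw [show x - (s - d) = x - s + d by ring]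
        · simp
      simp_rw [h2]
      rw [setLIntegral_expMeasure (f := fun s => ENNReal.ofReal (1 - q (x - s)))
        (by fun_prop)]
      refine lintegral_congr fun s => ?_
      rw [← ENNReal.ofReal_mul (by positivity)]
    have hexp : ∀ c : ℝ, IntervalIntegrable (fun s => ρ * Real.exp (c * s)) volume 0 x :=
      fun c => Continuous.intervalIntegrable (by fun_prop) _ _
    have hqint' : IntervalIntegrable (fun s => ρ * Real.exp (-ρ * s) * q (x - s)) volume 0 x := by
      refine (Monotone.intervalIntegrable (u := fun s => q (x - s)) (μ := volume)
        fun y z hyz => hqanti (by linarith)).continuousOn_mul ?_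
      fun_prop
    have h2 : 1 - u (n + 1) x = ∫ s in 0..x, ρ * Real.exp (-ρ * s) * (1 - q (x - s)) := by
      have hi : IntervalIntegrable (fun s => ρ * Real.exp (-ρ * s) * (1 - q (x - s))) volume 0 x :=
        ((hexp (-ρ)).sub hqint').congr fun s _ => by ring
      have hnn : ∀ s, 0 ≤ ρ * Real.exp (-ρ * s) * (1 - q (x - s)) := fun s =>
        mul_nonneg (by positivity) (sub_nonneg.2 (hq1 _))
      rw [intervalIntegral.integral_of_le hx,
        ← ENNReal.ofReal_eq_ofReal_iff (sub_nonneg.2 (treeTail_le_one _ _ _))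
          (setIntegral_nonneg measurableSet_Ioc fun s _ => hnn s),
        ofReal_integral_eq_lintegral_ofReal
          ((intervalIntegrable_iff_integrableOn_Ioc_of_le hx).1 hi)
          (ae_of_all _ hnn), h1]
      simp_rw [neg_mul]
    have h3 : ∫ s in 0..x, ρ * Real.exp (-ρ * s) * (1 - q (x - s)) =
        (1 - Real.exp (-ρ * x)) - ∫ s in 0..x, ρ * Real.exp (-ρ * s) * q (x - s) := by
      have h4 : ∫ s in 0..x, ρ * Real.exp (-ρ * s) = 1 - Real.exp (-ρ * x) := by
        have h5 := integral_mul_exp_mul (c := -ρ) 0 x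
        simp only [mul_zero, Real.exp_zero] at h5
        have h6 : ∫ s in 0..x, ρ * Real.exp (-ρ * s) = -∫ s in 0..x, -ρ * Real.exp (-ρ * s) := by
          rw [← intervalIntegral.integral_neg]
          exact intervalIntegral.integral_congr fun s _ => by ring
        rw [h6, h5]
        ring
      rw [← h4, ← intervalIntegral.integral_sub (hexp _) hqint']
      exact intervalIntegral.integral_congr fun s _ => by ring
    -- The substitution `r = x - s` pulls out `e^(-ρx)` and leaves an integrand that does not depend
    -- on `x`.
    have h4 : ∫ s in 0..x, ρ * Real.exp (-ρ * s) * q (x - s) =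
        Real.exp (-ρ * x) * ∫ r in 0..x, ρ * Real.exp (ρ * r) * q r := by
      have h5 := intervalIntegral.integral_comp_sub_left (a := 0) (b := x)
        (fun r => ρ * Real.exp (-ρ * (x - r)) * q r) x
      simp only [sub_sub_cancel, sub_self, sub_zero] at h5
      rw [h5, ← intervalIntegral.integral_const_mul]
      refine intervalIntegral.integral_congr fun r _ => ?_
      rw [show -ρ * (x - r) = -ρ * x + ρ * r by ring, Real.exp_add]
      ring
    have h5 : Real.exp (ρ * x) * Real.exp (-ρ * x) = 1 := by
      rw [← Real.exp_add]
      simp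
    have h6 : u (n + 1) x = Real.exp (-ρ * x) *
        (1 + ∫ r in 0..x, ρ * Real.exp (ρ * r) * q r) := by
      rw [h3, h4] at h2
      linarith
    rw [h6, ← mul_assoc, h5, one_mul]

end TreeRenewal

/-! ### Comparison of recursion at the ancestor with recursion along a line of descent. -/

section Genealogy

/-- The particle `u` is born, in terms of the marks. -/
def MarkBorn (r : Label → (ℝ × ℝ) × ℕ) : Label → Prop
  | [] => True
  | i :: u => MarkBorn r u ∧ i < (r u).2

/-- The birth place of the particle `u`, in terms of the marks. -/
def markPlace (r : Label → (ℝ × ℝ) × ℕ) : Label → ℝ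
  | [] => 0
  | _ :: u => markPlace r u + (r u).1.2

lemma markBorn_append (r : Label → (ℝ × ℝ) × ℕ) (u : Label) (i : ℕ) :
    MarkBorn r (u ++ [i]) ↔ i < (r []).2 ∧ MarkBorn (subtree r i) u := by
  induction u with
  | nil => simp [MarkBorn]
  | cons j u ih =>
    rw [List.cons_append, MarkBorn, MarkBorn, ih, and_assoc]
    rfl

lemma markPlace_append (r : Label → (ℝ × ℝ) × ℕ) (u : Label) (i : ℕ) :
    markPlace r (u ++ [i]) = (r []).1.2 + markPlace (subtree r i) u := by
  induction u with
  | nil => simp [markPlace]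
  | cons j u ih =>
    rw [List.cons_append, markPlace, markPlace, ih, add_assoc]
    rfl

/-- Exceedance recurses from the root, whereas births and birth places recurse from the particle
back to its parent. Splitting off the last entry of the label reconciles the two. -/
lemma treeExceeds_iff {n : ℕ} {x : ℝ} {r : Label → (ℝ × ℝ) × ℕ} :
    TreeExceeds n x r ↔
      ∃ u : Label, u.length < n ∧ MarkBorn r u ∧ x < markPlace r u + (r u).1.1 := by
  induction n generalizing x r with
  | zero => simp [TreeExceeds]
  | succ n ih =>
    simp only [TreeExceeds, ih]
    constructor
    · rintro (h | ⟨i, hi, u, hu, hb, h⟩)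
      · exact ⟨[], Nat.succ_pos n, trivial, by simpa [markPlace] using h⟩
      · refine ⟨u ++ [i], by simpa using hu, (markBorn_append r u i).2 ⟨hi, hb⟩, ?_⟩
        rw [markPlace_append]
        change _ < _ + (subtree r i u).1.1
        linarith
    · rintro ⟨u, hu, hb, h⟩
      rcases List.eq_nil_or_concat u with rfl | ⟨v, i, rfl⟩
      · exact Or.inl (by simpa [markPlace] using h)
      · rw [List.concat_eq_append] at hu hb h
        rw [markBorn_append] at hb
        rw [markPlace_append] at h
        refine Or.inr ⟨i, hb.1, v, by simpa using hu, hb.2, ?_⟩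
        change _ < _ + (subtree r i v).1.1 at h
        linarith

end Genealogy

/-! ### The maximal position expressed through the marks. -/

namespace BranchingData

variable {Ω : Type*}

/-- The maximal displacement, the displacement at death and the number of children. -/
noncomputable def mark (Z : BranchingData Ω) (ω : Ω) (u : Label) : (ℝ × ℝ) × ℕ :=
  ((pathSup (fun t => Z.disp u t ω) (Z.life u ω), pathEnd (fun t => Z.disp u t ω) (Z.life u ω)),
    Z.offspring u ω)

lemma markBorn_mark_iff (Z : BranchingData Ω) (ω : Ω) (u : Label) :
    MarkBorn (Z.mark ω) u ↔ Z.Born u ω := by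
  induction u with
  | nil => rfl
  | cons i u ih => exact and_congr ih Iff.rfl

lemma markPlace_mark {Z : BranchingData Ω} {ω : Ω}
    (hcad : ∀ u, IsCadlag (fun t => Z.disp u t ω)) (u : Label) :
    markPlace (Z.mark ω) u = Z.birthPlace u ω := by
  induction u with
  | nil => rfl
  | cons i u ih => rw [markPlace, ih, birthPlace, mark, (hcad u).pathEnd_eq]

/-- The lifetime interval is half-open, matching the supremum before the lifetime. Only times `t >
0` are admitted in the maximum; `x ≥ 0` makes the ancestor's start at `0` irrelevant. -/
lemma lt_maxPosition_iff {Z : BranchingData Ω} {ω : Ω}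
    (hcad : ∀ u, IsCadlag (fun t => Z.disp u t ω)) (hzero : ∀ u, Z.disp u 0 ω = 0)
    (hlife : ∀ u, 0 < Z.life u ω) {x : ℝ} (hx : 0 ≤ x) :
    (x : EReal) < Z.maxPosition ω ↔ ∃ n, TreeExceeds n x (Z.mark ω) := by
  have h1 : (x : EReal) < Z.maxPosition ω ↔
      ∃ t : ℝ≥0, 0 < t ∧ ∃ u, u ∈ Z.alive t ω ∧ x < Z.position u t ω := by
    simp only [maxPosition, lt_iSup_iff, EReal.coe_lt_coe_iff, exists_prop]
  have h2 : (∃ n, TreeExceeds n x (Z.mark ω)) ↔ ∃ u, Z.Born u ω ∧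
      x < Z.birthPlace u ω + pathSup (fun t => Z.disp u t ω) (Z.life u ω) := by
    simp only [treeExceeds_iff, markBorn_mark_iff, markPlace_mark hcad]
    exact ⟨fun ⟨n, u, _, h⟩ => ⟨u, h⟩, fun ⟨u, h⟩ => ⟨u.length + 1, u, Nat.lt_succ_self _, h⟩⟩
  rw [h1, h2]
  constructor
  · rintro ⟨t, -, u, ⟨hb, ht1, ht2⟩, h⟩
    refine ⟨u, hb, ?_⟩
    rw [position] at h
    by_contra h3
    rw [not_lt] at h3
    have h4 : pathSup (fun t => Z.disp u t ω) (Z.life u ω) < Z.disp u (t - Z.birthTime u ω) ω := by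
      linarith
    exact lt_irrefl _ (((hcad u).lt_pathSup_iff (hzero u) (pathSup_nonneg _ _)).2
      ⟨_, (tsub_lt_iff_left ht1).2 ht2, h4⟩)
  · rintro ⟨u, hb, h⟩
    -- The supremum is characterized only at nonnegative levels. A particle born above `x` is
    -- therefore treated apart: it exceeds `x` at its birth, it is alive then because its lifetime
    -- is positive, and it is not the ancestor.
    rcases lt_or_ge x (Z.birthPlace u ω) with h3 | h3
    · refine ⟨Z.birthTime u ω, ?_, u, ⟨hb, le_rfl, lt_add_of_pos_right _ (hlife u)⟩, ?_⟩
      · rcases u with _ | ⟨i, u⟩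
        · exact absurd h3 (not_lt.2 hx)
        · exact add_pos_of_nonneg_of_pos zero_le (hlife u)
      · rw [position, tsub_self, hzero, add_zero]
        exact h3
    · obtain ⟨s, hs, h4⟩ := ((hcad u).lt_pathSup_iff (hzero u) (sub_nonneg.2 h3)).1
        (show x - Z.birthPlace u ω < _ by linarith)
      have hs0 : 0 < s := by
        refine pos_of_ne_zero fun h5 => ?_
        rw [h5, hzero] at h4
        linarith
      refine ⟨Z.birthTime u ω + s, add_pos_of_nonneg_of_pos zero_le hs0, u,
        ⟨hb, le_self_add, add_lt_add_right hs _⟩, ?_⟩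
      rw [position, add_tsub_cancel_left]
      linarith

end BranchingData

/-! ### The law of the marks of a branching Lévy process. -/

section BranchingLaw

variable {Ω₀ : Type*} [MeasurableSpace Ω₀] {P₀ : Measure Ω₀} {ξ : ℝ≥0 → Ω₀ → ℝ} {Ω : Type*}
  [MeasurableSpace Ω] {P : Measure Ω} {Z : BranchingData Ω} {p : PMF ℕ}

/-- The mark of a particle as a function of its displacement, lifetime and offspring number. -/
noncomputable def markOfData (q : (ℝ≥0 → ℝ) × ℝ≥0 × ℕ) : (ℝ × ℝ) × ℕ :=
  ((pathSup q.1 q.2.1, pathEnd q.1 q.2.1), q.2.2)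

lemma measurable_markOfData : Measurable markOfData := by
  have h : Measurable fun q : (ℝ≥0 → ℝ) × ℝ≥0 × ℕ => (q.1, q.2.1) := by fun_prop
  exact ((measurable_pathSup.comp h).prodMk (measurable_pathEnd.comp h)).prodMk
    measurable_snd.snd

lemma IsBranchingLevyProcess.measurable_data (hZ : IsBranchingLevyProcess Z P ξ P₀ p) (u : Label) :
    Measurable fun ω => ((fun t => Z.disp u t ω), Z.life u ω, Z.offspring u ω) :=
  (measurable_pi_lambda _ (hZ.measurable_disp u)).prodMk
    ((hZ.measurable_life u).prodMk (hZ.measurable_offspring u))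

lemma IsBranchingLevyProcess.map_life (hZ : IsBranchingLevyProcess Z P ξ P₀ p) (u : Label) :
    P.map (Z.life u) = lifeLaw := by
  have hm := hZ.measurable_life u
  rw [lifeLaw, ← (hZ.law_life u).map_eq, Measure.map_map (by fun_prop) (by fun_prop)]
  congr 1
  ext ω
  simp

lemma IsBranchingLevyProcess.measurable_mark (hZ : IsBranchingLevyProcess Z P ξ P₀ p) :
    Measurable Z.mark := by
  refine measurable_pi_lambda _ fun u => ?_
  have h := measurable_markOfData.comp (hZ.measurable_data u)
  rw [Function.comp_def] at h
  exact h

lemma IsBranchingLevyProcess.ae_good (hL : IsLevyProcess ξ P₀)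
    (hZ : IsBranchingLevyProcess Z P ξ P₀ p) :
    ∀ᵐ ω ∂P, (∀ u, IsCadlag (fun t => Z.disp u t ω)) ∧ (∀ u, Z.disp u 0 ω = 0) ∧
      ∀ u, 0 < Z.life u ω := by
  refine (ae_all_iff.2 hZ.cadlag_disp).and ((ae_all_iff.2 fun u => ?_).and
    (ae_all_iff.2 fun u => ?_))
  · have h := ((hZ.law_disp u).comp (measurable_pi_apply (0 : ℝ≥0))).symm
    exact h.ae_snd (p := fun y => y = 0) (measurableSet_singleton 0) hL.start_zero
  · have h := ae_pos_lifeLaw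
    rw [← hZ.map_life u] at h
    exact ae_of_ae_map (hZ.measurable_life u).aemeasurable h

variable [IsProbabilityMeasure P₀] [IsProbabilityMeasure P]

/-- The mark is a measurable functional of path, lifetime and offspring number. These are
independent, so only their marginal laws matter, and the path may be replaced by `ξ` on its own
probability space. -/
lemma IsBranchingLevyProcess.map_mark (hL : IsLevyProcess ξ P₀)
    (hZ : IsBranchingLevyProcess Z P ξ P₀ p) (u : Label) :
    P.map (fun ω => Z.mark ω u) =
      ((P₀.prod lifeLaw).map fun q => (killedSup ξ q, killedEnd ξ q)).prod p.toMeasure := by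
  have hdisp : Measurable fun ω t => Z.disp u t ω :=
    measurable_pi_lambda _ (hZ.measurable_disp u)
  have hlife := hZ.measurable_life u
  have hoff := hZ.measurable_offspring u
  have hsup : Measurable fun q : (ℝ≥0 → ℝ) × ℝ≥0 => (pathSup q.1 q.2, pathEnd q.1 q.2) :=
    measurable_pathSup.prodMk measurable_pathEnd
  have h1 : P.map (fun ω => ((fun t => Z.disp u t ω), Z.life u ω, Z.offspring u ω)) =
      (P₀.map fun ω t => ξ t ω).prod (lifeLaw.prod p.toMeasure) := by
    rw [(indepFun_iff_map_prod_eq_prod_map_map hdisp.aemeasurable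
      (hlife.prodMk hoff).aemeasurable).1 (hZ.indep_disp u),
      (indepFun_iff_map_prod_eq_prod_map_map hlife.aemeasurable hoff.aemeasurable).1
      (hZ.indep_life_offspring u), hZ.map_life, (hZ.law_offspring u).map_eq,
      (hZ.law_disp u).map_eq]
  have hprob : IsProbabilityMeasure (P₀.map fun ω t => ξ t ω) :=
    Measure.isProbabilityMeasure_map hL.measurable_path.aemeasurable
  have h2 : (fun ω => Z.mark ω u) = markOfData ∘
      fun ω => ((fun t => Z.disp u t ω), Z.life u ω, Z.offspring u ω) := rfl
  have h3 : markOfData = Prod.map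
      (fun q : (ℝ≥0 → ℝ) × ℝ≥0 => (pathSup q.1 q.2, pathEnd q.1 q.2)) id ∘
      MeasurableEquiv.prodAssoc.symm := rfl
  have h4 : (fun q => (killedSup ξ q, killedEnd ξ q)) =
      (fun q : (ℝ≥0 → ℝ) × ℝ≥0 => (pathSup q.1 q.2, pathEnd q.1 q.2)) ∘
        Prod.map (fun ω t => ξ t ω) id := rfl
  have h5 : (P₀.map fun ω t => ξ t ω).prod lifeLaw =
      (P₀.prod lifeLaw).map (Prod.map (fun ω t => ξ t ω) id) := by
    rw [← Measure.map_prod_map _ _ hL.measurable_path measurable_id, Measure.map_id]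
  rw [h2, ← Measure.map_map measurable_markOfData (hZ.measurable_data u), h1, h3,
    ← Measure.map_map (hsup.prodMap measurable_id) (MeasurableEquiv.measurable _), h4,
    ← Measure.map_map hsup (hL.measurable_path.prodMap measurable_id), ← h5]
  have h6 := (measurePreserving_prodAssoc (P₀.map fun ω t => ξ t ω) lifeLaw p.toMeasure).symm
    MeasurableEquiv.prodAssoc
  rw [h6.map_eq, ← Measure.map_prod_map _ _ hsup measurable_id, Measure.map_id]

lemma IsBranchingLevyProcess.map_mark_eq_treeLaw (hL : IsLevyProcess ξ P₀)
    (hZ : IsBranchingLevyProcess Z P ξ P₀ p) :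
    P.map Z.mark = treeLaw
      (((P₀.prod lifeLaw).map fun q => (killedSup ξ q, killedEnd ξ q)).prod p.toMeasure) := by
  have h1 : iIndepFun (fun u ω => Z.mark ω u) P :=
    hZ.indep.comp (fun _ => markOfData) fun _ => measurable_markOfData
  have h2 : P.map Z.mark = Measure.infinitePi fun u => P.map fun ω => Z.mark ω u :=
    h1.map_fun_eq_infinitePi_map fun u => (measurable_pi_apply u).comp hZ.measurable_mark
  simp_rw [hZ.map_mark hL] at h2
  exact h2

/-- The tail of the maximal position. -/
lemma IsBranchingLevyProcess.measure_lt_maxPosition (hL : IsLevyProcess ξ P₀)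
    (hZ : IsBranchingLevyProcess Z P ξ P₀ p) {x : ℝ} (hx : 0 ≤ x) :
    P.real {ω | (x : EReal) < Z.maxPosition ω} = ⨆ n, treeTail
      (((P₀.prod lifeLaw).map fun q => (killedSup ξ q, killedEnd ξ q)).prod p.toMeasure) n x := by
  set m := ((P₀.prod lifeLaw).map fun q => (killedSup ξ q, killedEnd ξ q)).prod p.toMeasure
  have hprob : IsProbabilityMeasure m := by
    have := hL.measurable_killedSup.prodMk hL.measurable_killedEnd
    have : IsProbabilityMeasure ((P₀.prod lifeLaw).map fun q => (killedSup ξ q, killedEnd ξ q)) :=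
      Measure.isProbabilityMeasure_map this.aemeasurable
    infer_instance
  have h1 : P {ω | (x : EReal) < Z.maxPosition ω} =
      P (Z.mark ⁻¹' ⋃ n, {r | TreeExceeds n x r}) := by
    refine measure_congr ?_
    filter_upwards [hZ.ae_good hL] with ω ⟨h1, h2, h3⟩
    refine propext ((BranchingData.lt_maxPosition_iff h1 h2 h3 hx).trans ?_)
    change _ ↔ Z.mark ω ∈ ⋃ n, {r | TreeExceeds n x r}
    simp
  have hmono : Monotone fun n => {r | TreeExceeds n x r} :=
    monotone_nat_of_le_succ fun n r h => TreeExceeds.succ h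
  have h2 := tendsto_measure_iUnion_atTop (μ := treeLaw m) hmono
  rw [← hZ.map_mark_eq_treeLaw hL, Measure.map_apply hZ.measurable_mark
    (MeasurableSet.iUnion fun n => measurableSet_treeExceeds_right n x), ← h1,
    hZ.map_mark_eq_treeLaw hL] at h2
  have h3 := (ENNReal.tendsto_toReal (measure_ne_top _ _)).comp h2
  refine tendsto_nhds_unique h3 (tendsto_atTop_ciSup (monotone_treeTail m x) ⟨1, ?_⟩)
  rintro _ ⟨n, rfl⟩
  exact treeTail_le_one m n x

end BranchingLaw

/-! ### From the strict to the weak tail, and the conclusion. -/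

section Limit

/-- The function `g` lies between `f x` and `f (x - 1/x)`. The shift tends to zero, so it costs only
the factor `e^(lam/x) → 1`. Here `f` is the tail for `>` and `g` the tail for `≥`. -/
lemma tendsto_exp_mul_of_sandwich {lam C : ℝ} {f g : ℝ → ℝ}
    (hf : Tendsto (fun x => Real.exp (lam * x) * f x) atTop (𝓝 C)) (hle : ∀ x, 0 ≤ x → f x ≤ g x)
    (hge : ∀ x y, 0 ≤ x → x < y → g y ≤ f x) :
    Tendsto (fun x => Real.exp (lam * x) * g x) atTop (𝓝 C) := by
  have hinv : Tendsto (fun x : ℝ => x⁻¹) atTop (𝓝 0) := tendsto_inv_atTop_zero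
  have hshift : Tendsto (fun x : ℝ => x - x⁻¹) atTop atTop :=
    tendsto_id.atTop_add (C := -0) hinv.neg
  have hup : Tendsto (fun x : ℝ => Real.exp (lam * x⁻¹) *
      (Real.exp (lam * (x - x⁻¹)) * f (x - x⁻¹))) atTop (𝓝 C) := by
    have h1 : Tendsto (fun x : ℝ => Real.exp (lam * x⁻¹)) atTop (𝓝 1) := by
      have := (Real.continuous_exp.tendsto _).comp (hinv.const_mul lam)
      rw [mul_zero, Real.exp_zero] at this
      exact this
    simpa using h1.mul (hf.comp hshift)
  refine tendsto_of_tendsto_of_tendsto_of_le_of_le' hf hup ?_ ?_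
  · filter_upwards [eventually_ge_atTop 0] with x hx
    gcongr
    exact hle x hx
  · filter_upwards [eventually_ge_atTop 1] with x hx
    rw [← mul_assoc, ← Real.exp_add, show lam * x⁻¹ + lam * (x - x⁻¹) = lam * x by ring]
    have h1 : x⁻¹ ≤ 1 := inv_le_one_of_one_le₀ hx
    have h2 : 0 < x⁻¹ := by positivity
    gcongr
    exact hge _ _ (by linarith) (by linarith)

end Limit

/-- The case `m = 0` stands apart because the linearization defect divides by `survivalFunction p
1`, which then vanishes; there `lam = ρ`, and the ancestor alone gives the lower bound. -/
lemma IsRenewalIteration.exists_tendsto_survivalFunction {p : PMF ℕ} (hm : offspringMean p < 1)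
    (hLlogL : Summable fun k : ℕ => (k : ℝ) * Real.log k * (p k).toReal) {ρ lam : ℝ}
    {ν : Measure ℝ} [IsProbabilityMeasure ν] {u : ℕ → ℝ → ℝ}
    (hu : IsRenewalIteration ρ (survivalFunction p) ν u) (hρ : 0 < ρ) (hlam : 0 < lam)
    (hν : ∀ᵐ d ∂ν, 0 ≤ d)
    (hlap : ρ * (offspringMean p).toReal * ∫ d, Real.exp (-lam * d) ∂ν = ρ - lam) :
    ∃ C, 0 < C ∧ Tendsto (fun x => Real.exp (lam * x) * ⨆ n, u n x) atTop (𝓝 C) := by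
  have hF := isSurvivalFunction_survivalFunction hm
  have hm0 : 0 ≤ (offspringMean p).toReal := ENNReal.toReal_nonneg
  rcases hm0.eq_or_lt with h0 | h0
  · rw [← h0, mul_zero, zero_mul] at hlap
    have hρlam : ρ = lam := by linarith
    refine hu.exists_tendsto_exp_mul_iSup hF hρ hm0 hlam hν ?_ one_pos fun x hx => ?_
    · rw [← h0, mul_zero, zero_mul, hlap]
    · rw [← hρlam]
      exact hu.exp_neg_le_iSup hF hρ hx
  · obtain ⟨B, hB⟩ := exists_integral_linearizationDefect_le hm hLlogL hlam
    obtain ⟨c, hc, hle⟩ := hu.exists_pos_le_exp_mul_iSup hF hρ hm0 (toReal_offspringMean_lt_one hm)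
      hlam hν hlap (continuous_linearizationDefect hm lam)
      (antitone_linearizationDefect hm hlam.le) (linearizationDefect_nonneg p lam) hB
      fun x s hx h0s hs => mul_exp_neg_linearizationDefect_le hm h0 hlam hx h0s hs
    exact hu.exists_tendsto_exp_mul_iSup hF hρ hm0 hlam hν hlap hc hle

theorem theorem3 {Ω₀ : Type*} [MeasurableSpace Ω₀] (P₀ : Measure Ω₀) [IsProbabilityMeasure P₀]
    (ξ : ℝ≥0 → Ω₀ → ℝ) (α cPos cNeg η : ℝ)
    (hξ : IsStrictlyStableProcess α cPos cNeg η ξ P₀)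
    (hcPos : cPos = 0)
    (hα : (1 < α ∧ α < 2 ∧ 0 < cNeg) ∨ (α = 1 ∧ cNeg = 0 ∧ η < 0))
    (p : PMF ℕ) (hm : offspringMean p < 1)
    (hLlogL : Summable fun k : ℕ => (k : ℝ) * Real.log k * (p k).toReal) :
    0 < laplaceConstant ξ P₀ ∧
    ∃ C₄ : ℝ, 0 < C₄ ∧
      ∀ {Ω : Type*} [MeasurableSpace Ω] (P : Measure Ω) [IsProbabilityMeasure P]
        (Z : BranchingData Ω), IsBranchingLevyProcess Z P ξ P₀ p →
        Tendsto (fun x : ℝ =>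
            Real.exp (((1 - (offspringMean p).toReal) / laplaceConstant ξ P₀) ^ (1 / α) * x) *
              P.real {ω | (x : EReal) ≤ Z.maxPosition ω})
          atTop (𝓝 C₄) := by
  subst hcPos
  have hC := hξ.laplaceConstant_pos hα
  refine ⟨hC, ?_⟩
  have hα0 : 0 < α := by rcases hα with h | h <;> linarith [h.1]
  have hL := hξ.levy
  have hm0 : 0 ≤ (offspringMean p).toReal := ENNReal.toReal_nonneg
  have hm1 := toReal_offspringMean_lt_one hm
  set C := laplaceConstant ξ P₀
  set m := (offspringMean p).toReal
  set lam := ((1 - m) / C) ^ (1 / α) with hlam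
  set ρ := (1 / C) ^ (1 / α) with hρ
  have hlam0 : 0 < lam := Real.rpow_pos_of_pos (div_pos (sub_pos.2 hm1) hC) _
  have hρ0 : 0 < ρ := by positivity
  have hlamα : C * lam ^ α = 1 - m := by
    rw [hlam, ← Real.rpow_mul (div_nonneg (sub_nonneg.2 hm1.le) hC.le),
      one_div_mul_cancel hα0.ne', Real.rpow_one, mul_div_cancel₀ _ hC.ne']
  obtain ⟨ν, hνp, hν, hκ, hlaw⟩ := hξ.exists_map_killedSup_killedEnd hα0 hC hρ
  -- The transform of `ν` is available only for `θ < ρ`, which excludes `lam = ρ`, that is `m = 0`;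
  -- both sides vanish in that case.
  have hlap : ρ * m * ∫ d, Real.exp (-lam * d) ∂ν = ρ - lam := by
    rcases hm0.eq_or_lt with h0 | h0
    · rw [hlam, hρ, ← h0]
      simp
    · have h := hlaw lam hlam0.le (Real.rpow_lt_rpow (div_nonneg (sub_nonneg.2 hm1.le) hC.le)
        (div_lt_div_of_pos_right (by linarith) hC) (by positivity))
      rwa [hlamα, sub_sub_cancel] at h
  have hκp : IsProbabilityMeasure
      ((P₀.prod lifeLaw).map fun q => (killedSup ξ q, killedEnd ξ q)) :=
    Measure.isProbabilityMeasure_map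
      (hL.measurable_killedSup.prodMk hL.measurable_killedEnd).aemeasurable
  -- The iteration involves only the law of one killed path and `p`, so the constant is fixed before
  -- any branching process is chosen.
  obtain ⟨C₄, hC₄, hlim⟩ := (isRenewalIteration_treeTail hρ0 hm
    hκ).exists_tendsto_survivalFunction hm hLlogL hρ0 hlam0 hν hlap
  refine ⟨C₄, hC₄, fun P _ Z hZ => tendsto_exp_mul_of_sandwich hlim (fun x hx => ?_)
    fun x y hx hxy => ?_⟩
  · rw [← hZ.measure_lt_maxPosition hL hx]
    exact measureReal_mono fun ω (hω : (x : EReal) < Z.maxPosition ω) => hω.le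
  · rw [← hZ.measure_lt_maxPosition hL hx]
    exact measureReal_mono fun ω hω => lt_of_lt_of_le (EReal.coe_lt_coe_iff.2 hxy) hω
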